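/- **Setting.** Work in the upper half-plane model of $\mathbb H^2$ with the action of $\mathrm{PSL}(2,\mathbb R)$ by Möbius transformations; "congruent" means congruent under this group. *The tile.* Let the core be $\gamma=\{0\le \operatorname{Re} z\le 2,\ 1\le \operatorname{Im} z\le 2\}$. The densest horoball packing $\bar P$ consists of the images of $\{\operatorname{Im} z\ge 1\}$ under $\mathrm{PSL}(2,\mathbb Z)$; the complementary gaps, each bounded by three pairwise tangent horoballs, are called triangles. Cut the triangle between the horoballs based at $\infty,0,1$ into three congruent pieces by the geodesics from its centre $\frac{1+\sqrt3 i}{2}$ to the three tangency points, and let $\pi$ be the piece adjacent to $\{\operatorname{Im} z\ge1\}$. The modified binary tile $\bar\tau$ is obtained from $\gamma$ by adding the left prong $\pi$ and the right prong $\pi+1$ below the lower edge, removing $2\pi$ (the dent) at the upper edge, and adding a small bump on the right vertical edge and the matching dent (its translate by $-2$) in the left vertical edge; for definiteness, the vertical edges are replaced by the curves $\operatorname{Re} z=\beta(\operatorname{Im} z)$ and $\operatorname{Re} z=2+\beta(\operatorname{Im} z)$ with $\beta(y)=\max(0,\frac18-|y-\frac{11}8|)$. *Tilings.* A tiling by $\bar\tau$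 is a collection of copies $g\bar\tau$, $g\in \mathrm{PSL}(2,\mathbb R)$, that covers $\mathbb H^2$ and whose interiors are pairwise disjoint. The space of all such tilings carries the topology of uniform convergence on compact subsets of $\mathbb H^2$, its Borel $\sigma$-algebra, and the natural action of $\mathrm{PSL}(2,\mathbb R)$. A tiling is nondegenerate if the union of the cores of its tiles is the union of the horoballs of a packing congruent to $\bar P$. *Dyadic indices.* Let $H$ be a horoball of the packing of a nondegenerate tiling and $\Delta$ a triangle of the packing adjacent to $H$. The dyadic index of $H$ measured from $\Delta$ is $\sum_{i\ge0}a_i2^i\in\mathbb Z_2$, $a_i\in\{0,1\}$, where $a_0$ is $0$ or $1$ according as the left or the right prong of a tile of $H$ sticks into $\Delta$, and, starting from that tile, $a_1,a_2,\dots$ tell successively whether the tile emerges from the left ($0$) or right ($1$) prong of its parent (its dent being filled by that prong), then the same for the parent, and so on. **Theorem.** For each dyadic integer $w\in\mathbb Z_2$ let $\mathcal T_w$ be the closure, in the space of tilings by $\bar\tau$, of the class of nondegenerate tilings in which at each triangle the dyadic indices of the three adjacent horoballs sum to $w$. Then $\mathcal T_w$ is uniquely ergodic under $\mathrm{PSL}(2,\mathbb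 R)$: there is exactly one $\mathrm{PSL}(2,\mathbb R)$-invariant Borel probability measure on $\mathcal T_w$. -/

import Mathlib

open MeasureTheory UpperHalfPlane Set
open scoped Pointwise MatrixGroups

noncomputable section

namespace ModifiedBinary

/-- The group `PSL(2, ℝ)` of orientation-preserving rigid motions of the hyperbolic plane. -/
abbrev PSL2R : Type := Matrix.ProjectiveSpecialLinearGroup (Fin 2) ℝ

theorem center_smul (A : SL(2, ℝ)) (hA : A ∈ Subgroup.center SL(2, ℝ)) (z : ℍ) : A • z = z := by
  obtain ⟨r, hr, hrA⟩ := Matrix.SpecialLinearGroup.mem_center_iff.mp hA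
  have hr0 : (r : ℂ) ≠ 0 := by
    rintro h
    simp [Complex.ofReal_eq_zero.mp h] at hr
  ext1
  rw [coe_specialLinearGroup_apply, ← hrA]
  simp [hr0]

/-- The action of `PSL(2, ℝ)` on the upper half plane by Möbius transformations, induced by
Mathlib's action of `SL(2, ℝ)`. -/
instance : MulAction PSL2R ℍ :=
  MulAction.compHom ℍ (QuotientGroup.lift (Subgroup.center SL(2, ℝ))
    (MulAction.toPermHom SL(2, ℝ) ℍ) (fun A hA => Equiv.ext (center_smul A hA)))

/-- The class of a matrix in `PSL(2, ℝ)`. -/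
def toPSL : SL(2, ℝ) →* PSL2R := QuotientGroup.mk' (Subgroup.center SL(2, ℝ))

theorem toPSL_smul (A : SL(2, ℝ)) (z : ℍ) : toPSL A • z = A • z := rfl

instance : IsIsometricSMul PSL2R ℍ where
  isometry_smul g := by
    obtain ⟨A, rfl⟩ := QuotientGroup.mk'_surjective _ g
    exact isometry_smul ℍ A

/-- The matrix of `z ↦ z + 1`. -/
def shiftMatrix : SL(2, ℝ) := ⟨!![1, 1; 0, 1], by simp⟩

/-- The matrix of `z ↦ z / 2`. -/
def halfMatrix : SL(2, ℝ) := ⟨!![(√2)⁻¹, 0; 0, √2], by simp⟩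

/-- The matrix of `z ↦ 1 / (1 - z)`. -/
def rotMatrix : SL(2, ℝ) := ⟨!![0, 1; -1, 1], by simp⟩

/-- The motion `z ↦ z + 1`. -/
def shift : PSL2R := toPSL shiftMatrix

/-- The motion `z ↦ z / 2`. -/
def half : PSL2R := toPSL halfMatrix

/-- The motion `z ↦ 1 / (1 - z)`: the rotation by a third of a turn about `(1 + √3 i) / 2`,
which permutes the horoballs at `∞`, `0` and `1` cyclically. -/
def rot : PSL2R := toPSL rotMatrix

/-- The modular group `PSL(2, ℤ)`, as a subgroup of `PSL(2, ℝ)`. -/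
def modular : Subgroup PSL2R :=
  (toPSL.comp (Matrix.SpecialLinearGroup.map (Int.castRingHom ℝ))).range

/-- The core of the tile, with vertices `i`, `2 + i`, `2i`, `2 + 2i`: two geodesic edges
(`re = 0` and `re = 2`) and two horocyclic edges (`im = 1` and `im = 2`). -/
def core : Set ℍ := {z | 0 ≤ z.re ∧ z.re ≤ 2 ∧ 1 ≤ z.im ∧ z.im ≤ 2}

/-- The profile of the bump carried by the right geodesic edge of the core, and of the matching
dent in the left one: a small triangle over the heights `[5/4, 3/2]`. -/
def bump (y : ℝ) : ℝ := max 0 (1 / 8 - |y - 11 / 8|)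

/-- The modified binary tile.

* The geodesic edges of the core are replaced by `re = bump im` (a dent) and
  `re = 2 + bump im` (a bump).
* Under each half `[k, k + 1]`, `k = 0, 1`, of the lower horocyclic edge of the core a prong is
  added. Among the horoballs `im ≥ 1` and those tangent to it and based at `k` and `k + 1`, the
  gap is the triangular region with centre `k + 1/2 + (√3/2) i`; the prong is the third of this
  gap that touches `im ≥ 1`, cut out by the geodesics from the centre to the tangency points
  `k + i` and `k + 1 + i`, which are arcs of the unit circles about `k` and `k + 1`.
* The upper horocyclic edge gets the dent into which such a prong fits: the image of the prong
  with `k = 0` under `z ↦ 2z`, bounded below by arcs of the circles of radius `2` about `0`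
  and `2`. -/
def tile : Set ℍ :=
  {z | bump z.im ≤ z.re ∧ z.re ≤ 2 + bump z.im ∧
    1 ≤ ‖(z : ℂ)‖ ∧ 1 ≤ ‖(z : ℂ) - 1‖ ∧ 1 ≤ ‖(z : ℂ) - 2‖ ∧
    (‖(z : ℂ)‖ ≤ 2 ∨ ‖(z : ℂ) - 2‖ ≤ 2)}

/-- A tiling of the hyperbolic plane by congruent copies of the modified binary tile. The bumps
leave the tile without symmetries, so a copy `g • tile` is recorded by its motion `g`. -/
@[ext]
structure Tiling where
  /-- The motions carrying the tile to its copies in the tiling. -/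
  motions : Set PSL2R
  covers : (⋃ g ∈ motions, g • tile) = univ
  disjoint_interior : motions.Pairwise fun g h =>
    Disjoint (interior (g • tile)) (interior (h • tile))

/-- Every copy in `S` that meets `K` is uniformly `ε`-close to a copy in `T`. -/
def NearOn (K : Set ℍ) (ε : ℝ) (S T : Tiling) : Prop :=
  ∀ g ∈ S.motions, (g • tile ∩ K).Nonempty →
    ∃ h ∈ T.motions, ∀ z ∈ tile, dist (g • z) (h • z) ≤ ε

/-- The topology of uniform convergence on compact subsets of the hyperbolic plane. -/
instance : TopologicalSpace Tiling where
  IsOpen U := ∀ T ∈ U, ∃ K : Set ℍ, IsCompact K ∧ ∃ ε > 0,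
    ∀ S, NearOn K ε S T → NearOn K ε T S → S ∈ U
  isOpen_univ := fun _ _ => ⟨∅, isCompact_empty, 1, one_pos, fun _ _ _ => mem_univ _⟩
  isOpen_inter := by
    rintro U V hU hV T ⟨hTU, hTV⟩
    obtain ⟨K, hK, ε, hε, h⟩ := hU T hTU
    obtain ⟨K', hK', ε', hε', h'⟩ := hV T hTV
    have key : ∀ A B : Tiling, NearOn (K ∪ K') (min ε ε') A B →
        NearOn K ε A B ∧ NearOn K' ε' A B := fun A B hAB =>
      ⟨fun g hg hgK => (hAB g hg (hgK.mono (inter_subset_inter_right _ subset_union_left))).imp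
          fun k hk => ⟨hk.1, fun z hz => (hk.2 z hz).trans (min_le_left _ _)⟩,
        fun g hg hgK => (hAB g hg (hgK.mono (inter_subset_inter_right _ subset_union_right))).imp
          fun k hk => ⟨hk.1, fun z hz => (hk.2 z hz).trans (min_le_right _ _)⟩⟩
    exact ⟨K ∪ K', hK.union hK', min ε ε', lt_min hε hε', fun S h1 h2 =>
      ⟨h S (key _ _ h1).1 (key _ _ h2).1, h' S (key _ _ h1).2 (key _ _ h2).2⟩⟩
  isOpen_sUnion := by
    rintro 𝒰 h𝒰 T ⟨U, hU, hTU⟩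
    obtain ⟨K, hK, ε, hε, h⟩ := h𝒰 U hU T hTU
    exact ⟨K, hK, ε, hε, fun S h1 h2 => ⟨U, hU, h S h1 h2⟩⟩

/-- The Borel `σ`-algebra on the space of tilings. -/
instance : MeasurableSpace Tiling := borel Tiling

instance : BorelSpace Tiling := ⟨rfl⟩

/-- Rigid motions act on tilings by moving every tile. -/
instance : MulAction PSL2R Tiling where
  smul g T :=
    { motions := g • T.motions
      covers := by
        have h := T.covers
        rw [eq_univ_iff_forall] at h ⊢
        intro z
        obtain ⟨k, hk, hz⟩ := mem_iUnion₂.mp (h (g⁻¹ • z))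
        refine mem_iUnion₂.mpr ⟨g * k, smul_mem_smul_set hk, ?_⟩
        rwa [mul_smul, mem_smul_set_iff_inv_smul_mem]
      disjoint_interior := by
        rintro _ ⟨k, hk, rfl⟩ _ ⟨l, hl, rfl⟩ hkl
        have h := T.disjoint_interior hk hl (fun e => hkl (by rw [e]))
        simp only [smul_eq_mul, mul_smul, interior_smul] at h ⊢
        exact disjoint_smul_set.mpr h }
  one_smul T := Tiling.ext (one_smul PSL2R T.motions)
  mul_smul g h T := Tiling.ext (mul_smul g h T.motions)

/-- The union of the horoballs in the densest horoball packing of the upper half plane, whose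
horoballs are the images of `{im ≥ 1}` under the modular group. Its gaps ("triangles") are the
images under the modular group of the gap between the horoballs at `∞`, `0` and `1`. -/
def horoballs : Set ℍ := ⋃ γ ∈ modular, γ • {z : ℍ | 1 ≤ z.im}

/-- A dyadic integer, given by its binary digits. -/
def dyadic (a : ℕ → Fin 2) : ℤ_[2] := ∑' n, ((a n : ℕ) : ℤ_[2]) * 2 ^ n

/-- `HasIndex T f a`: measured from the triangle that is the image under `f` of the gap between
the horoballs at `∞`, `0` and `1`, the horoball `f • {im ≥ 1}` has the dyadic index with binary
digits `a` in the tiling `T`.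

Digits are `0` for left and `1` for right, and the left and the right prong of the copy `g • tile`
are the images of the standard prong below `[0, 1]` under `g` and `g * shift`. The digit `a 0`
tells which prong of the copy `g 0` sticks into the triangle, and `a (n + 1)` tells from which
prong of its parent `g (n + 1)` the copy `g n` emerges, i.e. which prong fills its dent. -/
def HasIndex (T : Tiling) (f : PSL2R) (a : ℕ → Fin 2) : Prop :=
  ∃ g : ℕ → PSL2R, (∀ n, g n ∈ T.motions) ∧
    f = g 0 * shift ^ (a 0 : ℕ) ∧
    ∀ n, g n = g (n + 1) * shift ^ (a (n + 1) : ℕ) * half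

/-- The nondegenerate tilings (the cores of the tiles fill up the horoballs of a densest horoball
packing `h • horoballs`) in which, at each triangle of the packing, the dyadic indices of the
three horoballs around the triangle sum to `w`. -/
def fixedSum (w : ℤ_[2]) : Set Tiling :=
  {T | ∃ h : PSL2R, (⋃ g ∈ T.motions, g • core) = h • horoballs ∧
    ∀ γ ∈ modular, ∃ a b c : ℕ → Fin 2,
      HasIndex T (h * γ) a ∧ HasIndex T (h * γ * rot) b ∧ HasIndex T (h * γ * rot ^ 2) c ∧
      dyadic a + dyadic b + dyadic c = w}

/-- The space of tilings with fixed sum `w`: the closure of the class above. -/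
def tilingSpace (w : ℤ_[2]) : Set Tiling := closure (fixedSum w)

/-- Unique ergodicity of the action of `G` on `X`: there is exactly one Borel probability measure
on `X` (that is, on the ambient space and carried by `X`) that is invariant under `G`. -/
def UniquelyErgodicOn (G : Type*) {Ω : Type*} [SMul G Ω] [MeasurableSpace Ω] (X : Set Ω) : Prop :=
  ∃! μ : Measure Ω, IsProbabilityMeasure μ ∧ μ Xᶜ = 0 ∧
    ∀ g : G, MeasurePreserving (fun x => g • x) μ μ

end ModifiedBinary

end

/-! A nondegenerate tiling amounts to a packing congruent to the modular one together with its
dyadic indices. Passing to the next triangle along a horoball adds 1 to the index, and the fixed sum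
`w` yields the third index at a triangle from the other two, so the pair of indices at two horoballs
of one reference triangle determines all the others. Crossing a tangency point and turning a
triangle generate PSL(2,ℤ) as a free product of groups of order 2 and 3, so their effects on pairs
extend consistently to an action of SL(2,ℤ) on ℤ₂² by affine homeomorphisms (`indexAction`), and
every pair occurs. Hence the nondegenerate tilings are exactly the quotient of SL(2,ℝ) × ℤ₂² by
SL(2,ℤ) (`tilingAt`, `fixedSum_eq_range`, `exists_of_tilingAt_eq`).

In a limit outside this class all copies point to one common boundary point
(`lowerLeft_eq_zero_of_mem_closure`). A finite invariant measure on such limits would induce a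
finite invariant measure on the boundary circle, and translations already force that to vanish
(`measure_closure_diff_range`).

It remains to treat the quotient. An invariant probability measure lifts to SL(2,ℝ) × ℤ₂² by
counting orbit points; the lift is left invariant, hence Haar in the first factor, and its second
factor is invariant under `indexAction` (`liftMeasure_eq`). On ℤ₂² only the Haar measure is
invariant (`eq_haarPair_of_indexAction`): two steps around a horoball translate the pair by (2, -1),
the conjugate by a turn translates it by (-1, 2), and the determinant 3 of these vectors is a unit
in ℤ₂, so the translations are dense. Conversely, Haar measure gives an invariant probability
measure because SL(2,ℤ) has finite covolume. -/

noncomputable section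

namespace ModifiedBinary

/-! ### Motions composed of a modular element and a scaling by a power of two. -/

/-- The inclusion of `SL(2, ℤ)` into `SL(2, ℝ)`. -/
def incl : SL(2, ℤ) →* SL(2, ℝ) := Matrix.SpecialLinearGroup.map (Int.castRingHom ℝ)

@[simp]
theorem incl_apply (δ : SL(2, ℤ)) (i j : Fin 2) : incl δ i j = (δ i j : ℝ) := rfl

theorem incl_smul (δ : SL(2, ℤ)) (z : ℍ) : incl δ • z = δ • z := by
  ext1
  rw [coe_specialLinearGroup_apply, coe_specialLinearGroup_apply]
  simp

theorem incl_injective : Function.Injective incl := by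
  intro γ δ h
  ext i j
  have := congrArg (fun A : SL(2, ℝ) => A i j) h
  simpa using this

theorem toPSL_surjective : Function.Surjective toPSL := QuotientGroup.mk'_surjective _

theorem toPSL_eq_iff {A B : SL(2, ℝ)} : toPSL A = toPSL B ↔ A = B ∨ A = -B := by
  unfold toPSL
  rw [QuotientGroup.mk'_apply, QuotientGroup.mk'_apply, QuotientGroup.eq,
    Matrix.SpecialLinearGroup.mem_center_iff]
  constructor
  · rintro ⟨r, hr, h⟩
    have hr' : r = 1 ∨ r = -1 := by simpa using hr
    have hB : (B : Matrix (Fin 2) (Fin 2) ℝ) = A * Matrix.scalar (Fin 2) r := by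
      rw [h, Matrix.SpecialLinearGroup.coe_mul, ← Matrix.mul_assoc,
        ← Matrix.SpecialLinearGroup.coe_mul]
      simp
    rcases hr' with rfl | rfl
    · left; ext i j; simp [hB]
    · right; ext i j; simp [hB]
  · rintro (rfl | rfl)
    · exact ⟨1, by simp, by simp⟩
    · exact ⟨-1, by simp, by ext i j; fin_cases i <;> fin_cases j <;> simp⟩

theorem toPSL_neg (A : SL(2, ℝ)) : toPSL (-A) = toPSL A := toPSL_eq_iff.mpr (Or.inr rfl)

/-- The matrix of `z ↦ 2 ^ n * z`. -/
def dil (n : ℕ) : SL(2, ℝ) := ⟨!![√2 ^ n, 0; 0, (√2 ^ n)⁻¹], by simp⟩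

theorem coe_dil (n : ℕ) :
    (dil n : Matrix (Fin 2) (Fin 2) ℝ) = !![√2 ^ n, 0; 0, (√2 ^ n)⁻¹] := rfl

theorem coe_half : (halfMatrix : Matrix (Fin 2) (Fin 2) ℝ) = !![(√2)⁻¹, 0; 0, √2] := rfl

theorem coe_shift : (shiftMatrix : Matrix (Fin 2) (Fin 2) ℝ) = !![1, 1; 0, 1] := rfl

theorem coe_rot : (rotMatrix : Matrix (Fin 2) (Fin 2) ℝ) = !![0, 1; -1, 1] := rfl

@[simp] theorem dil_zero : dil 0 = 1 := by ext i j; fin_cases i <;> fin_cases j <;> simp [coe_dil]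

theorem dil_succ_mul_half (n : ℕ) : dil (n + 1) * halfMatrix = dil n := by
  ext i j
  fin_cases i <;> fin_cases j <;> simp [coe_dil, coe_half, pow_succ]
  field_simp

theorem coe_dil_smul (n : ℕ) (z : ℍ) : ((dil n • z : ℍ) : ℂ) = 2 ^ n * z := by
  rw [coe_specialLinearGroup_apply]
  have h : ((√2 : ℝ) : ℂ) * (√2 : ℝ) = 2 := by
    rw [← Complex.ofReal_mul, Real.mul_self_sqrt (by norm_num)]; norm_num
  simp [coe_dil]
  rw [mul_right_comm, ← mul_pow, h]

theorem im_dil_smul (n : ℕ) (z : ℍ) : (dil n • z).im = 2 ^ n * z.im := by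
  have := congrArg Complex.im (coe_dil_smul n z)
  rw [show (2 ^ n : ℂ) = ((2 ^ n : ℝ) : ℂ) by push_cast; rfl, Complex.im_ofReal_mul] at this
  exact this

theorem re_dil_smul (n : ℕ) (z : ℍ) : (dil n • z).re = 2 ^ n * z.re := by
  have := congrArg Complex.re (coe_dil_smul n z)
  rw [show (2 ^ n : ℂ) = ((2 ^ n : ℝ) : ℂ) by push_cast; rfl, Complex.re_ofReal_mul] at this
  exact this

theorem incl_T : incl ModularGroup.T = shiftMatrix := by
  ext i j
  fin_cases i <;> fin_cases j <;> simp [ModularGroup.coe_T, coe_shift]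

/-- The matrix of `z ↦ 1 / (1 - z)`, with integer entries. -/
def rotInt : SL(2, ℤ) := ⟨!![0, 1; -1, 1], by simp⟩

theorem coe_rotInt : (rotInt : Matrix (Fin 2) (Fin 2) ℤ) = !![0, 1; -1, 1] := rfl

theorem incl_rotInt : incl rotInt = rotMatrix := by
  ext i j
  fin_cases i <;> fin_cases j <;> simp [coe_rotInt, coe_rot]

theorem dil_mul_T (n : ℕ) (k : ℤ) :
    dil n * incl (ModularGroup.T ^ k) = incl (ModularGroup.T ^ (2 ^ n * k)) * dil n := by
  have h : √2 ^ n * √2 ^ n = 2 ^ n := by rw [← mul_pow, Real.mul_self_sqrt (by norm_num)]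
  have h' : √2 ^ n ≠ 0 := by positivity
  ext i j
  fin_cases i <;> fin_cases j <;>
    simp [coe_dil, Matrix.mul_apply, ModularGroup.coe_T_zpow, -map_zpow]
  rw [← h]; field_simp

theorem coe_T_smul (k : ℤ) (z : ℍ) : ((incl (ModularGroup.T ^ k) • z : ℍ) : ℂ) = z + k := by
  rw [incl_smul, ModularGroup.coe_T_zpow_smul_eq]

/-- The motion `δ ∘ (z ↦ 2 ^ n z)`. -/
def place (δ : SL(2, ℤ)) (n : ℕ) : PSL2R := toPSL (incl δ * dil n)

theorem place_succ_mul_half (δ : SL(2, ℤ)) (n : ℕ) : place δ (n + 1) * half = place δ n := by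
  rw [place, half, ← map_mul, mul_assoc, dil_succ_mul_half, place]

/-- A matrix of the form `γ⁻¹ * δ * dil n` is not integral unless `n = 0`. -/
theorem incl_mul_dil_eq {γ δ : SL(2, ℤ)} {n : ℕ} (h : incl γ * dil n = incl δ) : n = 0 := by
  have h2 : dil n = incl (γ⁻¹ * δ) := by rw [map_mul, ← h, map_inv]; group
  have h3 := congrArg (fun A : SL(2, ℝ) => A 1 1) h2
  simp only [coe_dil, incl_apply] at h3
  simp only [Matrix.of_apply, Matrix.cons_val', Matrix.cons_val_one, Matrix.cons_val_fin_one] at h3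
  by_contra hn
  have h1 : (1 : ℝ) < √2 ^ n := one_lt_pow₀ (by rw [Real.lt_sqrt] <;> norm_num) hn
  have h4 : (0 : ℝ) < (√2 ^ n)⁻¹ := by positivity
  have h5 : (√2 ^ n)⁻¹ < 1 := inv_lt_one_of_one_lt₀ h1
  rw [h3] at h4 h5
  norm_cast at h4 h5
  omega

theorem incl_neg (δ : SL(2, ℤ)) : incl (-δ) = -incl δ := by
  ext i j; simp

theorem dil_add (m n : ℕ) : dil (m + n) = dil m * dil n := by
  ext i j
  fin_cases i <;> fin_cases j <;> simp [coe_dil, pow_add, mul_comm]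

theorem place_eq_iff {γ δ : SL(2, ℤ)} {m n : ℕ} :
    place γ m = place δ n ↔ m = n ∧ (γ = δ ∨ γ = -δ) := by
  constructor
  · have key : ∀ {γ δ : SL(2, ℤ)} {m n : ℕ}, n ≤ m → incl γ * dil m = incl δ * dil n →
        m = n ∧ γ = δ := by
      intro γ δ m n hmn h
      obtain ⟨k, rfl⟩ := Nat.exists_eq_add_of_le' hmn
      rw [dil_add, ← mul_assoc, mul_left_inj] at h
      have := incl_mul_dil_eq h
      subst this
      rw [dil_zero, mul_one] at h
      exact ⟨by simp, incl_injective h⟩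
    intro h
    have h' : incl γ * dil m = incl δ * dil n ∨ incl γ * dil m = incl (-δ) * dil n := by
      rw [incl_neg, neg_mul]; exact toPSL_eq_iff.mp h
    rcases le_total n m with hmn | hmn
    · rcases h' with h' | h'
      · exact ⟨(key hmn h').1, Or.inl (key hmn h').2⟩
      · exact ⟨(key hmn h').1, Or.inr (key hmn h').2⟩
    · rcases h' with h' | h'
      · exact ⟨(key hmn h'.symm).1.symm, Or.inl (key hmn h'.symm).2.symm⟩
      · exact ⟨(key hmn h'.symm).1.symm, Or.inr (key hmn h'.symm).2.symm⟩
  · rintro ⟨rfl, rfl | rfl⟩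
    · rfl
    · rw [place, place, incl_neg, neg_mul, toPSL_neg]

/-- A copy of level 0 has no child. This later singles out the bottom copies of the horoballs from
the set of motions alone. -/
theorem place_ne_mul_half {γ δ : SL(2, ℤ)} (n : ℕ) : place γ n ≠ place δ 0 * half := by
  intro h
  have h2 : place γ (n + 1) = place δ 0 := by
    rw [← place_succ_mul_half] at h
    exact mul_right_cancel h
  simpa using (place_eq_iff.mp h2).1

theorem shift_zpow (k : ℤ) : shift ^ k = toPSL (incl (ModularGroup.T ^ k)) := by
  rw [shift, ← incl_T, map_zpow, map_zpow]

theorem place_mul_shift_zpow (δ : SL(2, ℤ)) (n : ℕ) (k : ℤ) :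
    place δ n * shift ^ k = place (δ * ModularGroup.T ^ (2 ^ n * k)) n := by
  rw [shift_zpow, place, ← map_mul, mul_assoc, dil_mul_T, ← mul_assoc, ← map_mul, place]

theorem place_smul (δ : SL(2, ℤ)) (n : ℕ) (z : ℍ) : place δ n • z = incl δ • dil n • z := by
  rw [place, toPSL_smul, mul_smul]

theorem mem_modular_iff {f : PSL2R} : f ∈ modular ↔ ∃ γ : SL(2, ℤ), toPSL (incl γ) = f := Iff.rfl

/-! ### The tile in coordinates and its interior. -/

theorem sq_norm_sub (z : ℍ) (a : ℝ) : ‖(z : ℂ) - a‖ ^ 2 = (z.re - a) ^ 2 + z.im ^ 2 := by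
  rw [← Complex.normSq_eq_norm_sq, Complex.normSq_apply]
  simp [sq]

theorem le_norm_sub_iff (z : ℍ) (a : ℝ) {r : ℝ} (hr : 0 ≤ r) :
    r ≤ ‖(z : ℂ) - a‖ ↔ r ^ 2 ≤ (z.re - a) ^ 2 + z.im ^ 2 := by
  rw [← sq_norm_sub, sq_le_sq₀ hr (norm_nonneg _)]

theorem lt_norm_sub_iff (z : ℍ) (a : ℝ) {r : ℝ} (hr : 0 ≤ r) :
    r < ‖(z : ℂ) - a‖ ↔ r ^ 2 < (z.re - a) ^ 2 + z.im ^ 2 := by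
  rw [← sq_norm_sub, sq_lt_sq₀ hr (norm_nonneg _)]

theorem norm_sub_le_iff (z : ℍ) (a : ℝ) {r : ℝ} (hr : 0 ≤ r) :
    ‖(z : ℂ) - a‖ ≤ r ↔ (z.re - a) ^ 2 + z.im ^ 2 ≤ r ^ 2 := by
  rw [← sq_norm_sub, sq_le_sq₀ (norm_nonneg _) hr]

theorem bump_eq_zero_or (y : ℝ) :
    bump y = 0 ∨ (0 < bump y ∧ bump y ≤ 1 / 8 ∧ 5 / 4 < y ∧ y < 3 / 2) := by
  unfold bump
  rcases le_total (1 / 8 - |y - 11 / 8|) 0 with h | h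
  · left; exact max_eq_left h
  · rcases h.eq_or_lt with h' | h'
    · left; exact max_eq_left h'.ge
    · right
      rw [max_eq_right h]
      have := abs_lt.mp (show |y - 11 / 8| < 1 / 8 by linarith)
      refine ⟨h', by linarith [abs_nonneg (y - 11 / 8)], by linarith, by linarith⟩

/-- The tile in real coordinates. -/
theorem mem_tile_iff (z : ℍ) : z ∈ tile ↔ bump z.im ≤ z.re ∧ z.re ≤ 2 + bump z.im ∧
    1 ≤ z.re ^ 2 + z.im ^ 2 ∧ 1 ≤ (z.re - 1) ^ 2 + z.im ^ 2 ∧ 1 ≤ (z.re - 2) ^ 2 + z.im ^ 2 ∧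
    (z.re ^ 2 + z.im ^ 2 ≤ 4 ∨ (z.re - 2) ^ 2 + z.im ^ 2 ≤ 4) := by
  have h0 := le_norm_sub_iff z 0 zero_le_one
  have h1 := le_norm_sub_iff z 1 zero_le_one
  have h2 := le_norm_sub_iff z 2 zero_le_one
  have h3 := norm_sub_le_iff z 0 zero_le_two
  have h4 := norm_sub_le_iff z 2 zero_le_two
  norm_num at h0 h1 h2 h3 h4
  simp only [tile, mem_ofPred_eq, h0, h1, h2, h3, h4]

theorem bump_continuous : Continuous bump := by unfold bump; fun_prop

theorem isClosed_tile : IsClosed tile := by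
  have h1 : Continuous fun z : ℍ => z.re := UpperHalfPlane.continuous_re
  have h2 : Continuous fun z : ℍ => z.im := UpperHalfPlane.continuous_im
  have h3 : Continuous fun z : ℍ => bump z.im := bump_continuous.comp h2
  have : tile = {z : ℍ | bump z.im ≤ z.re ∧ z.re ≤ 2 + bump z.im ∧
    1 ≤ z.re ^ 2 + z.im ^ 2 ∧ 1 ≤ (z.re - 1) ^ 2 + z.im ^ 2 ∧ 1 ≤ (z.re - 2) ^ 2 + z.im ^ 2 ∧
    (z.re ^ 2 + z.im ^ 2 ≤ 4 ∨ (z.re - 2) ^ 2 + z.im ^ 2 ≤ 4)} := by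
    ext z; exact mem_tile_iff z
  rw [this]
  have hn (a : ℝ) : Continuous fun z : ℍ => (z.re - a) ^ 2 + z.im ^ 2 := by fun_prop
  have hn0 : Continuous fun z : ℍ => z.re ^ 2 + z.im ^ 2 := by fun_prop
  exact (isClosed_le h3 h1).inter <| (isClosed_le h1 (continuous_const.add h3)).inter <|
    (isClosed_le continuous_const hn0).inter <| (isClosed_le continuous_const (hn 1)).inter <|
    (isClosed_le continuous_const (hn 2)).inter <|
    (isClosed_le hn0 continuous_const).union (isClosed_le (hn 2) continuous_const)

theorem re_im_bounds_of_mem_tile {z : ℍ} (hz : z ∈ tile) :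
    0 ≤ z.re ∧ z.re ≤ 3 ∧ 1 / 2 ≤ z.im ∧ z.im ≤ 2 := by
  obtain ⟨h1, h2, h3, h4, h5, h6⟩ := (mem_tile_iff z).mp hz
  have hy := z.im_pos
  rcases bump_eq_zero_or z.im with hb | ⟨hb1, hb2, hb3, hb4⟩
  · rw [hb] at h1 h2
    refine ⟨h1, by linarith, ?_, ?_⟩
    · by_contra hlt
      push Not at hlt
      rcases le_total z.re (1 / 2) with h | h
      · nlinarith
      · rcases le_total z.re (3 / 2) with h' | h' <;> nlinarith
    · rcases h6 with h6 | h6 <;> nlinarith [sq_nonneg z.re, sq_nonneg (z.re - 2)]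
  · exact ⟨by linarith, by linarith, by linarith, by linarith⟩

theorem one_le_norm_sub_int_of_mem_tile {z : ℍ} (hz : z ∈ tile) (k : ℤ) :
    1 ≤ (z.re - k) ^ 2 + z.im ^ 2 := by
  obtain ⟨h1, h2, h3, h4, h5, -⟩ := (mem_tile_iff z).mp hz
  rcases bump_eq_zero_or z.im with hb | ⟨hb1, hb2, hb3, hb4⟩
  · rw [hb] at h1 h2
    rcases lt_or_ge k 0 with hk | hk
    · have : (k : ℝ) ≤ -1 := by exact_mod_cast Int.le_sub_one_of_lt hk
      nlinarith
    · rcases lt_or_ge 2 k with hk2 | hk2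
      · have : (3 : ℝ) ≤ k := by exact_mod_cast hk2
        nlinarith
      · interval_cases k
        · simpa using h3
        · simpa using h4
        · simpa using h5
  · nlinarith [sq_nonneg (z.re - k)]

/-- An interior point can be pushed a little along its vertical line. With the horizontal pushes of
`exists_left`, this turns the weak inequalities defining the tile into strict ones in its interior.
-/
theorem exists_lower {S : Set ℍ} {z : ℍ} (hz : z ∈ interior S) :
    (∃ w ∈ S, w.re = z.re ∧ w.im < z.im) ∧ ∃ w ∈ S, w.re = z.re ∧ z.im < w.im := by
  have hc := (isometry_vertical_line z.re).continuous
  have ho : IsOpen ((fun y => mk ⟨z.re, Real.exp y⟩ (Real.exp_pos y)) ⁻¹' interior S) :=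
    isOpen_interior.preimage hc
  have hm : Real.log z.im ∈ (fun y => mk ⟨z.re, Real.exp y⟩ (Real.exp_pos y)) ⁻¹' interior S := by
    have : mk ⟨z.re, Real.exp (Real.log z.im)⟩ (Real.exp_pos _) = z := by
      ext1
      apply Complex.ext
      · rfl
      · exact Real.exp_log z.im_pos
    rw [mem_preimage, this]
    exact hz
  obtain ⟨ε, hε, hb⟩ := Metric.isOpen_iff.mp ho _ hm
  have h1 : ∀ t : ℝ, |t| < ε → mk ⟨z.re, Real.exp (Real.log z.im + t)⟩ (Real.exp_pos _) ∈ S :=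
    fun t ht => interior_subset (hb (by simpa [Real.dist_eq] using ht))
  refine ⟨⟨_, h1 (-(ε / 2)) (by rw [abs_neg, abs_of_pos] <;> linarith), rfl, ?_⟩,
    ⟨_, h1 (ε / 2) (by rw [abs_of_pos] <;> linarith), rfl, ?_⟩⟩
  · change Real.exp _ < _
    rw [Real.exp_add, Real.exp_log z.im_pos]
    have : Real.exp (-(ε / 2)) < 1 := Real.exp_lt_one_iff.mpr (by linarith)
    nlinarith [z.im_pos]
  · change _ < Real.exp _
    rw [Real.exp_add, Real.exp_log z.im_pos]
    have : 1 < Real.exp (ε / 2) := Real.one_lt_exp_iff.mpr (by linarith)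
    nlinarith [z.im_pos]

theorem exists_left {S : Set ℍ} {z : ℍ} (hz : z ∈ interior S) :
    (∃ w ∈ S, w.im = z.im ∧ w.re < z.re) ∧ ∃ w ∈ S, w.im = z.im ∧ z.re < w.re := by
  have hc : Continuous fun t : ℝ => t +ᵥ z := by
    rw [isOpenEmbedding_coe.isInducing.continuous_iff]
    simp only [Function.comp_def, coe_vadd]
    fun_prop
  have ho : IsOpen ((fun t : ℝ => t +ᵥ z) ⁻¹' interior S) := isOpen_interior.preimage hc
  have hm : (0 : ℝ) ∈ (fun t : ℝ => t +ᵥ z) ⁻¹' interior S := by simpa using hz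
  obtain ⟨ε, hε, hb⟩ := Metric.isOpen_iff.mp ho _ hm
  have h1 : ∀ t : ℝ, |t| < ε → t +ᵥ z ∈ S :=
    fun t ht => interior_subset (hb (by simpa [Real.dist_eq] using ht))
  refine ⟨⟨_, h1 (-(ε / 2)) (by rw [abs_neg, abs_of_pos] <;> linarith), by simp, ?_⟩,
    ⟨_, h1 (ε / 2) (by rw [abs_of_pos] <;> linarith), by simp, ?_⟩⟩
  · rw [vadd_re]; linarith
  · rw [vadd_re]; linarith

/-- Points in the interior of the tile satisfy all the inequalities strictly. -/
theorem strict_of_mem_interior_tile {z : ℍ} (hz : z ∈ interior tile) :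
    bump z.im < z.re ∧ z.re < 2 + bump z.im ∧ (∀ k : ℤ, 1 < (z.re - k) ^ 2 + z.im ^ 2) ∧
    (z.re ^ 2 + z.im ^ 2 < 4 ∨ (z.re - 2) ^ 2 + z.im ^ 2 < 4) := by
  obtain ⟨⟨a, ha, ha1, ha2⟩, b, hb, hb1, hb2⟩ := exists_lower hz
  obtain ⟨⟨c, hc, hc1, hc2⟩, d, hd, hd1, hd2⟩ := exists_left hz
  refine ⟨?_, ?_, fun k => ?_, ?_⟩
  · have := ((mem_tile_iff c).mp hc).1
    rw [hc1] at this; linarith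
  · have := ((mem_tile_iff d).mp hd).2.1
    rw [hd1] at this; linarith
  · have := one_le_norm_sub_int_of_mem_tile ha k
    rw [ha1] at this
    nlinarith [a.im_pos]
  · have := ((mem_tile_iff b).mp hb).2.2.2.2.2
    rw [hb1] at this
    exact this.imp (fun h => by nlinarith [z.im_pos]) (fun h => by nlinarith [z.im_pos])

/-- An element of `SL(2, ℤ)` that moves `∞` lowers every point outside all the closed unit discs
about the integers. -/
theorem im_smul_lt {u : ℍ} (hu : ∀ k : ℤ, 1 < (u.re - k) ^ 2 + u.im ^ 2) {ε : SL(2, ℤ)}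
    (hε : ε 1 0 ≠ 0) : (ε • u).im < u.im := by
  rw [ModularGroup.im_smul_eq_div_normSq, div_lt_iff₀
    (Complex.normSq_pos.mpr (denom_ne_zero _ _))]
  suffices 1 < Complex.normSq (denom (ε : SL(2, ℤ)) u) by nlinarith [u.im_pos]
  have h1 : Complex.normSq (denom (ε : SL(2, ℤ)) u) =
      (ε 1 0 * u.re + ε 1 1) ^ 2 + (ε 1 0 * u.im) ^ 2 := by
    rw [ModularGroup.denom_apply, Complex.normSq_apply]
    simp [sq]
  rw [h1]
  set k := round u.re with hk
  have h2 := hu k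
  have h3 : |u.re - k| ≤ 1 / 2 := abs_sub_round _
  set v := u.re - k with hv
  set e : ℤ := ε 1 1 + ε 1 0 * k with he
  have h4 : (ε 1 0 * u.re + ε 1 1 : ℝ) = ε 1 0 * v + e := by
    rw [he, hv]; push_cast; ring
  rw [h4]
  set c := ε 1 0
  -- The squared denominator is c²(v² + y²) + 2cev + e² with v² + y² > 1 and |v| ≤ 1/2, so it
  -- exceeds this integral form, which is positive for c ≠ 0.
  have h5 : (1 : ℝ) ≤ (c : ℝ) ^ 2 - |(c : ℝ)| * |(e : ℝ)| + (e : ℝ) ^ 2 := by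
    have : (1 : ℤ) ≤ c ^ 2 - |c| * |e| + e ^ 2 := by
      have h7 : 0 < |c| := abs_pos.mpr hε
      rw [← sq_abs c, ← sq_abs e]
      nlinarith [sq_nonneg (2 * |e| - |c|)]
    exact_mod_cast this
  have h6 : -(|(c : ℝ)| * |(e : ℝ)|) ≤ 2 * (c * e * v) := by
    have : |(c * e * v : ℝ)| ≤ |(c : ℝ)| * |(e : ℝ)| * (1 / 2) := by
      rw [abs_mul, abs_mul]; gcongr
    have := neg_le_of_abs_le this
    linarith
  have h7 : (0 : ℝ) < (c : ℝ) ^ 2 := by positivity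
  nlinarith

theorem eq_T_zpow_of_c_eq_zero {ε : SL(2, ℤ)} (hε : ε 1 0 = 0) :
    ∃ l : ℤ, ε = ModularGroup.T ^ l ∨ ε = -ModularGroup.T ^ l := by
  have h := ε.det_coe
  rw [Matrix.det_fin_two, hε, mul_zero, sub_zero] at h
  rcases Int.eq_one_or_neg_one_of_mul_eq_one' h with ⟨h1, h2⟩ | ⟨h1, h2⟩
  · refine ⟨ε 0 1, Or.inl ?_⟩
    ext i j
    rw [ModularGroup.coe_T_zpow]
    fin_cases i <;> fin_cases j <;> simp [hε, h1, h2]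
  · refine ⟨-ε 0 1, Or.inr ?_⟩
    ext i j
    rw [Matrix.SpecialLinearGroup.coe_neg, ModularGroup.coe_T_zpow]
    fin_cases i <;> fin_cases j <;> simp [hε, h1, h2]

/-! ### The tiling with given dyadic indices. -/

theorem exists_int_dvd_add (x : ℤ_[2]) (n : ℕ) : ∃ m : ℤ, (2 : ℤ_[2]) ^ n ∣ x + m := by
  refine ⟨-(x.appr n : ℤ), ?_⟩
  have := PadicInt.appr_spec n x
  rw [Ideal.mem_span_singleton] at this
  simpa [sub_eq_add_neg] using this

theorem two_pow_dvd_int {n : ℕ} {k : ℤ} : (2 : ℤ_[2]) ^ n ∣ k ↔ (2 : ℤ) ^ n ∣ k := by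
  simpa using PadicInt.pow_p_dvd_int_iff (p := 2) n k

/-- The dyadic indices of a tiling whose horoballs form the standard packing, as a function of the
motion that carries the standard horoball and triangle to the given ones. -/
structure IsIndexing (φ : SL(2, ℤ) → ℤ_[2]) : Prop where
  mul_T : ∀ δ, φ (δ * ModularGroup.T) = φ δ + 1
  neg : ∀ δ, φ (-δ) = φ δ

theorem IsIndexing.mul_T_zpow {φ : SL(2, ℤ) → ℤ_[2]} (hφ : IsIndexing φ) (δ : SL(2, ℤ)) (k : ℤ) :
    φ (δ * ModularGroup.T ^ k) = φ δ + k := by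
  induction k with
  | zero => simp
  | succ n ih =>
    rw [zpow_add_one, ← mul_assoc, hφ.mul_T, ih]; push_cast; ring
  | pred n ih =>
    have := hφ.mul_T (δ * ModularGroup.T ^ (-(n : ℤ) - 1))
    rw [mul_assoc, ← zpow_add_one, sub_add_cancel, ih] at this
    push_cast at this ⊢
    linear_combination -this

/-- The motions of the tiling with dyadic indices `φ`. -/
def placements (φ : SL(2, ℤ) → ℤ_[2]) : Set PSL2R :=
  -- A copy of level n spans 2 ^ (n + 1) triangles along its horoball. It starts at the triangle of
  -- δ exactly when the path up from there to level n uses left prongs only, that is, when the first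
  -- n + 1 digits vanish.
  {g | ∃ δ n, (2 : ℤ_[2]) ^ (n + 1) ∣ φ δ ∧ g = place δ n}

theorem exists_near_center (x : ℤ_[2]) (n : ℕ) (r : ℝ) :
    ∃ k : ℤ, (2 : ℤ_[2]) ^ n ∣ x + k ∧ |r - k| ≤ 2 ^ n / 2 := by
  obtain ⟨m, hm⟩ := exists_int_dvd_add x n
  refine ⟨m + 2 ^ n * round ((r - m) / 2 ^ n), ?_, ?_⟩
  · push_cast
    rw [← add_assoc]
    exact dvd_add hm (dvd_mul_right _ _)
  · have h := abs_sub_round ((r - m) / 2 ^ n)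
    have h2 : (0 : ℝ) < 2 ^ n := by positivity
    have : r - ((m + 2 ^ n * round ((r - m) / 2 ^ n) : ℤ) : ℝ) =
        2 ^ n * ((r - m) / 2 ^ n - round ((r - m) / 2 ^ n)) := by
      push_cast; field_simp; ring
    rw [this, abs_mul, abs_of_pos h2]
    nlinarith

theorem one_le_of_mem_fd {u : ℍ} (hu : u ∈ ModularGroup.fd) (k : ℤ) :
    1 ≤ (u.re - k) ^ 2 + u.im ^ 2 := by
  obtain ⟨h1, h2⟩ := hu
  rw [Complex.normSq_apply] at h1
  have h3 : |(k : ℝ)| ≤ (k : ℝ) ^ 2 := by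
    rw [← sq_abs]
    rcases eq_or_ne k 0 with rfl | hk
    · simp
    · have : (1 : ℝ) ≤ |(k : ℝ)| := by exact_mod_cast Int.one_le_abs hk
      nlinarith
  have h4 : |u.re * k| ≤ 1 / 2 * |(k : ℝ)| := by rw [abs_mul]; gcongr
  have h5 := le_of_abs_le h4
  simp only [coe_re, coe_im] at h1
  nlinarith

/-- Move z into the standard fundamental domain. In the horoball at ∞, the copies of level n lie
above the discs of radius 2 ^ n and below those of radius 2 ^ (n + 1), centred at the integers k
with φ γ⁻¹ + k divisible by the radius. The level of z is found from the first scale whose discs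
reach the point. -/
theorem exists_placement (φ : SL(2, ℤ) → ℤ_[2]) (hφ : IsIndexing φ) (z : ℍ) :
    ∃ g ∈ placements φ, z ∈ g • tile := by
  obtain ⟨γ, hγ⟩ := ModularGroup.exists_smul_mem_fd z
  set u := γ • z with hu
  let P : ℕ → Prop := fun n => ¬ ∀ k : ℤ, (2 : ℤ_[2]) ^ n ∣ φ γ⁻¹ + k →
    ((2 : ℝ) ^ n) ^ 2 ≤ (u.re - k) ^ 2 + u.im ^ 2
  have hP : ∃ n, P n := by
    -- Some centre is within 2 ^ n / 2 horizontally, and the height is also below 2 ^ n / 2, so the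
    -- disc of radius 2 ^ n contains the point.
    obtain ⟨n, hn⟩ := pow_unbounded_of_one_lt (2 * u.im) one_lt_two
    obtain ⟨k, hk1, hk2⟩ := exists_near_center (φ γ⁻¹) n u.re
    refine ⟨n, fun h => ?_⟩
    have := h k hk1
    rw [← sq_abs (u.re - k)] at this
    nlinarith [u.im_pos, abs_nonneg (u.re - k)]
  classical
  obtain ⟨n, hn⟩ : ∃ n, Nat.find hP = n + 1 := by
    -- Scale 0 does not qualify: the fundamental domain avoids the open unit discs about all
    -- integers.
    refine Nat.exists_eq_succ_of_ne_zero fun h0 => ?_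
    have h1 := Nat.find_spec hP
    rw [h0] at h1
    exact h1 fun k _ => by simpa using one_le_of_mem_fd hγ k
  have hPn : ∀ k : ℤ, (2 : ℤ_[2]) ^ n ∣ φ γ⁻¹ + k →
      ((2 : ℝ) ^ n) ^ 2 ≤ (u.re - k) ^ 2 + u.im ^ 2 := by
    have := Nat.find_min hP (m := n) (by omega)
    simpa [P] using this
  obtain ⟨k, hk1, hk2⟩ : ∃ k : ℤ, (2 : ℤ_[2]) ^ (n + 1) ∣ φ γ⁻¹ + k ∧
      (u.re - k) ^ 2 + u.im ^ 2 < ((2 : ℝ) ^ (n + 1)) ^ 2 := by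
    have := Nat.find_spec hP
    rw [hn] at this
    simpa [P] using this
  set p : ℝ := 2 ^ n with hp
  have hp0 : 0 < p := by positivity
  -- In rescaled units the copies of one level are 2 apart; subtracting the bump selects the one
  -- whose curved sides enclose the point at its height.
  set l := ⌊((u.re - k) / p - bump (u.im / p)) / 2⌋ with hl
  set j : ℤ := k + 2 ^ (n + 1) * l with hj
  have hj' : (j : ℝ) = k + 2 * p * l := by rw [hj]; push_cast; ring
  set v := (dil n)⁻¹ • incl (ModularGroup.T ^ (-j)) • u with hv
  have hvu : dil n • v = incl (ModularGroup.T ^ (-j)) • u := by rw [hv, smul_inv_smul]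
  have hre : p * v.re = u.re - j := by
    rw [← re_dil_smul, hvu, incl_smul, ModularGroup.re_T_zpow_smul]; push_cast; ring
  have him : p * v.im = u.im := by
    rw [← im_dil_smul, hvu, incl_smul, ModularGroup.im_T_zpow_smul]
  have hre' : v.re = (u.re - k) / p - 2 * l := by
    field_simp; linarith
  have him' : v.im = u.im / p := by field_simp; linarith
  refine ⟨place (γ⁻¹ * ModularGroup.T ^ j) n, ⟨_, n, ?_, rfl⟩, ?_⟩
  · rw [hφ.mul_T_zpow, hj]
    push_cast
    rw [← add_assoc]
    exact dvd_add hk1 (dvd_mul_right _ _)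
  refine ⟨v, ?_, ?_⟩
  swap
  · change place (γ⁻¹ * ModularGroup.T ^ j) n • v = z
    rw [place_smul, hvu, ← mul_smul, ← map_mul, incl_smul, hu, ← mul_smul]
    simp
  have hfl := Int.floor_le (((u.re - k) / p - bump (u.im / p)) / 2)
  have hfl' := Int.lt_floor_add_one (((u.re - k) / p - bump (u.im / p)) / 2)
  rw [← hl] at hfl hfl'
  rw [← him'] at hfl hfl'
  have hint : ∀ q : ℤ, 1 ≤ (v.re - q) ^ 2 + v.im ^ 2 := by
    intro q
    have h1 := hPn (j + 2 ^ n * q) (by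
      rw [hj]; push_cast
      have : φ γ⁻¹ + (k + 2 ^ (n + 1) * l + 2 ^ n * q) =
        φ γ⁻¹ + k + 2 ^ n * (2 * l + q) := by ring
      rw [this]
      exact dvd_add ((pow_dvd_pow _ (Nat.le_succ n)).trans hk1) (dvd_mul_right _ _))
    push_cast at h1
    rw [← him, show u.re - (j + 2 ^ n * q) = p * (v.re - q) by rw [mul_sub, hre]; ring] at h1
    have : p ^ 2 * 1 ≤ p ^ 2 * ((v.re - q) ^ 2 + v.im ^ 2) := by linarith
    exact le_of_mul_le_mul_left this (by positivity)
  have hup : (v.re + 2 * l) ^ 2 + v.im ^ 2 < 4 := by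
    rw [← him, show u.re - k = p * (v.re + 2 * l) by rw [hre']; field_simp; ring] at hk2
    have : p ^ 2 * ((v.re + 2 * l) ^ 2 + v.im ^ 2) < p ^ 2 * 4 := by
      rw [pow_succ (2 : ℝ) n, ← hp] at hk2; linarith
    exact lt_of_mul_lt_mul_left this (by positivity)
  have hb1 : bump v.im ≤ v.re := by linarith
  have hb2 : v.re ≤ 2 + bump v.im := by linarith
  rw [mem_tile_iff]
  refine ⟨hb1, hb2, by simpa using hint 0, by simpa using hint 1, by simpa using hint 2, ?_⟩
  -- The disc of radius 2 containing the point is centred at -2l, while the tile refers to the discs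
  -- about 0 and 2. As the real part lies in [0, 2], the centre may be moved to 0 or 2 according to
  -- the sign of l. At the heights of the bump one of the two discs contains the point anyway.
  rcases bump_eq_zero_or v.im with hb | ⟨hb3, hb4, hb5, hb6⟩
  · rw [hb] at hb1 hb2
    rcases lt_or_ge l 0 with hl0 | hl0
    · right
      have : (l : ℝ) ≤ -1 := by exact_mod_cast Int.le_sub_one_of_lt hl0
      nlinarith
    · left
      have : (0 : ℝ) ≤ l := by exact_mod_cast hl0
      nlinarith
  · rcases le_total v.re 1 with h | h
    · left; nlinarith
    · right; nlinarith

/-- Each disc of radius 2 ^ m about a multiple of 2 ^ m lies inside a disc of radius 2 ^ n about a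
multiple of 2 ^ n: round the centre down, moving it by at most 2 ^ n - 2 ^ m. -/
theorem norm_gt_of_scale_le {u : ℍ} {m n : ℕ} (hmn : m ≤ n)
    (h : ∀ l : ℤ, (2 : ℝ) ^ n < ‖(u : ℂ) - ((2 ^ n * l : ℤ) : ℝ)‖) (q : ℤ) :
    (2 : ℝ) ^ m < ‖(u : ℂ) - ((2 ^ m * q : ℤ) : ℝ)‖ := by
  set a : ℤ := 2 ^ (n - m) with ha
  have ha0 : 0 < a := by positivity
  have h1 := h (q / a)
  have h2 := Int.emod_nonneg q ha0.ne'
  have h3 := Int.emod_lt_of_pos q ha0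
  have h4 := Int.mul_ediv_add_emod q a
  set r := q % a
  set l := q / a
  have h5 : (2 : ℤ) ^ n = 2 ^ m * a := by rw [ha, ← pow_add, Nat.add_sub_cancel' hmn]
  have h5' : (2 : ℝ) ^ n = 2 ^ m * a := by exact_mod_cast h5
  have h6 : (u : ℂ) - ((2 ^ n * l : ℤ) : ℝ) =
      ((u : ℂ) - ((2 ^ m * q : ℤ) : ℝ)) + ((2 ^ m * r : ℝ) : ℂ) := by
    rw [← h4, h5]; push_cast; ring
  have h7 : ‖((2 ^ m * r : ℝ) : ℂ)‖ = 2 ^ m * r := by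
    rw [Complex.norm_real, Real.norm_of_nonneg]
    have : (0 : ℝ) ≤ r := by exact_mod_cast h2
    positivity
  have h8 := norm_add_le ((u : ℂ) - ((2 ^ m * q : ℤ) : ℝ)) ((2 ^ m * r : ℝ) : ℂ)
  rw [← h6, h7] at h8
  have h9 : (r : ℝ) ≤ a - 1 := by exact_mod_cast Int.le_sub_one_of_lt h3
  rw [h5'] at h1
  have : (0 : ℝ) < 2 ^ m := by positivity
  nlinarith

/-- Both preimages of a common interior point lie outside all unit discs about the integers. A
transition element moving ∞ would lower each of them below the other, so the copies belong to the
same horoball. There, different levels are separated by the discs of radius 2 ^ (n + 1), and copies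
of one level by their vertical sides. -/
theorem place_eq_of_interior_inter_of_le {φ : SL(2, ℤ) → ℤ_[2]} (hφ : IsIndexing φ)
    {δ δ' : SL(2, ℤ)} {n n' : ℕ} (hn : (2 : ℤ_[2]) ^ (n + 1) ∣ φ δ)
    (hn' : (2 : ℤ_[2]) ^ (n' + 1) ∣ φ δ') (hle : n ≤ n') {v v' : ℍ} (hv : v ∈ interior tile)
    (hv' : v' ∈ interior tile) (h : place δ n • v = place δ' n' • v') :
    place δ n = place δ' n' := by
  have hs := strict_of_mem_interior_tile hv
  have hs' := strict_of_mem_interior_tile hv'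
  have key : ∀ (n : ℕ) (v : ℍ), (∀ k : ℤ, 1 < (v.re - k) ^ 2 + v.im ^ 2) → ∀ l : ℤ,
      (2 : ℝ) ^ n < ‖((dil n • v : ℍ) : ℂ) - ((2 ^ n * l : ℤ) : ℝ)‖ := by
    intro n v hv l
    rw [lt_norm_sub_iff _ _ (by positivity), re_dil_smul, im_dil_smul]
    have := hv l
    have h2 : (0 : ℝ) < (2 ^ n) ^ 2 := by positivity
    push_cast
    nlinarith
  have key1 : ∀ (n : ℕ) (v : ℍ), (∀ k : ℤ, 1 < (v.re - k) ^ 2 + v.im ^ 2) →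
      ∀ k : ℤ, 1 < ((dil n • v).re - k) ^ 2 + (dil n • v).im ^ 2 := by
    intro n v hv k
    have := norm_gt_of_scale_le (Nat.zero_le n) (key n v hv) k
    rw [lt_norm_sub_iff _ _ (by positivity)] at this
    simpa using this
  have hu := key n v hs.2.2.1
  have hu' := key n' v' hs'.2.2.1
  have hu1 := key1 n v hs.2.2.1
  have hu1' := key1 n' v' hs'.2.2.1
  rw [place_smul, place_smul, incl_smul, incl_smul] at h
  set u := dil n • v with hudef
  set u' := dil n' • v' with hudef'
  have hε : (δ'⁻¹ * δ) • u = u' := by rw [mul_smul, h, inv_smul_smul]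
  have hε' : (δ'⁻¹ * δ)⁻¹ • u' = u := by rw [← hε, inv_smul_smul]
  have hc : (δ'⁻¹ * δ) 1 0 = 0 := by
    by_contra hc
    have h1 := im_smul_lt hu1 hc
    have h2 := im_smul_lt hu1' (ε := (δ'⁻¹ * δ)⁻¹) (by
      rw [Matrix.SpecialLinearGroup.coe_inv, Matrix.adjugate_fin_two]
      simpa using hc)
    rw [hε] at h1
    rw [hε'] at h2
    exact lt_asymm h1 h2
  obtain ⟨l, hl⟩ := eq_T_zpow_of_c_eq_zero hc
  have hδ : δ = δ' * ModularGroup.T ^ l ∨ δ = -(δ' * ModularGroup.T ^ l) := by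
    refine hl.imp (fun hl => ?_) (fun hl => ?_)
    · rw [← hl]; group
    · rw [← mul_neg, ← hl]; group
  have hTl : u' = ModularGroup.T ^ l • u := by
    rw [← hε]
    rcases hl with hl | hl
    · rw [hl]
    · rw [hl, ModularGroup.SL_neg_smul]
  have hre : u'.re = u.re + l := by rw [hTl, ModularGroup.re_T_zpow_smul]
  have him : u'.im = u.im := by rw [hTl, ModularGroup.im_T_zpow_smul]
  have hφl : φ δ = φ δ' + l := by
    rw [← hφ.mul_T_zpow]
    rcases hδ with hδ | hδ
    · rw [hδ]
    · rw [hδ, hφ.neg]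
  have hdl : (2 : ℤ) ^ (n + 1) ∣ l := by
    rw [← two_pow_dvd_int, ← dvd_add_right ((pow_dvd_pow _ (by omega)).trans hn'), ← hφl]
    exact hn
  obtain ⟨q, hq⟩ := hdl
  have hp : (0 : ℝ) < 2 ^ n := by positivity
  rcases hle.lt_or_eq with hlt | rfl
  · exfalso
    have h1 := norm_gt_of_scale_le (Nat.succ_le_of_lt hlt) hu'
    have h2 := h1 q
    have h3 := h1 (q + 1)
    rw [lt_norm_sub_iff _ _ (by positivity), hre, him] at h2 h3
    rw [hq, hudef, re_dil_smul, im_dil_smul] at h2 h3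
    push_cast at h2 h3
    rw [Nat.succ_eq_add_one, pow_succ (2 : ℝ) n] at h2 h3
    have h5 : ((2 : ℝ) ^ n) ^ 2 * 4 < (2 ^ n) ^ 2 * (v.re ^ 2 + v.im ^ 2) := by
      convert h2 using 1 <;> ring
    have h6 : ((2 : ℝ) ^ n) ^ 2 * 4 < (2 ^ n) ^ 2 * ((v.re - 2) ^ 2 + v.im ^ 2) := by
      convert h3 using 1 <;> ring
    have h7 := lt_of_mul_lt_mul_left h5 (by positivity)
    have h8 := lt_of_mul_lt_mul_left h6 (by positivity)
    rcases hs.2.2.2 with h4 | h4 <;> linarith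
  · rw [hq, hudef, hudef', re_dil_smul, re_dil_smul] at hre
    rw [hudef, hudef', im_dil_smul, im_dil_smul] at him
    have him' : v'.im = v.im := mul_left_cancel₀ hp.ne' him
    have hre' : v'.re = v.re + 2 * q := by
      push_cast at hre
      rw [pow_succ] at hre
      apply mul_left_cancel₀ hp.ne'
      linarith
    rw [him', hre'] at hs'
    have hq0 : q = 0 := by
      have h1 : (q : ℝ) < 1 := by linarith [hs.1, hs'.2.1]
      have h2 : (-1 : ℝ) < q := by linarith [hs'.1, hs.2.1]
      have h1' : q < 1 := by exact_mod_cast h1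
      have h2' : -1 < q := by exact_mod_cast h2
      omega
    rw [hq, hq0, mul_zero, zpow_zero, mul_one] at hδ
    exact place_eq_iff.mpr ⟨rfl, hδ⟩

/-- The tiling with the dyadic indices `φ`. -/
@[simps]
def tilingOf (φ : SL(2, ℤ) → ℤ_[2]) (hφ : IsIndexing φ) : Tiling where
  motions := placements φ
  covers := by
    rw [eq_univ_iff_forall]
    intro z
    obtain ⟨g, hg, hz⟩ := exists_placement φ hφ z
    exact mem_iUnion₂.mpr ⟨g, hg, hz⟩
  disjoint_interior := by
    rintro _ ⟨δ, n, hn, rfl⟩ _ ⟨δ', n', hn', rfl⟩ hne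
    rw [Set.disjoint_left]
    intro z hz hz'
    rw [interior_smul] at hz hz'
    obtain ⟨v, hv, hvz⟩ := hz
    obtain ⟨v', hv', hvz'⟩ := hz'
    apply hne
    have h : place δ n • v = place δ' n' • v' := hvz.trans hvz'.symm
    rcases le_total n n' with hle | hle
    · exact place_eq_of_interior_inter_of_le hφ hn hn' hle hv hv' h
    · exact (place_eq_of_interior_inter_of_le hφ hn' hn hle hv' hv h.symm).symm

/-! ### The topology on tilings. -/

open Filter Topology
open scoped ENNReal NNReal

theorem NearOn.mono {K K' : Set ℍ} {ε ε' : ℝ} {S T : Tiling} (h : NearOn K' ε' S T)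
    (hK : K ⊆ K') (hε : ε' ≤ ε) : NearOn K ε S T := fun g hg hgK =>
  (h g hg (hgK.mono (inter_subset_inter_right _ hK))).imp
    fun _ hk => ⟨hk.1, fun z hz => (hk.2 z hz).trans hε⟩

/-- The intermediate copy may miss K by δ ≤ 1, hence the thickening of K by 1. -/
theorem NearOn.trans {K : Set ℍ} {δ ε : ℝ} {A B C : Tiling} (h : NearOn K δ A B)
    (h' : NearOn (Metric.cthickening 1 K) ε B C) (hδ : δ ≤ 1) : NearOn K (δ + ε) A C := by
  rintro g hg ⟨_, ⟨z, hz, rfl⟩, hK⟩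
  obtain ⟨k, hk, hgk⟩ := h g hg ⟨_, ⟨z, hz, rfl⟩, hK⟩
  have hd := hgk z hz
  obtain ⟨l, hl, hkl⟩ := h' k hk ⟨k • z, smul_mem_smul_set hz,
    Metric.mem_cthickening_of_dist_le (k • z) (g • z) 1 K hK (by rw [dist_comm]; linarith)⟩
  exact ⟨l, hl, fun w hw => (dist_triangle _ (k • w) _).trans (add_le_add (hgk w hw) (hkl w hw))⟩

/-- The tilings that are uniformly `ε`-close to `T` on `K`. -/
def vicinity (T : Tiling) (K : Set ℍ) (ε : ℝ) : Set Tiling := {S | NearOn K ε S T ∧ NearOn K ε T S}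

theorem isOpen_tiling_iff {U : Set Tiling} :
    IsOpen U ↔ ∀ T ∈ U, ∃ K : Set ℍ, IsCompact K ∧ ∃ ε > 0, vicinity T K ε ⊆ U := by
  change (∀ T ∈ U, ∃ K : Set ℍ, IsCompact K ∧ ∃ ε > 0,
    ∀ S, NearOn K ε S T → NearOn K ε T S → S ∈ U) ↔ _
  refine forall₂_congr fun T _ => exists_congr fun K => and_congr Iff.rfl <| exists_congr
    fun ε => and_congr Iff.rfl ⟨fun h S hS => h S hS.1 hS.2, fun h S h1 h2 => h ⟨h1, h2⟩⟩

theorem vicinity_subset {K : Set ℍ} {ε δ : ℝ} {R S : Tiling}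
    (hR : R ∈ vicinity S (Metric.cthickening 1 K) δ) (hδ : δ ≤ 1) (hε : δ + δ ≤ ε) :
    vicinity R (Metric.cthickening 1 K) δ ⊆ vicinity S K ε := fun _ hQ =>
  ⟨((hQ.1.mono (Metric.self_subset_cthickening K) le_rfl).trans hR.1 hδ).mono subset_rfl hε,
    ((hR.2.mono (Metric.self_subset_cthickening K) le_rfl).trans hQ.2 hδ).mono subset_rfl hε⟩

theorem self_mem_vicinity (T : Tiling) (K : Set ℍ) {ε : ℝ} (hε : 0 ≤ ε) : T ∈ vicinity T K ε :=
  ⟨fun g hg _ => ⟨g, hg, fun z _ => by simpa⟩, fun g hg _ => ⟨g, hg, fun z _ => by simpa⟩⟩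

/-- The topology is given by its open sets, so this needs an argument: the tilings having some
vicinity inside the given one form an open set, by halving ε and thickening K. -/
theorem vicinity_mem_nhds (T : Tiling) {K : Set ℍ} (hK : IsCompact K) {ε : ℝ} (hε : 0 < ε) :
    vicinity T K ε ∈ 𝓝 T := by
  refine mem_nhds_iff.mpr ⟨{S | ∃ K' : Set ℍ, IsCompact K' ∧ ∃ ε' > 0,
    vicinity S K' ε' ⊆ vicinity T K ε}, ?_, ?_, ⟨K, hK, ε, hε, subset_rfl⟩⟩
  · rintro S ⟨K', -, ε', hε', h⟩
    exact h (self_mem_vicinity S K' hε'.le)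
  · rw [isOpen_tiling_iff]
    rintro S ⟨K', hK', ε', hε', h⟩
    have hδ : 0 < min (ε' / 2) 1 := lt_min (by linarith) one_pos
    refine ⟨Metric.cthickening 1 K', hK'.cthickening, _, hδ, fun R hR =>
      ⟨Metric.cthickening 1 K', hK'.cthickening, _, hδ, subset_trans ?_ h⟩⟩
    exact vicinity_subset hR (min_le_right _ _)
      (by linarith [min_le_left (ε' / 2) 1])

theorem mem_nhds_tiling_iff {T : Tiling} {U : Set Tiling} :
    U ∈ 𝓝 T ↔ ∃ K : Set ℍ, IsCompact K ∧ ∃ ε > 0, vicinity T K ε ⊆ U := by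
  constructor
  · intro h
    obtain ⟨V, hVU, hV, hT⟩ := mem_nhds_iff.mp h
    obtain ⟨K, hK, ε, hε, hs⟩ := isOpen_tiling_iff.mp hV T hT
    exact ⟨K, hK, ε, hε, hs.trans hVU⟩
  · rintro ⟨K, hK, ε, hε, hs⟩
    exact mem_of_superset (vicinity_mem_nhds T hK hε) hs

theorem smul_mem_vicinity {S T : Tiling} {K : Set ℍ} {ε : ℝ} (g : PSL2R)
    (h : S ∈ vicinity T K ε) : g • S ∈ vicinity (g • T) (g • K) ε := by
  have key : ∀ {A B : Tiling}, NearOn K ε A B → NearOn (g • K) ε (g • A) (g • B) := by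
    rintro A B hAB _ ⟨k, hk, rfl⟩ hne
    obtain ⟨l, hl, hd⟩ := hAB k hk (by
      obtain ⟨p, hp, hpK⟩ := hne
      refine ⟨g⁻¹ • p, ?_, mem_smul_set_iff_inv_smul_mem.mp hpK⟩
      have := mem_smul_set_iff_inv_smul_mem.mp hp
      rw [mem_smul_set_iff_inv_smul_mem]
      simpa [mul_smul] using this)
    refine ⟨g * l, smul_mem_smul_set hl, fun z hz => ?_⟩
    change dist ((g * k) • z) ((g * l) • z) ≤ ε
    rw [mul_smul, mul_smul, dist_smul]
    exact hd z hz
  exact ⟨key h.1, key h.2⟩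

instance : ContinuousConstSMul PSL2R Tiling where
  continuous_const_smul g := by
    rw [continuous_iff_continuousAt]
    intro T U hU
    obtain ⟨K, hK, ε, hε, h⟩ := mem_nhds_tiling_iff.mp hU
    rw [mem_map, mem_nhds_tiling_iff]
    refine ⟨g⁻¹ • K, hK.image (continuous_const_smul _), ε, hε, fun S hS => h ?_⟩
    simpa using smul_mem_vicinity g hS

/-- Two motions are `ε`-close on the tile. -/
def Close (ε : ℝ) (g h : PSL2R) : Prop := ∀ z ∈ tile, dist (g • z) (h • z) ≤ ε

theorem Close.symm {ε : ℝ} {g h : PSL2R} (H : Close ε g h) : Close ε h g := fun z hz => by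
  rw [dist_comm]; exact H z hz

theorem Close.trans {ε δ : ℝ} {g h k : PSL2R} (H : Close ε g h) (H' : Close δ h k) :
    Close (ε + δ) g k := fun z hz =>
  (dist_triangle _ (h • z) _).trans (add_le_add (H z hz) (H' z hz))

theorem mem_interior_tile {z : ℍ} (h1 : 0 < z.re) (h2 : z.re < 2) (h3 : 1 < z.im)
    (h4 : z.im < 5 / 4) : z ∈ interior tile := by
  have hr : Continuous fun z : ℍ => z.re := UpperHalfPlane.continuous_re
  have hi : Continuous fun z : ℍ => z.im := UpperHalfPlane.continuous_im
  refine mem_interior.mpr ⟨{z : ℍ | 0 < z.re} ∩ {z : ℍ | z.re < 2} ∩ {z : ℍ | 1 < z.im} ∩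
    {z : ℍ | z.im < 5 / 4}, ?_, ?_, ⟨⟨⟨h1, h2⟩, h3⟩, h4⟩⟩
  · rintro w ⟨⟨⟨w1, w2⟩, w3⟩, w4⟩
    simp only [mem_ofPred_eq] at w1 w2 w3 w4
    have hb : bump w.im = 0 := by
      rcases bump_eq_zero_or w.im with hb | ⟨-, -, hb, -⟩
      · exact hb
      · linarith
    rw [mem_tile_iff, hb]
    refine ⟨w1.le, by linarith, by nlinarith, by nlinarith, by nlinarith, ?_⟩
    rcases le_total w.re 1 with h | h
    · left; nlinarith
    · right; nlinarith
  · exact (((isOpen_lt continuous_const hr).inter (isOpen_lt hr continuous_const)).inter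
      (isOpen_lt continuous_const hi)).inter (isOpen_lt hi continuous_const)

/-- A point in the interior of the tile. -/
def basePoint : ℍ := mk ⟨1, 9 / 8⟩ (by norm_num)

theorem basePoint_mem_interior : basePoint ∈ interior tile :=
  mem_interior_tile (by change (0 : ℝ) < 1; norm_num) (by change (1 : ℝ) < 2; norm_num)
    (by change (1 : ℝ) < 9 / 8; norm_num) (by change (9 / 8 : ℝ) < 5 / 4; norm_num)

theorem basePoint_mem : basePoint ∈ tile := interior_subset basePoint_mem_interior

/-- The motions of a tiling are uniformly separated. -/
theorem exists_separation : ∃ δ > 0, ∀ (T : Tiling), ∀ g ∈ T.motions, ∀ h ∈ T.motions,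
    dist (g • basePoint) (h • basePoint) < δ → g = h := by
  obtain ⟨δ, hδ, hb⟩ := Metric.isOpen_iff.mp isOpen_interior _ basePoint_mem_interior
  refine ⟨δ, hδ, fun T g hg h hh hd => ?_⟩
  by_contra hne
  have hdis : Disjoint (interior (g • tile)) (interior (h • tile)) :=
    T.disjoint_interior hg hh hne
  rw [Set.disjoint_left] at hdis
  refine @hdis (h • basePoint) ?_ ?_
  · rw [interior_smul, mem_smul_set_iff_inv_smul_mem]
    apply hb
    rw [Metric.mem_ball, ← dist_smul g, smul_inv_smul, dist_comm]
    exact hd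
  · rw [interior_smul]
    exact smul_mem_smul_set basePoint_mem_interior

theorem dist_I_le_of_mem_tile {z : ℍ} (hz : z ∈ tile) : dist z I ≤ 8 := by
  obtain ⟨h1, h2, h3, h4⟩ := re_im_bounds_of_mem_tile hz
  refine (dist_le_dist_coe_div_sqrt z I).trans ?_
  rw [I_im, mul_one]
  have h5 : (1 / 2 : ℝ) ≤ √z.im := Real.le_sqrt_of_sq_le (by linarith)
  have h6 : dist (z : ℂ) (I : ℍ) ≤ 4 := by
    rw [Complex.dist_eq]
    refine (Complex.norm_le_abs_re_add_abs_im _).trans ?_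
    simp only [Complex.sub_re, Complex.sub_im, coe_re, coe_im, I_re, I_im, sub_zero]
    rw [abs_of_nonneg h1]
    have : |z.im - 1| ≤ 1 := abs_le.mpr ⟨by linarith, by linarith⟩
    linarith
  rw [div_le_iff₀ (by linarith)]
  linarith

theorem dist_le_of_mem_tile {z w : ℍ} (hz : z ∈ tile) (hw : w ∈ tile) : dist z w ≤ 16 := by
  refine (dist_triangle_right z w I).trans ?_
  linarith [dist_I_le_of_mem_tile hz, dist_I_le_of_mem_tile hw]

/-- A motion is determined by its effect on the tile. -/
theorem eq_of_close_zero {g h : PSL2R} (H : ∀ z ∈ tile, g • z = h • z) : g = h := by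
  suffices ∀ g : PSL2R, (∀ z ∈ tile, g • z = z) → g = 1 by
    have := this (h⁻¹ * g) fun z hz => by rw [mul_smul, H z hz, inv_smul_smul]
    rwa [inv_mul_eq_one, eq_comm] at this
  intro g hg
  obtain ⟨A, rfl⟩ := toPSL_surjective g
  have hz : ∀ x y : ℝ, 0 < x → x < 2 → 1 < y → y < 5 / 4 →
      A 1 0 * (x ^ 2 - y ^ 2) + A 1 1 * x = A 0 0 * x + A 0 1 ∧
      A 1 0 * (2 * x * y) + A 1 1 * y = A 0 0 * y := by
    intro x y h1 h2 h3 h4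
    have h5 : mk ⟨x, y⟩ (by change 0 < y; linarith) ∈ tile := interior_subset <|
      mem_interior_tile (z := mk ⟨x, y⟩ (by change 0 < y; linarith)) h1 h2 h3 h4
    have h6 := congrArg UpperHalfPlane.coe (hg _ h5)
    rw [toPSL_smul, coe_specialLinearGroup_apply, div_eq_iff (by
      simpa [denom] using denom_ne_zero (A : GL (Fin 2) ℝ)
        (mk ⟨x, y⟩ (by change 0 < y; linarith)))] at h6
    have hre := congrArg Complex.re h6
    have him := congrArg Complex.im h6
    simp at hre him
    constructor <;> nlinarith
  -- The fixed point equations at two points of equal height and different real parts force a scalar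
  -- matrix.
  have h1 := hz 1 (9 / 8) (by norm_num) (by norm_num) (by norm_num) (by norm_num)
  have h2 := hz (1 / 2) (9 / 8) (by norm_num) (by norm_num) (by norm_num) (by norm_num)
  have hc : A 1 0 = 0 := by linarith [h1.2, h2.2]
  have hd : A 1 1 = A 0 0 := by rw [hc] at h1; linarith [h1.2]
  have hb : A 0 1 = 0 := by rw [hc] at h1; linarith [h1.1]
  have hdet := A.det_coe
  rw [Matrix.det_fin_two, hc, hb, hd] at hdet
  rw [← map_one toPSL, toPSL_eq_iff]
  have h3 : A 0 0 = 1 ∨ A 0 0 = -1 := by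
    have : A 0 0 ^ 2 = 1 := by nlinarith
    simpa using this
  rcases h3 with h3 | h3
  · left; ext i j
    fin_cases i <;> fin_cases j <;> simp [hc, hb, hd, h3]
  · right; ext i j
    fin_cases i <;> fin_cases j <;> simp [hc, hb, hd, h3]

/-- A motion that is not in a tiling is not approximated by the motions in the tiling. -/
theorem exists_gap (T : Tiling) {g : PSL2R} (hg : g ∉ T.motions) :
    ∃ ε > 0, ∀ h ∈ T.motions, ¬ Close ε g h := by
  obtain ⟨δ, hδ, hsep⟩ := exists_separation
  by_cases hex : ∃ h ∈ T.motions, Close (δ / 3) g h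
  · obtain ⟨h, hh, hgh⟩ := hex
    have hne : ∃ z ∈ tile, g • z ≠ h • z := by
      by_contra hcon
      push Not at hcon
      exact hg (eq_of_close_zero hcon ▸ hh)
    obtain ⟨z, hz, hzne⟩ := hne
    have hpos := dist_pos.mpr hzne
    refine ⟨min (δ / 3) (dist (g • z) (h • z) / 2), lt_min (by linarith) (by linarith),
      fun k hk hgk => ?_⟩
    have hkh : k = h := by
      refine hsep T k hk h hh ?_
      have h1 := (hgk _ basePoint_mem).trans (min_le_left _ _)
      have h2 := hgh _ basePoint_mem
      have := dist_triangle_left (k • basePoint) (h • basePoint) (g • basePoint)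
      linarith
    rw [hkh] at hgk
    have := (hgk z hz).trans (min_le_right _ _)
    linarith
  · push Not at hex
    exact ⟨δ / 3, by linarith, hex⟩

theorem exists_close_of_mem_vicinity {S T : Tiling} {K : Set ℍ} {ε : ℝ}
    (h : S ∈ vicinity T K ε) {g : PSL2R} (hg : g ∈ T.motions) (hK : g • basePoint ∈ K) :
    ∃ k ∈ S.motions, Close ε g k :=
  h.2 g hg ⟨_, smul_mem_smul_set basePoint_mem, hK⟩

theorem exists_close_of_mem_vicinity' {S T : Tiling} {K : Set ℍ} {ε : ℝ}
    (h : S ∈ vicinity T K ε) {g : PSL2R} (hg : g ∈ S.motions) (hK : g • basePoint ∈ K) :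
    ∃ k ∈ T.motions, Close ε g k :=
  h.1 g hg ⟨_, smul_mem_smul_set basePoint_mem, hK⟩

/-- The tilings with a copy that is close to `g • tile`. -/
def hitting (g : PSL2R) (ε : ℝ) : Set Tiling :=
  {T | ∃ η < ε, ∃ h ∈ T.motions, Close η g h}

theorem isOpen_hitting (g : PSL2R) (ε : ℝ) : IsOpen (hitting g ε) := by
  rw [isOpen_tiling_iff]
  rintro T ⟨η, hη, h, hh, hgh⟩
  refine ⟨{h • basePoint}, isCompact_singleton, (ε - η) / 2, by linarith, fun S hS => ?_⟩
  obtain ⟨k, hk, hhk⟩ := exists_close_of_mem_vicinity hS hh rfl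
  exact ⟨η + (ε - η) / 2, by linarith, k, hk, hgh.trans hhk⟩

/-- A tiling near S with a copy near g would force S itself to have a copy near g, against
`exists_gap`. This gives the Hausdorff property. -/
theorem exists_hitting_of_not_mem {S T : Tiling} {g : PSL2R} (hg : g ∈ T.motions)
    (hgS : g ∉ S.motions) : ∃ ε > 0, T ∈ hitting g ε ∧ ∃ U : Set Tiling, IsOpen U ∧ S ∈ U ∧
      Disjoint (hitting g ε) U := by
  obtain ⟨ε, hε, hgap⟩ := exists_gap S hgS
  set δ := min (ε / 2) 1 with hδ
  have hδ0 : 0 < δ := lt_min (by linarith) one_pos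
  have hδ1 : δ ≤ 1 := min_le_right _ _
  have hδ2 : δ ≤ ε / 2 := min_le_left _ _
  obtain ⟨U, hU, hUo, hSU⟩ := mem_nhds_iff.mp
    (vicinity_mem_nhds S (isCompact_closedBall (g • basePoint) 1) hδ0)
  refine ⟨δ, hδ0, ⟨0, hδ0, g, hg, fun z _ => by simp⟩, U, hUo, hSU, ?_⟩
  rw [Set.disjoint_left]
  rintro R ⟨η, hη, k, hk, hgk⟩ hRU
  obtain ⟨l, hl, hkl⟩ := exists_close_of_mem_vicinity' (hU hRU) hk (by
    rw [Metric.mem_closedBall, dist_comm]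
    exact (hgk _ basePoint_mem).trans (by linarith))
  exact hgap l hl fun z hz => ((hgk.trans hkl) z hz).trans (by linarith)

instance : T2Space Tiling where
  t2 S T hne := by
    have : S.motions ≠ T.motions := fun h => hne (Tiling.ext h)
    rw [Ne, Set.ext_iff] at this
    push Not at this
    obtain ⟨g, ⟨h1, h2⟩ | ⟨h1, h2⟩⟩ := this
    · obtain ⟨ε, -, hS, U, hU, hT, hd⟩ := exists_hitting_of_not_mem h1 h2
      exact ⟨_, U, isOpen_hitting g ε, hU, hS, hT, hd⟩
    · obtain ⟨ε, -, hT, U, hU, hS, hd⟩ := exists_hitting_of_not_mem h2 h1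
      exact ⟨U, _, hU, isOpen_hitting g ε, hS, hT, hd.symm⟩

theorem isCompact_tile : IsCompact tile :=
  (isCompact_closedBall I 8).of_isClosed_subset isClosed_tile fun _ hz =>
    Metric.mem_closedBall.mpr (dist_I_le_of_mem_tile hz)

theorem eventually_dist_smul_lt (A : SL(2, ℝ)) {K : Set ℍ} (hK : IsCompact K) {ε : ℝ}
    (hε : 0 < ε) : ∀ᶠ B in 𝓝 A, ∀ z ∈ K, dist (A • z) (B • z) < ε := by
  apply hK.eventually_forall_of_forall_eventually
  intro z _
  have hc : Continuous fun p : SL(2, ℝ) × ℍ => dist (A • p.2) (p.1 • p.2) := by fun_prop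
  exact hc.continuousAt.eventually_lt continuousAt_const (by simpa using hε)

theorem eventually_close (A : SL(2, ℝ)) {ε : ℝ} (hε : 0 < ε) :
    ∀ᶠ B in 𝓝 A, Close ε (toPSL A) (toPSL B) :=
  (eventually_dist_smul_lt A isCompact_tile hε).mono fun _ hB z hz => (hB z hz).le

theorem I_mem_tile : I ∈ tile := by
  have hb : bump 1 = 0 := by
    rcases bump_eq_zero_or 1 with hb | ⟨-, -, hb, -⟩
    · exact hb
    · norm_num at hb
  rw [mem_tile_iff, I_im, I_re, hb]
  norm_num

theorem isCompact_dist_smul_le (z : ℍ) (r : ℝ) : IsCompact {B : SL(2, ℝ) | dist (B • I) z ≤ r} :=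
  isProperMap_smul_I.isCompact_preimage (isCompact_closedBall z r)

/-- Motions that are close on the tile are close in the group. -/
theorem exists_lift_of_close (A : SL(2, ℝ)) {U : Set SL(2, ℝ)} (hU : U ∈ 𝓝 A) :
    ∃ ε > 0, ∀ g : PSL2R, Close ε (toPSL A) g → ∃ B ∈ U, toPSL B = g := by
  obtain ⟨V, hVU, hV, hA⟩ := mem_nhds_iff.mp hU
  -- The orbit map of I is proper, so the matrices to be excluded form a compact set. Each of them
  -- differs from A somewhere on the tile, hence by a uniform amount. Neighbourhoods of both A and
  -- -A are removed since the two agree in PSL(2,ℝ).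
  have hC : IsCompact ({B : SL(2, ℝ) | dist (B • I) (A • I) ≤ 1} \ (V ∪ (fun B => -B) ⁻¹' V)) := by
    refine (isCompact_dist_smul_le _ _).diff (hV.union (hV.preimage ?_))
    exact continuous_induced_rng.mpr (continuous_subtype_val.neg)
  obtain ⟨n, hn⟩ := hC.elim_directed_cover
    (fun n : ℕ => {B : SL(2, ℝ) | ∃ z ∈ tile, (1 / ((n : ℝ) + 1)) < dist (A • z) (B • z)})
    (fun n => by
      have : {B : SL(2, ℝ) | ∃ z ∈ tile, (1 / ((n : ℝ) + 1)) < dist (A • z) (B • z)} =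
          ⋃ z ∈ tile, {B : SL(2, ℝ) | (1 / ((n : ℝ) + 1)) < dist (A • z) (B • z)} := by
        ext B; simp
      rw [this]
      exact isOpen_biUnion fun z _ => isOpen_lt continuous_const (by fun_prop))
    (by
      rintro B ⟨-, hB⟩
      have hne : ∃ z ∈ tile, A • z ≠ B • z := by
        by_contra hcon
        push Not at hcon
        have := eq_of_close_zero (g := toPSL A) (h := toPSL B) hcon
        rcases toPSL_eq_iff.mp this with h | h
        · exact hB (Or.inl (h ▸ hA))
        · exact hB (Or.inr (show -B ∈ V from h ▸ hA))
      obtain ⟨z, hz, hne⟩ := hne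
      obtain ⟨n, hn⟩ := exists_nat_one_div_lt (dist_pos.mpr hne)
      exact mem_iUnion.mpr ⟨n, z, hz, hn⟩)
    (directed_of_isDirected_le fun m n hmn B => by
      rintro ⟨z, hz, h⟩
      refine ⟨z, hz, lt_of_le_of_lt ?_ h⟩
      have : (m : ℝ) ≤ n := by exact_mod_cast hmn
      gcongr)
  refine ⟨min (1 / ((n : ℝ) + 1)) 1, lt_min (by positivity) one_pos, fun g hg => ?_⟩
  obtain ⟨B, rfl⟩ := toPSL_surjective g
  by_cases hBV : B ∈ V ∪ (fun B => -B) ⁻¹' V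
  · rcases hBV with h | h
    · exact ⟨B, hVU h, rfl⟩
    · exact ⟨-B, hVU h, toPSL_neg B⟩
  · exfalso
    obtain ⟨z, hz, hlt⟩ := hn ⟨by
      change dist (B • I) (A • I) ≤ 1
      rw [dist_comm]
      exact (hg I I_mem_tile).trans (min_le_right _ _), hBV⟩
    have := (hg z hz).trans (min_le_left _ _)
    rw [toPSL_smul, toPSL_smul] at this
    linarith

instance : PolishSpace SL(2, ℝ) := by
  have : PolishSpace (Matrix (Fin 2) (Fin 2) ℝ) :=
    inferInstanceAs (PolishSpace (Fin 2 → Fin 2 → ℝ))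
  exact Matrix.SpecialLinearGroup.isClosedEmbedding_val.polishSpace

instance : LocallyCompactSpace SL(2, ℝ) := by
  have : LocallyCompactSpace (Matrix (Fin 2) (Fin 2) ℝ) :=
    inferInstanceAs (LocallyCompactSpace (Fin 2 → Fin 2 → ℝ))
  exact Matrix.SpecialLinearGroup.isClosedEmbedding_val.locallyCompactSpace

instance : MeasurableSpace SL(2, ℝ) := borel _

instance : BorelSpace SL(2, ℝ) := ⟨rfl⟩

/-- The sets `hitting` with centres in a dense sequence and radii 1 / (n + 1) separate tilings. The
Lusin–Souslin theorem uses this in `exists_measurable_section`. -/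
instance : MeasurableSpace.CountablySeparated Tiling := by
  rw [MeasurableSpace.countablySeparated_def]
  refine ⟨⟨range fun p : ℕ × ℕ => hitting (toPSL (TopologicalSpace.denseSeq SL(2, ℝ) p.1))
    (1 / ((p.2 : ℝ) + 1)), countable_range _, ?_, ?_⟩⟩
  · rintro _ ⟨p, rfl⟩
    exact (isOpen_hitting _ _).measurableSet
  · have key : ∀ S T : Tiling, (∀ s ∈ range fun p : ℕ × ℕ =>
        hitting (toPSL (TopologicalSpace.denseSeq SL(2, ℝ) p.1)) (1 / ((p.2 : ℝ) + 1)),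
        S ∈ s ↔ T ∈ s) → S.motions ⊆ T.motions := by
      intro S T h g hg
      by_contra hgT
      obtain ⟨ε, hε, hgap⟩ := exists_gap T hgT
      obtain ⟨A, rfl⟩ := toPSL_surjective g
      obtain ⟨n, hn⟩ := exists_nat_one_div_lt (show 0 < ε / 2 by linarith)
      have hn0 : (0 : ℝ) < 1 / ((n : ℝ) + 1) := by positivity
      have hev := eventually_close A (show 0 < 1 / ((n : ℝ) + 1) / 2 by linarith)
      obtain ⟨_, ⟨k, rfl⟩, hk⟩ := (TopologicalSpace.denseRange_denseSeq SL(2, ℝ)).inter_nhds_nonempty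
        hev
      have := (h _ ⟨(k, n), rfl⟩).mp ⟨1 / ((n : ℝ) + 1) / 2, by dsimp only; linarith, _, hg, hk.symm⟩
      obtain ⟨η, hη, l, hl, hkl⟩ := this
      refine hgap l hl fun z hz => ((hk.trans hkl) z hz).trans ?_
      dsimp only at hη
      linarith
    intro S _ T _ h
    exact Tiling.ext (Subset.antisymm (key S T h) (key T S fun s hs => (h s hs).symm))

/-! ### The modular group as a free product of cyclic groups of orders two and three. -/

theorem rotInt_pow_three : rotInt ^ 3 = -1 := by decide

theorem S_sq : ModularGroup.S ^ 2 = -1 := by decide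

theorem S_mul_rotInt : ModularGroup.S * rotInt = ModularGroup.T⁻¹ := by decide

theorem rotInt_mul_T : rotInt * ModularGroup.T = -ModularGroup.S := by decide

/-- An induction principle for `SL(2, ℤ)`: a subgroup containing `S` and the rotation is
everything. -/
theorem mem_of_S_mem_of_rotInt_mem (H : Subgroup SL(2, ℤ)) (hS : ModularGroup.S ∈ H)
    (hR : rotInt ∈ H) (γ : SL(2, ℤ)) : γ ∈ H := by
  have hT : ModularGroup.T ∈ H := by
    rw [← inv_mem_iff, ← S_mul_rotInt]
    exact mul_mem hS hR
  have h1 : Subgroup.closure {ModularGroup.S, ModularGroup.T} ≤ H := by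
    rw [Subgroup.closure_le]
    rintro _ (rfl | rfl)
    exacts [hS, hT]
  rw [SpecialLinearGroup.SL2Z_generators] at h1
  exact h1 trivial

/-- The homomorphism from a cyclic group that sends the generator to `g`. -/
def cyclicHom {G : Type*} [Group G] (n : ℕ) (g : G) (h : g ^ n = 1) :
    Multiplicative (ZMod n) →* G :=
  AddMonoidHom.toMultiplicativeLeft
    (ZMod.lift n ⟨zmultiplesHom (Additive G) (Additive.ofMul g), by
      simp only [zmultiplesHom_apply, natCast_zsmul]
      rw [← ofMul_pow, h, ofMul_one]⟩)

theorem cyclicHom_apply {G : Type*} [Group G] (n : ℕ) (g : G) (h : g ^ n = 1) (k : ℤ) :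
    cyclicHom n g h (Multiplicative.ofAdd (k : ZMod n)) = g ^ k := by
  simp only [cyclicHom, AddMonoidHom.toMultiplicativeLeft_apply_apply, toAdd_ofAdd, ZMod.lift_coe]
  simp

/-- The orders of the factors of the modular group. -/
def factorOrder (b : Bool) : ℕ := cond b 3 2

/-- The pair of an involution and an element of order three. -/
def factorHom {G : Type*} [Group G] (s r : G) (hs : s ^ 2 = 1) (hr : r ^ 3 = 1) :
    (b : Bool) → Multiplicative (ZMod (factorOrder b)) →* G
  | false => cyclicHom 2 s hs
  | true => cyclicHom 3 r hr

theorem toPSL_S_sq : toPSL (incl ModularGroup.S) ^ 2 = 1 := by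
  rw [← map_pow, ← map_pow, S_sq, incl_neg, toPSL_neg, map_one, map_one]

theorem toPSL_rotInt_pow : toPSL (incl rotInt) ^ 3 = 1 := by
  rw [← map_pow, ← map_pow, rotInt_pow_three, incl_neg, toPSL_neg, map_one, map_one]

theorem re_S_smul (z : ℍ) : (ModularGroup.S • z).re = -z.re / Complex.normSq z := by
  have h := congrArg Complex.re (coe_specialLinearGroup_apply ModularGroup.S z)
  rw [coe_re] at h
  rw [h]
  simp [ModularGroup.coe_S, Complex.div_re]

theorem re_rotInt_smul (z : ℍ) : (rotInt • z).re = (1 - z.re) / Complex.normSq (1 - z) := by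
  have h := congrArg Complex.re (coe_specialLinearGroup_apply rotInt z)
  rw [coe_re] at h
  rw [h]
  simp [coe_rotInt, neg_add_eq_sub]

theorem re_rotInt_sq_smul (z : ℍ) : ((rotInt ^ 2) • z).re = 1 - z.re / Complex.normSq z := by
  have hR : ((rotInt ^ 2 : SL(2, ℤ)) : Matrix (Fin 2) (Fin 2) ℤ) = !![-1, 1; -1, 0] := by decide
  have h := congrArg Complex.re (coe_specialLinearGroup_apply (rotInt ^ 2) z)
  have h0 : Complex.normSq (z : ℂ) ≠ 0 := (Complex.normSq_pos.mpr (ne_zero z)).ne'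
  rw [coe_re] at h
  rw [h]
  simp only [hR, Complex.div_re]
  simp
  field_simp
  rw [Complex.normSq_apply]
  simp
  ring

/-- Ping-pong on the two quarter planes: z ↦ -1/z maps re > 0 into re < 0, and both nontrivial
rotations map re < 0 into re > 0. With two factors one must have at least three elements, here the
group of order three. -/
theorem coprod_hom_injective : Function.Injective (Monoid.CoprodI.lift
    (factorHom _ _ toPSL_S_sq toPSL_rotInt_pow)) := by
  refine Monoid.CoprodI.lift_injective_of_ping_pong
    (factorHom _ _ toPSL_S_sq toPSL_rotInt_pow) (Or.inr ⟨true, ?_⟩)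
    (fun b => {z : ℍ | cond b (0 < z.re) (z.re < 0)}) ?_ ?_ ?_
  · change 3 ≤ Cardinal.mk (ZMod 3)
    simp
  · rintro (_ | _)
    · exact ⟨(-1 : ℝ) +ᵥ I, by simp⟩
    · exact ⟨(1 : ℝ) +ᵥ I, by simp⟩
  · rintro (_ | _) (_ | _) hij
    · exact absurd rfl hij
    · exact Set.disjoint_left.mpr fun z (h1 : z.re < 0) (h2 : 0 < z.re) => lt_asymm h1 h2
    · exact Set.disjoint_left.mpr fun z (h1 : 0 < z.re) (h2 : z.re < 0) => lt_asymm h1 h2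
    · exact absurd rfl hij
  · rintro (_ | _) (_ | _) hij
    · exact absurd rfl hij
    · rintro h hne _ ⟨z, hz, rfl⟩
      have hh : h = Multiplicative.ofAdd ((1 : ℤ) : ZMod 2) :=
        (by decide : ∀ h : Multiplicative (ZMod 2), h ≠ 1 →
          h = Multiplicative.ofAdd ((1 : ℤ) : ZMod 2)) h hne
      subst hh
      change (cyclicHom 2 _ toPSL_S_sq (Multiplicative.ofAdd ((1 : ℤ) : ZMod 2)) • z).re < 0
      rw [cyclicHom_apply, zpow_one, toPSL_smul, incl_smul, re_S_smul]
      exact div_neg_of_neg_of_pos (neg_neg_of_pos hz) (Complex.normSq_pos.mpr (ne_zero z))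
    · rintro h hne _ ⟨z, hz, rfl⟩
      have hh : h = Multiplicative.ofAdd ((1 : ℤ) : ZMod 3) ∨
          h = Multiplicative.ofAdd ((2 : ℤ) : ZMod 3) :=
        (by decide : ∀ h : Multiplicative (ZMod 3), h ≠ 1 →
          h = Multiplicative.ofAdd ((1 : ℤ) : ZMod 3) ∨
          h = Multiplicative.ofAdd ((2 : ℤ) : ZMod 3)) h hne
      replace hz : z.re < 0 := hz
      rcases hh with rfl | rfl
      · change 0 < (cyclicHom 3 _ toPSL_rotInt_pow (Multiplicative.ofAdd ((1 : ℤ) : ZMod 3)) • z).re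
        rw [cyclicHom_apply, zpow_one, toPSL_smul, incl_smul, re_rotInt_smul]
        refine div_pos (by linarith) (Complex.normSq_pos.mpr fun h0 => ?_)
        have := congrArg Complex.re h0
        simp at this
        linarith
      · change 0 < (cyclicHom 3 _ toPSL_rotInt_pow (Multiplicative.ofAdd ((2 : ℤ) : ZMod 3)) • z).re
        rw [cyclicHom_apply, zpow_ofNat, ← map_pow, ← map_pow, toPSL_smul, incl_smul,
          re_rotInt_sq_smul]
        have := div_neg_of_neg_of_pos hz (Complex.normSq_pos.mpr (ne_zero z))
        linarith
    · exact absurd rfl hij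

/-- The modular group is the free product of a group of order two and one of order three. -/
theorem exists_hom {G : Type*} [Group G] (s r : G) (hs : s ^ 2 = 1) (hr : r ^ 3 = 1) :
    ∃ ρ : SL(2, ℤ) →* G, ρ ModularGroup.S = s ∧ ρ rotInt = r := by
  set L := Monoid.CoprodI.lift (factorHom _ _ toPSL_S_sq toPSL_rotInt_pow) with hL
  have hLS : L (Monoid.CoprodI.of (i := false) (Multiplicative.ofAdd ((1 : ℤ) : ZMod 2))) =
      toPSL (incl ModularGroup.S) := by
    rw [hL, Monoid.CoprodI.lift_of]
    exact (cyclicHom_apply 2 _ toPSL_S_sq 1).trans (zpow_one _)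
  have hLR : L (Monoid.CoprodI.of (i := true) (Multiplicative.ofAdd ((1 : ℤ) : ZMod 3))) =
      toPSL (incl rotInt) := by
    rw [hL, Monoid.CoprodI.lift_of]
    exact (cyclicHom_apply 3 _ toPSL_rotInt_pow 1).trans (zpow_one _)
  have hrange : ∀ γ, (toPSL.comp incl) γ ∈ L.range :=
    mem_of_S_mem_of_rotInt_mem (L.range.comap (toPSL.comp incl)) ⟨_, hLS⟩ ⟨_, hLR⟩
  let e := MonoidHom.ofInjective coprod_hom_injective
  let ρ : SL(2, ℤ) →* G := (Monoid.CoprodI.lift (factorHom s r hs hr)).comp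
    (e.symm.toMonoidHom.comp ((toPSL.comp incl).codRestrict L.range hrange))
  have key : ∀ γ c, L c = toPSL (incl γ) → ρ γ = Monoid.CoprodI.lift (factorHom s r hs hr) c := by
    intro γ c hc
    have : e.symm (((toPSL.comp incl).codRestrict L.range hrange) γ) = c := by
      rw [MulEquiv.symm_apply_eq]
      exact Subtype.ext hc.symm
    change Monoid.CoprodI.lift (factorHom s r hs hr) (e.symm _) = _
    rw [this]
  refine ⟨ρ, ?_, ?_⟩
  · rw [key _ _ hLS, Monoid.CoprodI.lift_of]
    exact (cyclicHom_apply 2 s hs 1).trans (zpow_one _)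
  · rw [key _ _ hLR, Monoid.CoprodI.lift_of]
    exact (cyclicHom_apply 3 r hr 1).trans (zpow_one _)

/-! ### The action of the modular group on pairs of dyadic indices. -/

/-- The pairs of dyadic indices at the first two of the three horoballs around a triangle. -/
abbrev IndexPair : Type := ℤ_[2] × ℤ_[2]

/-- The effect on the pair of indices of moving to the triangle across the tangency point. -/
@[simps]
def flip : IndexPair ≃ₜ IndexPair where
  toFun p := (p.2 + 1, p.1 - 1)
  invFun p := (p.2 + 1, p.1 - 1)
  left_inv p := by ext <;> simp
  right_inv p := by ext <;> simp

/-- The effect on the pair of indices of rotating the triangle. -/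
@[simps]
def turn (w : ℤ_[2]) : IndexPair ≃ₜ IndexPair where
  toFun p := (w - p.1 - p.2, p.1)
  invFun p := (p.2, w - p.1 - p.2)
  left_inv p := Prod.ext (by ring) (by ring)
  right_inv p := Prod.ext (by ring) (by ring)

theorem flip_sq : flip ^ 2 = 1 := by
  ext p <;> simp [pow_succ]

theorem turn_pow (w : ℤ_[2]) : turn w ^ 3 = 1 := by
  ext p <;> simp [pow_succ] <;> ring

/-- The action of the modular group on the pairs of indices. -/
def indexAction (w : ℤ_[2]) : SL(2, ℤ) →* (IndexPair ≃ₜ IndexPair) :=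
  (exists_hom flip (turn w) flip_sq (turn_pow w)).choose

theorem indexAction_S (w : ℤ_[2]) : indexAction w ModularGroup.S = flip :=
  (exists_hom flip (turn w) flip_sq (turn_pow w)).choose_spec.1

theorem indexAction_rotInt (w : ℤ_[2]) : indexAction w rotInt = turn w :=
  (exists_hom flip (turn w) flip_sq (turn_pow w)).choose_spec.2

theorem indexAction_T_inv (w : ℤ_[2]) : indexAction w ModularGroup.T⁻¹ = flip * turn w := by
  rw [← S_mul_rotInt, map_mul, indexAction_S, indexAction_rotInt]

theorem indexAction_neg_one (w : ℤ_[2]) : indexAction w (-1) = 1 := by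
  rw [← S_sq, map_pow, indexAction_S, flip_sq]

/-- The dyadic indices of all horoballs, measured from all triangles, in terms of two of them. -/
def index (w : ℤ_[2]) (x : IndexPair) (γ : SL(2, ℤ)) : ℤ_[2] := (indexAction w γ⁻¹ x).1

theorem isIndexing_index (w : ℤ_[2]) (x : IndexPair) : IsIndexing (index w x) where
  mul_T δ := by
    rw [index, mul_inv_rev, map_mul, indexAction_T_inv]
    simp [index]
  neg δ := by
    have : (-δ)⁻¹ = -1 * δ⁻¹ := by rw [neg_one_mul, inv_neg]
    rw [index, this, map_mul, indexAction_neg_one, one_mul, index]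

theorem index_mul_rotInt (w : ℤ_[2]) (x : IndexPair) (γ : SL(2, ℤ)) :
    index w x (γ * rotInt) = (indexAction w γ⁻¹ x).2 := by
  rw [index, mul_inv_rev, map_mul, map_inv, indexAction_rotInt]
  rfl

theorem index_sum (w : ℤ_[2]) (x : IndexPair) (γ : SL(2, ℤ)) :
    index w x γ + index w x (γ * rotInt) + index w x (γ * rotInt ^ 2) = w := by
  have h : index w x (γ * rotInt ^ 2) = w - index w x γ - index w x (γ * rotInt) := by
    rw [pow_two, ← mul_assoc, index_mul_rotInt, index_mul_rotInt, mul_inv_rev, map_mul, map_inv,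
      indexAction_rotInt]
    rfl
  rw [h]; ring

theorem index_indexAction (w : ℤ_[2]) (x : IndexPair) (γ δ : SL(2, ℤ)) :
    index w (indexAction w γ x) δ = index w x (γ⁻¹ * δ) := by
  rw [index, index, mul_inv_rev, inv_inv, map_mul]
  rfl

/-- The rule that the pair at γδ comes from the pair at γ by `indexAction w δ⁻¹` passes to products
and inverses of δ, so it suffices to check S and the rotation. For S it follows from the step rule
along a horoball, for the rotation from the fixed sum. -/
theorem eq_index {φ : SL(2, ℤ) → ℤ_[2]} (hφ : IsIndexing φ) {w : ℤ_[2]}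
    (hw : ∀ γ, φ γ + φ (γ * rotInt) + φ (γ * rotInt ^ 2) = w) :
    φ = index w (φ 1, φ rotInt) := by
  let H : Subgroup SL(2, ℤ) :=
    { carrier := {δ | ∀ γ, (φ (γ * δ), φ (γ * δ * rotInt)) =
        indexAction w δ⁻¹ (φ γ, φ (γ * rotInt))}
      mul_mem' := by
        intro δ ε hδ hε γ
        rw [← mul_assoc, hε, hδ, mul_inv_rev, map_mul]
        rfl
      one_mem' := by intro γ; simp
      inv_mem' := by
        intro δ hδ γ
        have := hδ (γ * δ⁻¹)
        rw [inv_mul_cancel_right] at this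
        rw [this, inv_inv, map_inv]
        exact (Homeomorph.apply_symm_apply _ _).symm }
  have h := mem_of_S_mem_of_rotInt_mem H ?_ ?_
  · funext γ
    have := h γ 1
    rw [one_mul, one_mul] at this
    rw [index, ← this]
  · intro γ
    have h1 : φ (γ * ModularGroup.S) = φ (γ * rotInt) + 1 := by
      rw [← hφ.mul_T, mul_assoc, rotInt_mul_T, mul_neg, hφ.neg]
    have h2 : φ (γ * ModularGroup.S * rotInt) = φ γ - 1 := by
      rw [mul_assoc, S_mul_rotInt, ← zpow_neg_one, hφ.mul_T_zpow]; push_cast; ring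
    rw [h1, h2, map_inv, indexAction_S]
    rfl
  · intro γ
    have h1 := hw γ
    rw [pow_two, ← mul_assoc] at h1
    rw [map_inv, indexAction_rotInt]
    refine Prod.ext rfl ?_
    change φ (γ * rotInt * rotInt) = w - φ γ - φ (γ * rotInt)
    rw [← h1]; ring

theorem index_injective (w : ℤ_[2]) : Function.Injective (index w) := by
  intro x y h
  have h1 := congrFun h 1
  have h2 := congrFun h (1 * rotInt)
  rw [index_mul_rotInt, index_mul_rotInt] at h2
  simp only [index, inv_one, map_one] at h1 h2
  exact Prod.ext h1 h2

theorem continuous_index (w : ℤ_[2]) (γ : SL(2, ℤ)) : Continuous fun x => index w x γ :=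
  continuous_fst.comp (indexAction w γ⁻¹).continuous

/-! ### The parametrization of nondegenerate tilings and its fibres. -/

/-- The tiling whose packing is moved by the first component, with the indices given by the
second. -/
def tilingAt (w : ℤ_[2]) (p : SL(2, ℝ) × IndexPair) : Tiling :=
  toPSL p.1 • tilingOf (index w p.2) (isIndexing_index w p.2)

theorem mem_tilingAt {w : ℤ_[2]} {A : SL(2, ℝ)} {x : IndexPair} {g : PSL2R} :
    g ∈ (tilingAt w (A, x)).motions ↔
      ∃ δ n, (2 : ℤ_[2]) ^ (n + 1) ∣ index w x δ ∧ g = toPSL A * place δ n := by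
  constructor
  · rintro ⟨_, ⟨δ, n, h, rfl⟩, rfl⟩
    exact ⟨δ, n, h, rfl⟩
  · rintro ⟨δ, n, h, rfl⟩
    exact ⟨_, ⟨δ, n, h, rfl⟩, rfl⟩

theorem toPSL_incl_mul_place (γ δ : SL(2, ℤ)) (n : ℕ) :
    toPSL (incl γ) * place δ n = place (γ * δ) n := by
  rw [place, ← map_mul, ← mul_assoc, ← map_mul, place]

theorem toPSL_smul_tilingAt (w : ℤ_[2]) (B : SL(2, ℝ)) (p : SL(2, ℝ) × IndexPair) :
    toPSL B • tilingAt w p = tilingAt w (B * p.1, p.2) := by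
  rw [tilingAt, tilingAt, smul_smul, ← map_mul]

/-- Changing the reference triangle by a modular element changes the pair of indices accordingly and
leaves the tiling alone. -/
theorem tilingAt_mul_incl (w : ℤ_[2]) (A : SL(2, ℝ)) (x : IndexPair) (γ : SL(2, ℤ)) :
    tilingAt w (A * incl γ⁻¹, indexAction w γ x) = tilingAt w (A, x) := by
  apply Tiling.ext
  ext g
  rw [mem_tilingAt, mem_tilingAt]
  constructor
  · rintro ⟨δ, n, h, rfl⟩
    rw [index_indexAction] at h
    exact ⟨_, n, h, by rw [map_mul, mul_assoc, toPSL_incl_mul_place]⟩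
  · rintro ⟨δ, n, h, rfl⟩
    refine ⟨γ * δ, n, ?_, ?_⟩
    · rwa [index_indexAction, inv_mul_cancel_left]
    · rw [map_mul, mul_assoc, toPSL_incl_mul_place, inv_mul_cancel_left]

/-- The copies at the bottom of the horoballs are those without children. -/
theorem mul_half_mem_tilingAt_iff {w : ℤ_[2]} {A : SL(2, ℝ)} {x : IndexPair} {δ : SL(2, ℤ)}
    {n : ℕ} (h : (2 : ℤ_[2]) ^ (n + 1) ∣ index w x δ) :
    toPSL A * place δ n * half ∈ (tilingAt w (A, x)).motions ↔ n ≠ 0 := by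
  rw [mem_tilingAt]
  constructor
  · rintro ⟨δ', n', -, h'⟩ rfl
    rw [mul_assoc, mul_right_inj] at h'
    exact place_ne_mul_half n' h'.symm
  · intro hn
    obtain ⟨m, rfl⟩ := Nat.exists_eq_succ_of_ne_zero hn
    exact ⟨δ, m, (pow_dvd_pow _ (by omega)).trans h, by
      rw [mul_assoc, Nat.succ_eq_add_one, place_succ_mul_half]⟩

theorem exists_dvd_index (w : ℤ_[2]) (x : IndexPair) (δ : SL(2, ℤ)) (n : ℕ) :
    ∃ k : ℤ, (2 : ℤ_[2]) ^ n ∣ index w x (δ * ModularGroup.T ^ k) := by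
  obtain ⟨m, hm⟩ := exists_int_dvd_add (index w x δ) n
  exact ⟨m, by rwa [(isIndexing_index w x).mul_T_zpow]⟩

theorem dvd_index_of_tilingAt_eq {w : ℤ_[2]} {A : SL(2, ℝ)} {x y : IndexPair}
    (h : tilingAt w (A, x) = tilingAt w (A, y)) {δ : SL(2, ℤ)} {n : ℕ}
    (hd : (2 : ℤ_[2]) ^ (n + 1) ∣ index w x δ) : (2 : ℤ_[2]) ^ (n + 1) ∣ index w y δ := by
  have h1 : toPSL A * place δ n ∈ (tilingAt w (A, y)).motions := by
    rw [← h, mem_tilingAt]; exact ⟨δ, n, hd, rfl⟩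
  obtain ⟨δ', n', h2, h3⟩ := mem_tilingAt.mp h1
  rw [mul_right_inj, place_eq_iff] at h3
  obtain ⟨rfl, rfl | rfl⟩ := h3
  · exact h2
  · rwa [(isIndexing_index w y).neg]

theorem eq_of_forall_two_pow_dvd {a b : ℤ_[2]} (h : ∀ n : ℕ, (2 : ℤ_[2]) ^ n ∣ a - b) : a = b := by
  rw [← sub_eq_zero, ← norm_eq_zero]
  refine le_antisymm (le_of_forall_pos_le_add fun ε hε => ?_) (norm_nonneg _)
  obtain ⟨n, hn⟩ := exists_pow_lt_of_lt_one hε (show (1 / 2 : ℝ) < 1 by norm_num)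
  have h1 := (PadicInt.norm_le_pow_iff_mem_span_pow (p := 2) (a - b) n).mpr
    (Ideal.mem_span_singleton.mpr (by simpa using h n))
  refine h1.trans ?_
  rw [zpow_neg, zpow_natCast]
  simp only [one_div, inv_pow] at hn
  push_cast
  linarith

/-- The positions of the copies of level n in a horoball determine its index modulo 2 ^ (n + 1). -/
theorem index_pair_eq_of_tilingAt_eq {w : ℤ_[2]} {A : SL(2, ℝ)} {x y : IndexPair}
    (h : tilingAt w (A, x) = tilingAt w (A, y)) : x = y := by
  apply index_injective w
  funext δ
  refine eq_of_forall_two_pow_dvd fun n => (pow_dvd_pow _ (Nat.le_succ n)).trans ?_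
  obtain ⟨k, hk⟩ := exists_dvd_index w x δ (n + 1)
  have hk' := dvd_index_of_tilingAt_eq h hk
  rw [(isIndexing_index w _).mul_T_zpow] at hk hk'
  simpa using dvd_sub hk hk'

/-- A childless copy has level 0 in both descriptions. Comparing its two expressions shows that A
and A' differ by an integral matrix, the sign being absorbed into γ; then the pairs are compared
over the same packing. -/
theorem exists_of_tilingAt_eq {w : ℤ_[2]} {A A' : SL(2, ℝ)} {x x' : IndexPair}
    (h : tilingAt w (A, x) = tilingAt w (A', x')) :
    ∃ γ : SL(2, ℤ), A' = A * incl γ⁻¹ ∧ x' = indexAction w γ x := by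
  obtain ⟨k, hk⟩ := exists_dvd_index w x 1 (0 + 1)
  have h1 : toPSL A * place (1 * ModularGroup.T ^ k) 0 ∈ (tilingAt w (A', x')).motions := by
    rw [← h, mem_tilingAt]
    exact ⟨_, 0, hk, rfl⟩
  obtain ⟨δ, n, hd, he⟩ := mem_tilingAt.mp h1
  have h2 : ¬ toPSL A * place (1 * ModularGroup.T ^ k) 0 * half ∈ (tilingAt w (A, x)).motions := by
    rw [mul_half_mem_tilingAt_iff hk]; simp
  rw [h, he, mul_half_mem_tilingAt_iff hd, not_not] at h2
  subst h2
  set ε := 1 * ModularGroup.T ^ k with hε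
  have h3 : toPSL A' = toPSL (A * incl (ε * δ⁻¹)) := by
    rw [place, place, dil_zero, mul_one, mul_one] at he
    rw [map_mul, map_mul, map_mul, ← mul_assoc, he, map_inv, map_inv, mul_inv_cancel_right]
  have h4 : ∃ γ : SL(2, ℤ), A' = A * incl γ⁻¹ := by
    rcases toPSL_eq_iff.mp h3 with h4 | h4
    · exact ⟨(ε * δ⁻¹)⁻¹, by rw [inv_inv, h4]⟩
    · exact ⟨(-(ε * δ⁻¹))⁻¹, by rw [inv_inv, incl_neg, mul_neg, h4]⟩
  obtain ⟨γ, hγ⟩ := h4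
  refine ⟨γ, hγ, ?_⟩
  rw [← tilingAt_mul_incl w A x γ, ← hγ] at h
  exact (index_pair_eq_of_tilingAt_eq h).symm

/-! ### Continuity of the parametrization. -/

theorem finite_incl_preimage {C : Set SL(2, ℝ)} (hC : IsCompact C) : (incl ⁻¹' C).Finite := by
  have h : IsClosedEmbedding (incl : SL(2, ℤ) → SL(2, ℝ)) :=
    Topology.IsClosedEmbedding.specialLinearGroup_map (f := Int.castRingHom ℝ)
      Int.isClosedEmbedding_coe_real
  exact (h.isCompact_preimage hC).finite_of_discrete

theorem im_smul_I_le_one (δ : SL(2, ℤ)) : (δ • I).im ≤ 1 := by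
  rw [ModularGroup.im_smul_eq_div_normSq, I_im, ModularGroup.denom_apply, Complex.normSq_apply,
    div_le_one_iff]
  left
  simp only [coe_I, Complex.add_re, Complex.mul_re, Complex.intCast_re, Complex.I_re, mul_zero,
    Complex.intCast_im, Complex.I_im, mul_one, sub_self, zero_add, Complex.add_im, Complex.mul_im,
    add_zero]
  have h : 0 < δ 1 1 * δ 1 1 + δ 1 0 * δ 1 0 := by
    have hdet := δ.det_coe
    rw [Matrix.det_fin_two] at hdet
    rcases eq_or_ne (δ 1 1) 0 with h0 | h0
    · have : δ 1 0 ≠ 0 := by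
        intro h1; rw [h0, h1] at hdet; simp at hdet
      nlinarith [mul_self_pos.mpr this, mul_self_nonneg (δ 1 1)]
    · nlinarith [mul_self_pos.mpr h0, mul_self_nonneg (δ 1 0)]
  have h1 : (1 : ℝ) ≤ δ 1 1 * δ 1 1 + δ 1 0 * δ 1 0 := by exact_mod_cast h
  exact ⟨by linarith, h1⟩

/-- Heights change by at most the exponential of the distance, and modular images of I have height
at most 1. Hence copies of high level are far from I. -/
theorem two_pow_le_exp_dist (δ : SL(2, ℤ)) (n : ℕ) :
    (2 : ℝ) ^ n ≤ Real.exp (dist (place δ n • I) I) := by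
  have h1 : dist (place δ n • I) I = dist (dil n • I) (δ⁻¹ • I) := by
    rw [place_smul, ← dist_smul (incl δ⁻¹), ← mul_smul, ← map_mul, inv_mul_cancel, map_one,
      one_smul, incl_smul]
  have h2 := im_le_im_mul_exp_dist (dil n • I) (δ⁻¹ • I)
  rw [im_dil_smul, I_im, mul_one] at h2
  rw [h1]
  exact h2.trans (mul_le_of_le_one_left (Real.exp_pos _).le (im_smul_I_le_one _))

theorem finite_place_near (R : ℝ) :
    {p : SL(2, ℤ) × ℕ | dist (place p.1 p.2 • I) I ≤ R}.Finite := by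
  obtain ⟨N, hN⟩ := pow_unbounded_of_one_lt (Real.exp R) one_lt_two
  have h : ∀ n : ℕ, {δ : SL(2, ℤ) | dist (place δ n • I) I ≤ R}.Finite := by
    intro n
    refine (finite_incl_preimage (isCompact_dist_smul_le I (R + dist (dil n • I) I))).subset ?_
    intro δ hδ
    change dist (incl δ • I) I ≤ _
    have := dist_triangle_left (incl δ • I) I (place δ n • I)
    rw [place_smul, dist_smul] at this
    change dist (place δ n • I) I ≤ R at hδ
    rw [place_smul] at hδ
    linarith
  refine ((Set.finite_Iio N).biUnion fun n _ =>
    (h n).image fun δ => (δ, n)).subset ?_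
  rintro ⟨δ, n⟩ hp
  change dist (place δ n • I) I ≤ R at hp
  refine mem_iUnion₂.mpr ⟨n, ?_, δ, hp, rfl⟩
  by_contra hn
  have h1 : (2 : ℝ) ^ N ≤ 2 ^ n := pow_le_pow_right₀ one_le_two (not_lt.mp hn)
  have h2 := two_pow_le_exp_dist δ n
  have h3 := Real.exp_le_exp.mpr hp
  linarith

theorem eventually_dvd_iff (y : ℤ_[2]) (n : ℕ) :
    ∀ᶠ y' in 𝓝 y, ((2 : ℤ_[2]) ^ n ∣ y' ↔ (2 : ℤ_[2]) ^ n ∣ y) := by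
  have : Metric.ball y ((2 : ℝ) ^ (-(n : ℤ))) ∈ 𝓝 y := Metric.ball_mem_nhds _ (by positivity)
  filter_upwards [this] with y' hy'
  rw [Metric.mem_ball, dist_eq_norm] at hy'
  have h1 := (PadicInt.norm_le_pow_iff_mem_span_pow (p := 2) (y' - y) n).mp
    (by push_cast; exact hy'.le)
  rw [Ideal.mem_span_singleton] at h1
  push_cast at h1
  exact (dvd_iff_dvd_of_dvd_sub h1)

/-- Only finitely many placements can affect a compact set, and for each of them the divisibility
condition is locally constant in the pair of indices. -/
theorem continuous_tilingAt (w : ℤ_[2]) : Continuous (tilingAt w) := by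
  rw [continuous_iff_continuousAt]
  rintro ⟨A, x⟩ U hU
  obtain ⟨K, hK, ε, hε, hsub⟩ := mem_nhds_tiling_iff.mp hU
  obtain ⟨R, hR⟩ := hK.isBounded.subset_closedBall (A • I)
  -- The margin covers the displacement of the base point (at most 1) and the bound 16 on the
  -- diameter of the tile; the maximum with 0 keeps I in the ball.
  set R1 := max (R + 25) 0 with hR1
  have hR1' : R + 25 ≤ R1 := le_max_left _ _
  have hQ := finite_place_near R1
  have e1 := eventually_dist_smul_lt A (isCompact_closedBall I R1) (lt_min hε one_pos)
  have e2 : ∀ᶠ x' in 𝓝 x, ∀ p ∈ {p : SL(2, ℤ) × ℕ | dist (place p.1 p.2 • I) I ≤ R1},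
      ((2 : ℤ_[2]) ^ (p.2 + 1) ∣ index w x' p.1 ↔ (2 : ℤ_[2]) ^ (p.2 + 1) ∣ index w x p.1) := by
    rw [eventually_all_finite hQ]
    intro p _
    exact (continuous_index w p.1).continuousAt.eventually (eventually_dvd_iff _ _)
  have e3 : ∀ᶠ p : SL(2, ℝ) × IndexPair in 𝓝 (A, x), _ := e1.prod_nhds e2
  rw [mem_map]
  filter_upwards [e3]
  rintro ⟨B, x'⟩ ⟨hB, hx'⟩
  apply hsub
  dsimp only at hB hx'
  have hBI : dist (A • I) (B • I) < 1 :=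
    (hB I (by rw [Metric.mem_closedBall, dist_self]; exact le_max_right _ _)).trans_le
      (min_le_right _ _)
  have key : ∀ C : SL(2, ℝ), dist (A • I) (C • I) < 1 → ∀ (δ : SL(2, ℤ)) (n : ℕ),
      (((toPSL C * place δ n) • tile) ∩ K).Nonempty →
      ∀ z ∈ tile, dist (place δ n • z) I ≤ R1 := by
    rintro C hC δ n ⟨_, ⟨z₀, hz₀, rfl⟩, hzK⟩ z hz
    have h1 := hR hzK
    have h2 : dist (C • place δ n • z₀) (A • I) ≤ R := by
      rw [Metric.mem_closedBall] at h1
      change dist ((toPSL C * place δ n) • z₀) (A • I) ≤ R at h1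
      rwa [mul_smul, toPSL_smul] at h1
    have h3 : dist (place δ n • z₀) I ≤ R + 1 := by
      rw [← dist_smul C]
      have := dist_triangle (C • place δ n • z₀) (A • I) (C • I)
      linarith
    have h4 : dist (place δ n • z) (place δ n • z₀) ≤ 16 := by
      rw [dist_smul]; exact dist_le_of_mem_tile hz hz₀
    have := dist_triangle (place δ n • z) (place δ n • z₀) I
    linarith
  constructor
  · intro g hg hgK
    obtain ⟨δ, n, hd, rfl⟩ := mem_tilingAt.mp hg
    have h1 := key B hBI δ n hgK
    refine ⟨toPSL A * place δ n, mem_tilingAt.mpr ⟨δ, n, ?_, rfl⟩, fun z hz => ?_⟩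
    · exact (hx' (δ, n) (h1 I I_mem_tile)).mp hd
    · rw [mul_smul, mul_smul, toPSL_smul, toPSL_smul, dist_comm]
      exact ((hB _ (h1 z hz)).trans_le (min_le_left _ _)).le
  · intro g hg hgK
    obtain ⟨δ, n, hd, rfl⟩ := mem_tilingAt.mp hg
    have h1 := key A (by simp) δ n hgK
    refine ⟨toPSL B * place δ n, mem_tilingAt.mpr ⟨δ, n, ?_, rfl⟩, fun z hz => ?_⟩
    · exact (hx' (δ, n) (h1 I I_mem_tile)).mpr hd
    · rw [mul_smul, mul_smul, toPSL_smul, toPSL_smul]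
      exact ((hB _ (h1 z hz)).trans_le (min_le_left _ _)).le

/-! ### Binary digits, and the identification of the fixed-sum class with the parametrized tilings.
-/

/-- The integer with the first `n` of the given binary digits. -/
def digitSum (a : ℕ → Fin 2) (n : ℕ) : ℕ := ∑ i ∈ Finset.range n, (a i : ℕ) * 2 ^ i

theorem digitSum_lt (a : ℕ → Fin 2) (n : ℕ) : digitSum a n < 2 ^ n := by
  induction n with
  | zero => simp [digitSum]
  | succ n ih =>
    rw [digitSum, Finset.sum_range_succ, pow_succ]
    have : (a n : ℕ) * 2 ^ n ≤ 1 * 2 ^ n := Nat.mul_le_mul_right _ (Nat.le_of_lt_succ (a n).isLt)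
    rw [digitSum] at ih
    omega

theorem summable_digits (a : ℕ → Fin 2) :
    Summable fun n => ((a n : ℕ) : ℤ_[2]) * 2 ^ n := by
  refine Summable.of_norm_bounded (g := fun n => (1 / 2 : ℝ) ^ n)
    (summable_geometric_of_lt_one (by norm_num) (by norm_num)) fun n => ?_
  rw [norm_mul, norm_pow]
  have h1 : ‖(2 : ℤ_[2])‖ = 1 / 2 := by
    simpa using PadicInt.norm_p (p := 2)
  rw [h1]
  exact mul_le_of_le_one_left (by positivity) (PadicInt.norm_le_one _)

theorem two_pow_dvd_dyadic_sub (a : ℕ → Fin 2) (n : ℕ) :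
    (2 : ℤ_[2]) ^ n ∣ dyadic a - digitSum a n := by
  have h := (summable_digits a).sum_add_tsum_nat_add n
  have h2 : ∑' i, ((a (i + n) : ℕ) : ℤ_[2]) * 2 ^ (i + n) =
      2 ^ n * ∑' i, ((a (i + n) : ℕ) : ℤ_[2]) * 2 ^ i := by
    rw [← (summable_digits fun i => a (i + n)).tsum_mul_left]
    exact tsum_congr fun i => by ring
  rw [dyadic, ← h, digitSum, h2]
  push_cast
  rw [add_sub_cancel_left]
  exact dvd_mul_right _ _

theorem exists_digits (x : ℤ_[2]) : ∃ a : ℕ → Fin 2, dyadic a = x := by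
  have h : ∀ y : ℤ_[2], ∃ (d : Fin 2) (y' : ℤ_[2]), y = (d : ℕ) + 2 * y' := by
    intro y
    have h1 := PadicInt.appr_spec 1 y
    rw [Ideal.mem_span_singleton] at h1
    obtain ⟨y', hy'⟩ := h1
    refine ⟨⟨y.appr 1, by simpa using PadicInt.appr_lt y 1⟩, y', ?_⟩
    push_cast at hy' ⊢
    linear_combination hy'
  choose d t hdt using h
  refine ⟨fun n => d (t^[n] x), eq_of_forall_two_pow_dvd fun n => ?_⟩
  have h2 : ∀ n : ℕ, x = digitSum (fun n => d (t^[n] x)) n + 2 ^ n * t^[n] x := by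
    intro n
    induction n with
    | zero => simp [digitSum]
    | succ n ih =>
      rw [digitSum, Finset.sum_range_succ, Function.iterate_succ_apply']
      rw [digitSum] at ih
      have h3 := hdt (t^[n] x)
      push_cast at ih ⊢
      rw [pow_succ]
      linear_combination ih + 2 ^ n * h3
  have h4 := two_pow_dvd_dyadic_sub (fun n => d (t^[n] x)) n
  have h5 : (2 : ℤ_[2]) ^ n ∣ digitSum (fun n => d (t^[n] x)) n - x := by
    refine ⟨-t^[n] x, ?_⟩
    linear_combination -h2 n
  simpa using dvd_add h4 h5

theorem digitSum_succ (a : ℕ → Fin 2) (n : ℕ) :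
    digitSum a (n + 1) = digitSum a n + (a n : ℕ) * 2 ^ n := Finset.sum_range_succ _ _

theorem place_digitSum_succ (γ : SL(2, ℤ)) (a : ℕ → Fin 2) (n : ℕ) :
    place (γ * ModularGroup.T ^ (-(digitSum a (n + 1) : ℤ))) n =
      place (γ * ModularGroup.T ^ (-(digitSum a (n + 2) : ℤ))) (n + 1) *
        shift ^ (a (n + 1) : ℕ) * half := by
  rw [← zpow_natCast shift, place_mul_shift_zpow, place_succ_mul_half, mul_assoc, ← zpow_add]
  congr 3
  rw [digitSum_succ a (n + 1)]
  push_cast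
  ring

/-- The recursion for the ancestors can be solved: the ancestor of level n starts to the left of the
triangle by the integer formed from the first n + 1 digits. -/
theorem hasIndex_iff {T : Tiling} {h : PSL2R} {γ : SL(2, ℤ)} {a : ℕ → Fin 2} :
    HasIndex T (h * toPSL (incl γ)) a ↔
      ∀ n, h * place (γ * ModularGroup.T ^ (-(digitSum a (n + 1) : ℤ))) n ∈ T.motions := by
  have h0 : h * toPSL (incl γ) =
      h * place (γ * ModularGroup.T ^ (-(digitSum a 1 : ℤ))) 0 * shift ^ (a 0 : ℕ) := by
    rw [← zpow_natCast shift, mul_assoc, place_mul_shift_zpow, mul_assoc, ← zpow_add]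
    simp [digitSum, place]
  constructor
  · rintro ⟨g, hg, hg0, hgn⟩
    have : ∀ n, g n = h * place (γ * ModularGroup.T ^ (-(digitSum a (n + 1) : ℤ))) n := by
      intro n
      induction n with
      | zero =>
        rw [h0] at hg0
        exact (mul_right_cancel hg0).symm
      | succ n ih =>
        have h1 := hgn n
        rw [ih, place_digitSum_succ, ← mul_assoc, ← mul_assoc] at h1
        exact (mul_right_cancel (mul_right_cancel h1)).symm
    intro n
    rw [← this]
    exact hg n
  · intro H
    refine ⟨_, H, h0, fun n => ?_⟩
    rw [place_digitSum_succ, ← mul_assoc, ← mul_assoc]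

theorem T_zpow_injective {i j : ℤ} {γ : SL(2, ℤ)} (h : γ * ModularGroup.T ^ i = γ * ModularGroup.T ^ j ∨
    γ * ModularGroup.T ^ i = -(γ * ModularGroup.T ^ j)) : i = j := by
  rw [← mul_neg, mul_right_inj, mul_right_inj] at h
  rcases h with h | h
  · have := congrArg (fun A : SL(2, ℤ) => A 0 1) h
    simpa [ModularGroup.coe_T_zpow] using this
  · have := congrArg (fun A : SL(2, ℤ) => A 0 0) h
    simp [ModularGroup.coe_T_zpow] at this

/-- Copies of the same size in the same horoball are not too close to each other. -/
theorem eq_of_place_mem {T : Tiling} {h : PSL2R} {γ : SL(2, ℤ)} {n : ℕ} {i j : ℤ}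
    (hi : h * place (γ * ModularGroup.T ^ i) n ∈ T.motions)
    (hj : h * place (γ * ModularGroup.T ^ j) n ∈ T.motions) (hij : |i - j| < 2 ^ (n + 1)) :
    i = j := by
  by_contra hne
  have hp : (0 : ℝ) < 2 ^ n := by positivity
  -- In units of the level the two copies are shifted by t with |t| < 2, less than their width, so 1
  -- + t/2 in one and 1 - t/2 in the other give a common interior point.
  set t : ℝ := (j - i) / 2 ^ n with ht
  have ht2 : |t| < 2 := by
    have : |(i : ℝ) - j| < 2 ^ (n + 1) := by exact_mod_cast hij
    rw [ht, abs_div, abs_of_pos hp, div_lt_iff₀ hp, abs_sub_comm]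
    rw [pow_succ] at this; linarith
  obtain ⟨ht3, ht4⟩ := abs_lt.mp ht2
  have hm : ∀ x : ℝ, 0 < x → x < 2 → mk ⟨x, 9 / 8⟩ (by norm_num) ∈ interior tile :=
    fun x h1 h2 => mem_interior_tile h1 h2 (by change (1 : ℝ) < 9 / 8; norm_num)
      (by change (9 / 8 : ℝ) < 5 / 4; norm_num)
  have h1 := hm (1 + t / 2) (by linarith) (by linarith)
  have h2 := hm (1 - t / 2) (by linarith) (by linarith)
  have hne' : h * place (γ * ModularGroup.T ^ i) n ≠ h * place (γ * ModularGroup.T ^ j) n := by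
    intro he
    exact hne (T_zpow_injective (place_eq_iff.mp (mul_left_cancel he)).2)
  have hdis : Disjoint (interior ((h * place (γ * ModularGroup.T ^ i) n) • tile))
    (interior ((h * place (γ * ModularGroup.T ^ j) n) • tile)) := T.disjoint_interior hi hj hne'
  rw [Set.disjoint_left, interior_smul, interior_smul] at hdis
  refine hdis (smul_mem_smul_set h1) ?_
  have : (h * place (γ * ModularGroup.T ^ i) n) • (mk ⟨1 + t / 2, 9 / 8⟩ (by norm_num) : ℍ) =
      (h * place (γ * ModularGroup.T ^ j) n) • (mk ⟨1 - t / 2, 9 / 8⟩ (by norm_num) : ℍ) := by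
    rw [mul_smul, mul_smul, place_smul, place_smul, map_mul, map_mul, mul_smul, mul_smul]
    congr 2
    ext1
    rw [coe_T_smul, coe_T_smul, coe_dil_smul, coe_dil_smul]
    have h3 : (2 : ℝ) ^ n * t = j - i := by rw [ht]; field_simp
    have h4 : (2 : ℂ) ^ n * t = j - i := by exact_mod_cast congrArg (Complex.ofReal) h3
    have h5 : ∀ x : ℝ, (⟨x, 9 / 8⟩ : ℂ) = x + 9 / 8 * Complex.I := by
      intro x; apply Complex.ext <;> simp
    change (2 : ℂ) ^ n * (⟨1 + t / 2, 9 / 8⟩ : ℂ) + i = 2 ^ n * (⟨1 - t / 2, 9 / 8⟩ : ℂ) + j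
    rw [h5, h5]
    push_cast
    linear_combination h4
  rw [this]
  exact smul_mem_smul_set h2

/-- At each level both chains of ancestors give copies of the same size in the same horoball, so
their positions agree or are at least one width apart. The case e = 0 shows that an index is unique,
the case e = 1 is the step rule. -/
theorem dyadic_eq_of_hasIndex {T : Tiling} {h : PSL2R} {γ : SL(2, ℤ)} {a b : ℕ → Fin 2} {e : ℤ}
    (he0 : 0 ≤ e) (he1 : e ≤ 1) (ha : HasIndex T (h * toPSL (incl γ)) a)
    (hb : HasIndex T (h * toPSL (incl (γ * ModularGroup.T ^ e))) b) : dyadic b = dyadic a + e := by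
  refine eq_of_forall_two_pow_dvd fun n => (pow_dvd_pow _ (Nat.le_succ n)).trans ?_
  have h1 := hasIndex_iff.mp ha n
  have h2 := hasIndex_iff.mp hb n
  rw [mul_assoc, ← zpow_add] at h2
  have h3 := digitSum_lt a (n + 1)
  have h4 := digitSum_lt b (n + 1)
  have key : (2 : ℤ) ^ (n + 1) ∣ (digitSum b (n + 1) : ℤ) - digitSum a (n + 1) - e := by
    have h3' : (digitSum a (n + 1) : ℤ) < 2 ^ (n + 1) := by exact_mod_cast h3
    have h4' : (digitSum b (n + 1) : ℤ) < 2 ^ (n + 1) := by exact_mod_cast h4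
    rcases lt_or_ge |(-(digitSum a (n + 1) : ℤ)) - (e + -(digitSum b (n + 1) : ℤ))|
      (2 ^ (n + 1)) with hlt | hge
    · have := eq_of_place_mem h1 h2 hlt
      rw [show (digitSum b (n + 1) : ℤ) - digitSum a (n + 1) - e = 0 by linarith]
      exact dvd_zero _
    · have : (digitSum b (n + 1) : ℤ) - digitSum a (n + 1) - e = -2 ^ (n + 1) := by
        rcases le_abs.mp hge with hge | hge <;> omega
      rw [this]
      exact (dvd_refl _).neg_right
  have h5 := two_pow_dvd_dyadic_sub a (n + 1)
  have h6 := two_pow_dvd_dyadic_sub b (n + 1)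
  rw [← two_pow_dvd_int] at key
  push_cast at key
  have := dvd_add (dvd_sub h6 h5) key
  convert this using 1
  ring

/-- By Baire, the interiors of countably many closed copies covering the plane have dense union, so
an extra copy in T would overlap one of them. -/
theorem Tiling.eq_of_motions_subset {S T : Tiling} (hS : S.motions.Countable)
    (h : S.motions ⊆ T.motions) : S = T := by
  refine Tiling.ext (h.antisymm fun g hg => ?_)
  by_contra hgS
  have hd : Dense (⋃ k ∈ S.motions, interior (k • tile)) :=
    dense_biUnion_interior_of_closed (fun k _ => isClosed_tile.smul k) hS S.covers
  obtain ⟨z, hz, hzk⟩ := hd.inter_open_nonempty (interior (g • tile)) isOpen_interior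
    ⟨g • basePoint, by
      rw [interior_smul]; exact smul_mem_smul_set basePoint_mem_interior⟩
  obtain ⟨k, hk, hzk⟩ := mem_iUnion₂.mp hzk
  have hdis : Disjoint (interior (g • tile)) (interior (k • tile)) :=
    T.disjoint_interior hg (h hk) fun e => hgS (e ▸ hk)
  exact Set.disjoint_left.mp hdis hz hzk

instance : Countable SL(2, ℤ) := by
  have : Countable (Matrix (Fin 2) (Fin 2) ℤ) := inferInstanceAs (Countable (Fin 2 → Fin 2 → ℤ))
  exact Subtype.countable

theorem countable_motions_tilingAt (w : ℤ_[2]) (p : SL(2, ℝ) × IndexPair) :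
    (tilingAt w p).motions.Countable := by
  refine (countable_range fun q : SL(2, ℤ) × ℕ => toPSL p.1 * place q.1 q.2).mono fun g hg => ?_
  obtain ⟨δ, n, -, rfl⟩ := mem_tilingAt.mp hg
  exact ⟨(δ, n), rfl⟩

theorem rot_eq : rot = toPSL (incl rotInt) := by rw [rot, incl_rotInt]

/-- The indices of T form an indexing with sum `w`, hence come from a pair. The resulting tiling has
its motions among those of T, since divisibility makes the leading digits vanish, and so equals T.
-/
theorem fixedSum_subset_range (w : ℤ_[2]) : fixedSum w ⊆ range (tilingAt w) := by
  rintro T ⟨h, -, H⟩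
  have H' : ∀ γ : SL(2, ℤ), ∃ a b c : ℕ → Fin 2, HasIndex T (h * toPSL (incl γ)) a ∧
      HasIndex T (h * toPSL (incl (γ * rotInt))) b ∧
      HasIndex T (h * toPSL (incl (γ * rotInt ^ 2))) c ∧ dyadic a + dyadic b + dyadic c = w := by
    intro γ
    obtain ⟨a, b, c, ha, hb, hc, hs⟩ := H _ (mem_modular_iff.mpr ⟨γ, rfl⟩)
    rw [rot_eq, mul_assoc, ← map_mul, ← map_mul] at hb
    rw [rot_eq, mul_assoc, ← map_pow, ← map_pow, ← map_mul, ← map_mul] at hc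
    exact ⟨a, b, c, ha, hb, hc, hs⟩
  choose a b c ha hb hc hs using H'
  have huniq : ∀ {γ : SL(2, ℤ)} {d e : ℕ → Fin 2}, HasIndex T (h * toPSL (incl γ)) d →
      HasIndex T (h * toPSL (incl γ)) e → dyadic e = dyadic d := by
    intro γ d e hd he
    have := dyadic_eq_of_hasIndex le_rfl zero_le_one hd (b := e) (by simpa using he)
    simpa using this
  have hφ : IsIndexing fun γ => dyadic (a γ) := by
    constructor
    · intro δ
      have := dyadic_eq_of_hasIndex zero_le_one le_rfl (ha δ) (b := a (δ * ModularGroup.T))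
        (by rw [zpow_one]; exact ha _)
      simpa using this
    · intro δ
      refine huniq (ha δ) ?_
      have := ha (-δ)
      rwa [incl_neg, toPSL_neg] at this
  have hsum : ∀ γ, dyadic (a γ) + dyadic (a (γ * rotInt)) + dyadic (a (γ * rotInt ^ 2)) = w := by
    intro γ
    rw [huniq (hb γ) (ha _), huniq (hc γ) (ha _)]
    exact hs γ
  obtain ⟨A, rfl⟩ := toPSL_surjective h
  refine ⟨(A, (dyadic (a 1), dyadic (a rotInt))), ?_⟩
  refine Tiling.eq_of_motions_subset (countable_motions_tilingAt w _) fun g hg => ?_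
  obtain ⟨δ, n, hd, rfl⟩ := mem_tilingAt.mp hg
  have hindex := congrFun (eq_index hφ hsum) δ
  rw [← hindex] at hd
  have h1 := hasIndex_iff.mp (ha δ) n
  have h2 : (2 : ℤ_[2]) ^ (n + 1) ∣ ((digitSum (a δ) (n + 1) : ℤ) : ℤ_[2]) := by
    have := dvd_sub hd (two_pow_dvd_dyadic_sub (a δ) (n + 1))
    simpa using this
  rw [two_pow_dvd_int] at h2
  have h3 : digitSum (a δ) (n + 1) = 0 :=
    Nat.eq_zero_of_dvd_of_lt (by exact_mod_cast h2) (digitSum_lt _ _)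
  rw [h3] at h1
  simpa using h1

/-- In each horoball the cores of level n fill the strip of heights between 2 ^ n and 2 ^ (n + 1).
-/
theorem iUnion_core_tilingAt (w : ℤ_[2]) (A : SL(2, ℝ)) (x : IndexPair) :
    (⋃ g ∈ (tilingAt w (A, x)).motions, g • core) = toPSL A • horoballs := by
  ext z
  rw [mem_smul_set_iff_inv_smul_mem, horoballs, mem_iUnion₂, mem_iUnion₂]
  constructor
  · rintro ⟨g, hg, hz⟩
    obtain ⟨δ, n, -, rfl⟩ := mem_tilingAt.mp hg
    obtain ⟨v, hv, rfl⟩ := hz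
    refine ⟨toPSL (incl δ), mem_modular_iff.mpr ⟨δ, rfl⟩, dil n • v, ?_, ?_⟩
    · change 1 ≤ (dil n • v).im
      rw [im_dil_smul]
      exact one_le_mul_of_one_le_of_one_le (one_le_pow₀ one_le_two) hv.2.2.1
    · change toPSL (incl δ) • dil n • v = (toPSL A)⁻¹ • (toPSL A * place δ n) • v
      rw [mul_smul, inv_smul_smul, place_smul, toPSL_smul]
  · rintro ⟨f, hf, u, hu, hz⟩
    obtain ⟨γ, rfl⟩ := mem_modular_iff.mp hf
    replace hu : 1 ≤ u.im := hu
    replace hz : toPSL (incl γ) • u = (toPSL A)⁻¹ • z := hz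
    obtain ⟨n, hn1, hn2⟩ := exists_nat_pow_near hu one_lt_two
    obtain ⟨m, hm⟩ := exists_dvd_index w x γ (n + 1)
    have hp : (0 : ℝ) < 2 ^ n := by positivity
    set l := ⌊(u.re - m) / (2 ^ (n + 1))⌋ with hl
    have hl1 := Int.floor_le ((u.re - m) / (2 ^ (n + 1)))
    have hl2 := Int.lt_floor_add_one ((u.re - m) / (2 ^ (n + 1)))
    rw [← hl, le_div_iff₀ (by positivity)] at hl1
    rw [← hl, div_lt_iff₀ (by positivity)] at hl2
    set j : ℤ := m + 2 ^ (n + 1) * l with hj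
    have hj' : (j : ℝ) = m + 2 ^ (n + 1) * l := by rw [hj]; push_cast; ring
    set v := (dil n)⁻¹ • incl (ModularGroup.T ^ (-j)) • u with hv
    have hvu : dil n • v = incl (ModularGroup.T ^ (-j)) • u := by rw [hv, smul_inv_smul]
    have hre : 2 ^ n * v.re = u.re - j := by
      rw [← re_dil_smul, hvu, incl_smul, ModularGroup.re_T_zpow_smul]; push_cast; ring
    have him : 2 ^ n * v.im = u.im := by
      rw [← im_dil_smul, hvu, incl_smul, ModularGroup.im_T_zpow_smul]
    refine ⟨toPSL A * place (γ * ModularGroup.T ^ j) n, mem_tilingAt.mpr ⟨_, n, ?_, rfl⟩, v, ?_, ?_⟩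
    · rw [(isIndexing_index w x).mul_T_zpow] at hm ⊢
      rw [hj]; push_cast
      rw [← add_assoc]
      exact dvd_add hm (dvd_mul_right _ _)
    · rw [pow_succ] at hl1 hl2 hj' hn2
      refine ⟨?_, ?_, ?_, ?_⟩
      · refine le_of_mul_le_mul_left ?_ hp
        linarith
      · refine le_of_mul_le_mul_left ?_ hp
        linarith
      · refine le_of_mul_le_mul_left ?_ hp
        linarith
      · refine le_of_mul_le_mul_left ?_ hp
        linarith
    · change (toPSL A * place (γ * ModularGroup.T ^ j) n) • v = z
      have hz' : z = toPSL A • toPSL (incl γ) • u := by rw [hz, smul_inv_smul]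
      rw [hz', mul_smul, place_smul, hvu, ← mul_smul, ← map_mul,
        toPSL_smul (incl γ)]
      simp

theorem range_tilingAt_subset (w : ℤ_[2]) : range (tilingAt w) ⊆ fixedSum w := by
  rintro _ ⟨⟨A, x⟩, rfl⟩
  refine ⟨toPSL A, iUnion_core_tilingAt w A x, fun f hf => ?_⟩
  obtain ⟨γ, rfl⟩ := mem_modular_iff.mp hf
  have key : ∀ δ : SL(2, ℤ), ∃ a, HasIndex (tilingAt w (A, x)) (toPSL A * toPSL (incl δ)) a ∧
      dyadic a = index w x δ := by
    intro δ
    obtain ⟨a, ha⟩ := exists_digits (index w x δ)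
    refine ⟨a, hasIndex_iff.mpr fun n => mem_tilingAt.mpr ⟨_, n, ?_, rfl⟩, ha⟩
    rw [(isIndexing_index w x).mul_T_zpow, ← ha]
    have := two_pow_dvd_dyadic_sub a (n + 1)
    push_cast
    rwa [← sub_eq_add_neg]
  obtain ⟨a, ha, ha'⟩ := key γ
  obtain ⟨b, hb, hb'⟩ := key (γ * rotInt)
  obtain ⟨c, hc, hc'⟩ := key (γ * rotInt ^ 2)
  refine ⟨a, b, c, ha, ?_, ?_, ?_⟩
  · rwa [map_mul incl, map_mul toPSL, ← mul_assoc, ← rot_eq] at hb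
  · rwa [map_mul incl, map_mul toPSL, ← mul_assoc, map_pow, map_pow, ← rot_eq] at hc
  · rw [ha', hb', hc', index_sum]

theorem fixedSum_eq_range (w : ℤ_[2]) : fixedSum w = range (tilingAt w) :=
  (fixedSum_subset_range w).antisymm (range_tilingAt_subset w)

/-! ### Degenerate limits and their vanishing measure. -/

theorem im_smul_le_one {ε : SL(2, ℤ)} (hε : ε 1 0 ≠ 0) {u : ℍ} (hu : 1 ≤ u.im) :
    (ε • u).im ≤ 1 := by
  rw [ModularGroup.im_smul_eq_div_normSq, ModularGroup.denom_apply, Complex.normSq_apply,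
    div_le_one_iff]
  left
  have hc : (1 : ℝ) ≤ (ε 1 0 : ℝ) ^ 2 := by
    have : 0 < ε 1 0 ^ 2 := by positivity
    exact_mod_cast this
  simp only [Complex.add_re, Complex.mul_re, Complex.intCast_re, Complex.intCast_im, zero_mul,
    sub_zero, Complex.add_im, Complex.mul_im, add_zero, coe_re, coe_im]
  have h : u.im ≤ (ε 1 0 * u.re + ε 1 1 : ℝ) * (ε 1 0 * u.re + ε 1 1) +
      ε 1 0 * u.im * (ε 1 0 * u.im) := by
    have h1 : u.im * u.im ≤ (ε 1 0 : ℝ) ^ 2 * (u.im * u.im) :=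
      le_mul_of_one_le_left (mul_self_nonneg _) hc
    nlinarith [mul_self_nonneg (ε 1 0 * u.re + ε 1 1 : ℝ)]
  exact ⟨by linarith, h⟩

theorem lowerLeft_conj (ε : SL(2, ℤ)) (m n : ℕ) :
    ((dil m)⁻¹ * incl ε * dil n : SL(2, ℝ)) 1 0 = √2 ^ m * √2 ^ n * ε 1 0 := by
  have h : ((dil m)⁻¹ : SL(2, ℝ)) = (!![(√2 ^ m)⁻¹, 0; 0, √2 ^ m] : Matrix (Fin 2) (Fin 2) ℝ) := by
    rw [Matrix.SpecialLinearGroup.coe_inv, coe_dil, Matrix.adjugate_fin_two]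
    simp
  rw [Matrix.SpecialLinearGroup.coe_mul, Matrix.SpecialLinearGroup.coe_mul, h, coe_dil]
  simp [Matrix.mul_apply, Fin.sum_univ_two, Matrix.vecMul, dotProduct]
  ring

theorem lowerLeft_ne_zero_of_toPSL {A B A' B' : SL(2, ℝ)} (hA : toPSL A = toPSL A')
    (hB : toPSL B = toPSL B') (h : (A⁻¹ * B) 1 0 ≠ 0) : (A'⁻¹ * B') 1 0 ≠ 0 := by
  rcases toPSL_eq_iff.mp hA with rfl | rfl <;> rcases toPSL_eq_iff.mp hB with rfl | rfl <;>
    simpa [inv_neg] using h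

theorem lowerLeft_ne_zero_of_place {A B h : SL(2, ℝ)} {δ δ' : SL(2, ℤ)} {n n' : ℕ}
    (hA : toPSL A = toPSL h * place δ n) (hB : toPSL B = toPSL h * place δ' n')
    (hne : (A⁻¹ * B) 1 0 ≠ 0) : (δ⁻¹ * δ') 1 0 ≠ 0 := by
  rw [place, ← map_mul] at hA hB
  have h1 := lowerLeft_ne_zero_of_toPSL hA hB hne
  have h2 : (h * (incl δ * dil n))⁻¹ * (h * (incl δ' * dil n')) =
      (dil n)⁻¹ * incl (δ⁻¹ * δ') * dil n' := by
    rw [map_mul, map_inv]; group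
  rw [h2, lowerLeft_conj] at h1
  intro h0
  rw [h0] at h1
  simp at h1

/-- Seen from the horoball of the first copy, that copy has height 2 ^ n while the second, in
another horoball, has height at most 1. So two nearby copies in different horoballs have bounded
level. The 2 in the exponent is an error of 1 at each end. -/
theorem two_pow_le_of_lowerLeft_ne_zero {g : PSL2R} {δ δ' : SL(2, ℤ)} {n n' : ℕ} {p q : ℍ}
    (hp : dist p ((g * place δ n) • I) ≤ 1) (hq : dist q ((g * place δ' n') • I) ≤ 1)
    (hc : (δ⁻¹ * δ') 1 0 ≠ 0) : (2 : ℝ) ^ n ≤ Real.exp (dist p q + 2) := by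
  have hdist : dist (dil n • I) ((δ⁻¹ * δ') • dil n' • I) ≤ dist p q + 2 := by
    have h1 : dist ((g * place δ n) • I) ((g * place δ' n') • I) =
        dist (dil n • I) ((δ⁻¹ * δ') • dil n' • I) := by
      rw [mul_smul, mul_smul, dist_smul, place_smul, place_smul, ← dist_smul (incl δ⁻¹),
        map_inv, inv_smul_smul, ← map_inv, mul_smul, incl_smul, incl_smul]
    rw [← h1]
    have h2 := dist_triangle4_left p q ((g * place δ n) • I) ((g * place δ' n') • I)
    linarith
  have him := im_le_im_mul_exp_dist (dil n • I) ((δ⁻¹ * δ') • dil n' • I)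
  have h1 : ((δ⁻¹ * δ') • dil n' • I).im ≤ 1 := im_smul_le_one hc (by
    rw [im_dil_smul, I_im, mul_one]
    exact one_le_pow₀ one_le_two)
  rw [im_dil_smul, I_im, mul_one] at him
  have h3 := Real.exp_le_exp.mpr hdist
  have h4 := mul_le_of_le_one_left (Real.exp_pos (dist (dil n • I) ((δ⁻¹ * δ') • dil n' • I))).le h1
  linarith

/-- The nondegenerate tilings with a copy of low level near `p`. -/
def lowAt (w : ℤ_[2]) (p : ℍ) (L : ℕ) : Set Tiling :=
  tilingAt w '' ((⋃ n ∈ Finset.range L, (fun B : SL(2, ℝ) => B * dil n) ⁻¹'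
    {B : SL(2, ℝ) | dist (B • I) p ≤ 1}) ×ˢ univ)

/-- This is the image of a compact set because ℤ₂² is compact. Tilings converging to a degenerate
one therefore eventually have only copies of high level near p. -/
theorem isClosed_lowAt (w : ℤ_[2]) (p : ℍ) (L : ℕ) : IsClosed (lowAt w p L) := by
  have h : IsCompact (⋃ n ∈ Finset.range L, (fun B : SL(2, ℝ) => B * dil n) ⁻¹'
      {B : SL(2, ℝ) | dist (B • I) p ≤ 1}) :=
    (Finset.range L).isCompact_biUnion fun n _ =>
      (Homeomorph.mulRight (dil n)).isCompact_preimage.mpr (isCompact_dist_smul_le _ _)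
  exact ((h.prod isCompact_univ).image (continuous_tilingAt w)).isClosed

theorem tilingAt_mem_lowAt {w : ℤ_[2]} {p : ℍ} {L n : ℕ} {h : SL(2, ℝ)} (x : IndexPair)
    {δ : SL(2, ℤ)} (hn : n < L) (hp : dist p ((toPSL h * place δ n) • I) ≤ 1) :
    tilingAt w (h, x) ∈ lowAt w p L := by
  refine ⟨(h * incl δ, indexAction w δ⁻¹ x), ⟨?_, trivial⟩, ?_⟩
  · refine mem_iUnion₂.mpr ⟨n, Finset.mem_range.mpr hn, ?_⟩
    change dist ((h * incl δ * dil n) • I) p ≤ 1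
    rw [dist_comm]
    rwa [place, ← map_mul, ← mul_assoc, toPSL_smul] at hp
  · have := tilingAt_mul_incl w h x δ⁻¹
    rwa [inv_inv] at this

theorem exists_nhds_lowerLeft_ne_zero {A B : SL(2, ℝ)} (hne : (A⁻¹ * B) 1 0 ≠ 0) :
    ∃ U ∈ 𝓝 A, ∃ V ∈ 𝓝 B, ∀ A' ∈ U, ∀ B' ∈ V, (A'⁻¹ * B') 1 0 ≠ 0 := by
  have hcont : Continuous fun p : SL(2, ℝ) × SL(2, ℝ) => (p.1⁻¹ * p.2) 1 0 := by fun_prop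
  have hU : ∀ᶠ p in 𝓝 (A, B), (p.1⁻¹ * p.2) 1 0 ≠ 0 := hcont.continuousAt.eventually_ne hne
  rw [nhds_prod_eq, eventually_prod_iff] at hU
  obtain ⟨p, hp, q, hq, h⟩ := hU
  exact ⟨{A' | p A'}, hp, {B' | q B'}, hq, fun A' hA' B' hB' => h hA' hB'⟩

/-- In a limit of nondegenerate tilings that is degenerate, all copies point to the same boundary
point. -/
theorem lowerLeft_eq_zero_of_mem_closure {w : ℤ_[2]} {T : Tiling}
    (hT : T ∈ closure (range (tilingAt w))) (hT' : T ∉ range (tilingAt w)) {A B : SL(2, ℝ)}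
    (hA : toPSL A ∈ T.motions) (hB : toPSL B ∈ T.motions) : (A⁻¹ * B) 1 0 = 0 := by
  by_contra hne
  obtain ⟨U, hU, V, hV, hUV⟩ := exists_nhds_lowerLeft_ne_zero hne
  obtain ⟨e₁, he₁, hA'⟩ := exists_lift_of_close A hU
  obtain ⟨e₂, he₂, hB'⟩ := exists_lift_of_close B hV
  obtain ⟨L, hL⟩ := pow_unbounded_of_one_lt (Real.exp (dist (A • I) (B • I) + 2)) one_lt_two
  -- A nearby nondegenerate tiling can be chosen off this closed set, so its copy near A has level
  -- at least L. Its copies near A and B lie in different horoballs, which contradicts the choice of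
  -- L.
  have hTF : T ∉ lowAt w (A • I) L := fun h => hT' (image_subset_range _ _ h)
  have he0 : 0 < min (min e₁ e₂) 1 := lt_min (lt_min he₁ he₂) one_pos
  have hK : IsCompact ({toPSL A • basePoint, toPSL B • basePoint} : Set ℍ) :=
    ((Set.finite_singleton _).insert _).isCompact
  obtain ⟨_, ⟨hS1, hS2⟩, ⟨h, x⟩, rfl⟩ := mem_closure_iff_nhds.mp hT _
    (inter_mem (vicinity_mem_nhds T hK he0) ((isClosed_lowAt w (A • I) L).isOpen_compl.mem_nhds hTF))
  obtain ⟨gA, hgA, hcA⟩ := exists_close_of_mem_vicinity hS1 hA (Or.inl rfl)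
  obtain ⟨gB, hgB, hcB⟩ := exists_close_of_mem_vicinity hS1 hB (Or.inr rfl)
  obtain ⟨A', hA'U, hA'⟩ := hA' gA fun z hz => (hcA z hz).trans
    ((min_le_left _ _).trans (min_le_left _ _))
  obtain ⟨B', hB'V, hB'⟩ := hB' gB fun z hz => (hcB z hz).trans
    ((min_le_left _ _).trans (min_le_right _ _))
  have hne' : (A'⁻¹ * B') 1 0 ≠ 0 := hUV A' hA'U B' hB'V
  obtain ⟨δ, n, -, hδ⟩ := mem_tilingAt.mp hgA
  obtain ⟨δ', n', -, hδ'⟩ := mem_tilingAt.mp hgB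
  have hAI := (hcA I I_mem_tile).trans (min_le_right _ _)
  have hBI := (hcB I I_mem_tile).trans (min_le_right _ _)
  rw [toPSL_smul, hδ] at hAI
  rw [toPSL_smul, hδ'] at hBI
  have hnL : L ≤ n := not_lt.mp fun hlt => hS2 (tilingAt_mem_lowAt x hlt hAI)
  have h1 := two_pow_le_of_lowerLeft_ne_zero hAI hBI
    (lowerLeft_ne_zero_of_place (hA'.trans hδ) (hB'.trans hδ') hne')
  have h2 : (2 : ℝ) ^ L ≤ 2 ^ n := pow_le_pow_right₀ one_le_two hnL
  linarith

theorem measurableSet_range_tilingAt (w : ℤ_[2]) : MeasurableSet (range (tilingAt w)) := by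
  have h : IsSigmaCompact (range (tilingAt w)) := by
    rw [← image_univ]
    exact isSigmaCompact_univ.image (continuous_tilingAt w)
  obtain ⟨K, hK, hKe⟩ := h
  rw [← hKe]
  exact MeasurableSet.iUnion fun n => (hK n).isClosed.measurableSet

/-- The tilings with a copy that points to a real boundary point larger than `t`. -/
def pointingAbove (t : ℝ) : Set Tiling :=
  {T | ∃ A : SL(2, ℝ), toPSL A ∈ T.motions ∧ A 1 0 ≠ 0 ∧ t < A 0 0 / A 1 0}

theorem isOpen_pointingAbove (t : ℝ) : IsOpen (pointingAbove t) := by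
  rw [isOpen_tiling_iff]
  rintro T ⟨A, hA, hA0, hAt⟩
  have hU : {B : SL(2, ℝ) | B 1 0 ≠ 0 ∧ t < B 0 0 / B 1 0} ∈ 𝓝 A := by
    have h1 : Continuous fun B : SL(2, ℝ) => B 1 0 := by fun_prop
    have h2 : Continuous fun B : SL(2, ℝ) => B 0 0 := by fun_prop
    exact (h1.continuousAt.eventually_ne hA0).and
      (continuousAt_const.eventually_lt (h2.continuousAt.div h1.continuousAt hA0) hAt)
  obtain ⟨ε, hε, hl⟩ := exists_lift_of_close A hU
  refine ⟨{toPSL A • basePoint}, isCompact_singleton, ε, hε, fun S hS => ?_⟩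
  obtain ⟨k, hk, hAk⟩ := exists_close_of_mem_vicinity hS hA rfl
  obtain ⟨B, hB, rfl⟩ := hl k hAk
  exact ⟨B, hk, hB.1, hB.2⟩

theorem toPSL_mem_smul_iff {A B : SL(2, ℝ)} {T : Tiling} :
    toPSL A ∈ (toPSL B • T).motions ↔ toPSL (B⁻¹ * A) ∈ T.motions := by
  change toPSL A ∈ toPSL B • T.motions ↔ _
  rw [mem_smul_set_iff_inv_smul_mem, smul_eq_mul, ← map_inv, ← map_mul]

theorem shift_smul_mem_pointingAbove_iff {t : ℝ} {T : Tiling} :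
    shift • T ∈ pointingAbove (t + 1) ↔ T ∈ pointingAbove t := by
  have key : ∀ A : SL(2, ℝ), (shiftMatrix * A) 0 0 = A 0 0 + A 1 0 ∧
      (shiftMatrix * A) 1 0 = A 1 0 := by
    intro A
    simp [coe_shift, Matrix.mul_apply]
  constructor
  · rintro ⟨A, hA, hA0, hAt⟩
    rw [shift, toPSL_mem_smul_iff] at hA
    obtain ⟨h1, h2⟩ := key (shiftMatrix⁻¹ * A)
    rw [mul_inv_cancel_left] at h1 h2
    refine ⟨_, hA, h2 ▸ hA0, ?_⟩
    rw [h1, h2, add_div, div_self (h2 ▸ hA0)] at hAt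
    linarith
  · rintro ⟨A, hA, hA0, hAt⟩
    obtain ⟨h1, h2⟩ := key A
    refine ⟨shiftMatrix * A, ?_, h2 ▸ hA0, ?_⟩
    · rw [shift, toPSL_mem_smul_iff, inv_mul_cancel_left]; exact hA
    · rw [h1, h2, add_div, div_self hA0]
      linarith

theorem smul_mem_range_iff {w : ℤ_[2]} {g : PSL2R} {T : Tiling} :
    g • T ∈ range (tilingAt w) ↔ T ∈ range (tilingAt w) := by
  have key : ∀ (g : PSL2R) (T : Tiling), T ∈ range (tilingAt w) → g • T ∈ range (tilingAt w) := by
    rintro g _ ⟨p, rfl⟩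
    obtain ⟨B, rfl⟩ := toPSL_surjective g
    exact ⟨_, (toPSL_smul_tilingAt w B p).symm⟩
  refine ⟨fun h => ?_, key g T⟩
  simpa using key g⁻¹ _ h

theorem smul_mem_closure_iff {w : ℤ_[2]} {g : PSL2R} {T : Tiling} :
    g • T ∈ closure (range (tilingAt w)) ↔ T ∈ closure (range (tilingAt w)) := by
  have h := (Homeomorph.smul g (α := Tiling)).preimage_closure (range (tilingAt w))
  have h2 : (Homeomorph.smul g (α := Tiling)) ⁻¹' range (tilingAt w) = range (tilingAt w) := by
    ext T; exact smul_mem_range_iff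
  rw [h2] at h
  exact Set.ext_iff.mp h T

/-- Invariant measures do not charge the degenerate tilings. -/
theorem measure_closure_diff_range (w : ℤ_[2]) (μ : Measure Tiling) [IsFiniteMeasure μ]
    (hμ : ∀ g : PSL2R, MeasurePreserving (fun T : Tiling => g • T) μ μ) :
    μ (closure (range (tilingAt w)) \ range (tilingAt w)) = 0 := by
  set Z := closure (range (tilingAt w)) \ range (tilingAt w) with hZ
  have hZm : MeasurableSet Z :=
    isClosed_closure.measurableSet.diff (measurableSet_range_tilingAt w)
  have hZg : ∀ (g : PSL2R) (T : Tiling), g • T ∈ Z ↔ T ∈ Z := fun g T =>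
    and_congr smul_mem_closure_iff (not_congr smul_mem_range_iff)
  -- For degenerate tilings with a finite common boundary point, these sets sort that point into the
  -- intervals (k, k + 1]. The motion z ↦ z + 1 permutes them, so they have equal measure, which
  -- must be 0.
  let E : ℤ → Set Tiling := fun k => Z ∩ (pointingAbove k \ pointingAbove (k + 1))
  have hEm : ∀ k, MeasurableSet (E k) := fun k => hZm.inter
    ((isOpen_pointingAbove _).measurableSet.diff (isOpen_pointingAbove _).measurableSet)
  have hEs : ∀ k, μ (E (k + 1)) = μ (E k) := by
    intro k
    rw [← (hμ shift).measure_preimage (hEm (k + 1)).nullMeasurableSet]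
    congr 1
    ext T
    simp only [E, mem_preimage, mem_inter_iff, Set.mem_sdiff, hZg]
    push_cast
    rw [shift_smul_mem_pointingAbove_iff, shift_smul_mem_pointingAbove_iff]
  have hE0 : ∀ k, μ (E k) = μ (E 0) := by
    intro k
    induction k with
    | zero => rfl
    | succ n ih => rw [hEs, ih]
    | pred n ih => rw [← ih, ← hEs]; simp
  have hanti : ∀ s t : ℝ, s ≤ t → pointingAbove t ⊆ pointingAbove s := by
    rintro s t hst T ⟨A, hA, hA0, hAt⟩
    exact ⟨A, hA, hA0, hst.trans_lt hAt⟩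
  have hdisj : Pairwise (Function.onFun Disjoint E) := by
    have key : ∀ k l : ℤ, k < l → Disjoint (E k) (E l) := by
      intro k l hkl
      rw [Set.disjoint_left]
      rintro T ⟨-, -, hT⟩ ⟨-, hT', -⟩
      have : (k : ℝ) + 1 ≤ l := by exact_mod_cast hkl
      exact hT (hanti _ _ this hT')
    intro k l hkl
    rcases lt_or_gt_of_ne hkl with h | h
    · exact key k l h
    · exact (key l k h).symm
  have hE : μ (E 0) = 0 := by
    by_contra hne
    have h1 : μ (⋃ k, E k) = ⊤ := by
      rw [measure_iUnion hdisj hEm]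
      simp_rw [hE0]
      exact ENNReal.tsum_const_eq_top_of_ne_zero hne
    exact measure_ne_top μ _ h1
  have hN : μ (⋃ k, E k) = 0 := measure_iUnion_null fun k => by rw [hE0, hE]
  have hmem : ∀ T ∈ Z, ∀ A : SL(2, ℝ), toPSL A ∈ T.motions → A 1 0 ≠ 0 → T ∈ ⋃ k, E k := by
    intro T hT A hA hA0
    set k := ⌈A 0 0 / A 1 0⌉ - 1 with hk
    have hk1 : (k : ℝ) < A 0 0 / A 1 0 := by
      have := Int.ceil_lt_add_one (A 0 0 / A 1 0)
      rw [hk]; push_cast; linarith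
    have hk2 : A 0 0 / A 1 0 ≤ k + 1 := by
      have := Int.le_ceil (A 0 0 / A 1 0)
      rw [hk]; push_cast; linarith
    refine mem_iUnion.mpr ⟨k, hT, ⟨A, hA, hA0, hk1⟩, ?_⟩
    rintro ⟨B, hB, hB0, hBt⟩
    have h1 := lowerLeft_eq_zero_of_mem_closure hT.1 hT.2 hA hB
    rw [Matrix.SpecialLinearGroup.coe_mul, Matrix.SpecialLinearGroup.coe_inv,
      Matrix.adjugate_fin_two] at h1
    simp [Matrix.mul_apply] at h1
    have h2 : A 0 0 / A 1 0 = B 0 0 / B 1 0 := by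
      rw [div_eq_div_iff hA0 hB0]; linarith
    linarith
  -- The remaining tilings point to ∞, and `rot` moves ∞ to 0.
  refine measure_mono_null (t := (⋃ k, E k) ∪ (fun T => rot • T) ⁻¹' (⋃ k, E k)) ?_
    (measure_union_null hN ?_)
  · intro T hT
    obtain ⟨g, hg, -⟩ := mem_iUnion₂.mp (T.covers.symm ▸ mem_univ I : I ∈ ⋃ g ∈ T.motions, g • tile)
    obtain ⟨A, rfl⟩ := toPSL_surjective g
    by_cases hA : A 1 0 = 0
    · right
      refine hmem (rot • T) ((hZg rot T).mpr hT) (rotMatrix * A) ?_ ?_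
      · rw [rot, toPSL_mem_smul_iff, inv_mul_cancel_left]; exact hg
      · have hdet := A.det_coe
        rw [Matrix.det_fin_two, hA] at hdet
        have : A 0 0 ≠ 0 := by rintro h0; rw [h0] at hdet; simp at hdet
        rw [Matrix.SpecialLinearGroup.coe_mul, coe_rot]
        simpa [Matrix.mul_apply, hA] using this
    · exact Or.inl (hmem T hT A hg hA)
  · rw [(hμ rot).measure_preimage (MeasurableSet.iUnion hEm).nullMeasurableSet]
    exact hN

/-! ### Haar measure on SL(2,ℝ): right invariance and finite covolume of SL(2,ℤ). -/

/-- The Haar measure on `SL(2, ℝ)`. -/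
abbrev haarSL : Measure SL(2, ℝ) := Measure.haar

theorem map_mul_right_haarSL {g : SL(2, ℝ)} (hg : Measure.modularCharacter g = 1) :
    haarSL.map (· * g) = haarSL := by
  rw [Measure.map_right_mul_eq_modularCharacterFun_smul]
  change Measure.modularCharacter g • haarSL = haarSL
  rw [hg, one_smul]

theorem eq_one_of_pow_eq_one {a : ℝ≥0} {n : ℕ} (hn : n ≠ 0) (h : a ^ n = 1) : a = 1 :=
  (pow_eq_one_iff_of_nonneg (zero_le) hn).mp h

/-- SL(2,ℤ) is generated by elements of finite order, and a nonnegative real with a power equal to 1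
is 1. -/
theorem modularCharacter_incl (γ : SL(2, ℤ)) : Measure.modularCharacter (incl γ) = 1 := by
  refine mem_of_S_mem_of_rotInt_mem (Measure.modularCharacter.comp incl).ker ?_ ?_ γ
  · refine eq_one_of_pow_eq_one (n := 4) (by norm_num) ?_
    rw [← map_pow, show ModularGroup.S ^ 4 = 1 by decide, map_one]
  · refine eq_one_of_pow_eq_one (n := 6) (by norm_num) ?_
    rw [← map_pow, show rotInt ^ 6 = 1 by decide, map_one]

/-- S conjugates a scaling to its inverse, so the square of the character is 1. -/
theorem modularCharacter_dil (n : ℕ) : Measure.modularCharacter (dil n) = 1 := by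
  have h : incl ModularGroup.S * dil n * (incl ModularGroup.S)⁻¹ = (dil n)⁻¹ := by
    rw [mul_inv_eq_iff_eq_mul]
    ext i j
    fin_cases i <;> fin_cases j <;>
      simp [coe_dil, ModularGroup.coe_S, Matrix.mul_apply, Fin.sum_univ_two, Matrix.adjugate_fin_two]
  have h2 := congrArg Measure.modularCharacter h
  have h3 : Measure.modularCharacter (dil n) * Measure.modularCharacter (dil n)⁻¹ = 1 := by
    rw [← map_mul, mul_inv_cancel, map_one]
  have h4 : Measure.modularCharacter (incl ModularGroup.S)⁻¹ = 1 := by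
    rw [← map_inv]; exact modularCharacter_incl _
  rw [map_mul, map_mul, modularCharacter_incl, h4, one_mul, mul_one] at h2
  rw [← h2, ← pow_two] at h3
  exact eq_one_of_pow_eq_one two_ne_zero h3

/-- The matrix of `z ↦ z + t`. -/
def transl (t : ℝ) : SL(2, ℝ) := ⟨!![1, t; 0, 1], by simp⟩

theorem coe_transl (t : ℝ) : (transl t : Matrix (Fin 2) (Fin 2) ℝ) = !![1, t; 0, 1] := rfl

theorem coe_transl_smul (t : ℝ) (z : ℍ) : ((transl t • z : ℍ) : ℂ) = z + t := by
  rw [coe_specialLinearGroup_apply]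
  simp [coe_transl]

/-- The scaling by 2 conjugates a translation to its square. -/
theorem modularCharacter_transl (t : ℝ) : Measure.modularCharacter (transl t) = 1 := by
  have h : dil 1 * transl t = transl t * transl t * dil 1 := by
    have h2 : √2 * √2 = (2 : ℝ) := Real.mul_self_sqrt (by norm_num)
    ext i j
    fin_cases i <;> fin_cases j <;>
      simp [coe_dil, coe_transl, Matrix.mul_apply, Fin.sum_univ_two]
    field_simp
    linear_combination t * h2
  have h2 := congrArg Measure.modularCharacter h
  rw [map_mul, map_mul, map_mul, modularCharacter_dil, one_mul, mul_one] at h2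
  have h0 : Measure.modularCharacter (transl t) ≠ 0 :=
    (Measure.modularCharacterFun_pos (transl t)).ne'
  exact (mul_left_cancel₀ h0 (by rw [mul_one]; exact h2)).symm

/-- The measure on the upper half plane induced by the Haar measure. -/
def area : Measure ℍ := haarSL.map fun g => g⁻¹ • I

theorem measurable_inv_smul_I : Measurable fun g : SL(2, ℝ) => g⁻¹ • I :=
  Continuous.measurable (by fun_prop)

theorem area_preimage_smul {a : SL(2, ℝ)} (ha : Measure.modularCharacter a = 1) {E : Set ℍ}
    (hE : MeasurableSet E) : area ((fun z => a • z) ⁻¹' E) = area E := by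
  have ha' : Measure.modularCharacter a⁻¹ = 1 := by
    have : Measure.modularCharacter a * Measure.modularCharacter a⁻¹ = 1 := by
      rw [← map_mul, mul_inv_cancel, map_one]
    rwa [ha, one_mul] at this
  have hm : Measurable fun z : ℍ => a • z := (continuous_const_smul a).measurable
  rw [area, Measure.map_apply measurable_inv_smul_I (hm hE),
    Measure.map_apply measurable_inv_smul_I hE]
  conv_rhs => rw [← map_mul_right_haarSL ha']
  rw [Measure.map_apply (measurable_mul_const _) (measurable_inv_smul_I hE)]
  congr 1
  ext g
  simp [mul_smul]

theorem area_lt_top_of_isCompact {K : Set ℍ} (hK : IsCompact K) : area K < ⊤ := by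
  rw [area, Measure.map_apply measurable_inv_smul_I hK.measurableSet]
  have h : IsCompact ((fun g : SL(2, ℝ) => g • I) ⁻¹' K) := isProperMap_smul_I.isCompact_preimage hK
  have : (fun g : SL(2, ℝ) => g⁻¹ • I) ⁻¹' K = ((fun g : SL(2, ℝ) => g • I) ⁻¹' K)⁻¹ := rfl
  rw [this]
  exact h.inv.measure_lt_top

/-- A box in the upper half plane. -/
def box (r : ℝ) : Set ℍ := {z | -r ≤ z.re ∧ z.re < r ∧ 1 / 2 ≤ z.im ∧ z.im < 1}

theorem measurableSet_box (r : ℝ) : MeasurableSet (box r) := by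
  have hr : Measurable fun z : ℍ => z.re := UpperHalfPlane.continuous_re.measurable
  have hi : Measurable fun z : ℍ => z.im := UpperHalfPlane.continuous_im.measurable
  exact (measurableSet_le measurable_const hr).inter <| (measurableSet_lt hr measurable_const).inter <|
    (measurableSet_le measurable_const hi).inter (measurableSet_lt hi measurable_const)

theorem re_transl_smul (t : ℝ) (z : ℍ) : (transl t • z).re = z.re + t := by
  have := congrArg Complex.re (coe_transl_smul t z)
  simpa using! this

theorem im_transl_smul (t : ℝ) (z : ℍ) : (transl t • z).im = z.im := by
  have := congrArg Complex.im (coe_transl_smul t z)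
  simpa using! this

theorem area_box_half {r : ℝ} (hr : 0 < r) : area (box r) = 2 * area (box (r / 2)) := by
  have h : box r = (fun z => transl (r / 2) • z) ⁻¹' box (r / 2) ∪
      (fun z => transl (-(r / 2)) • z) ⁻¹' box (r / 2) := by
    ext z
    simp only [box, mem_ofPred_eq, mem_union, mem_preimage, re_transl_smul, im_transl_smul]
    constructor
    · rintro ⟨h1, h2, h3⟩
      rcases lt_or_ge z.re 0 with h | h
      · left; exact ⟨by linarith, by linarith, h3⟩
      · right; exact ⟨by linarith, by linarith, h3⟩
    · rintro (⟨h1, h2, h3⟩ | ⟨h1, h2, h3⟩)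
      · exact ⟨by linarith, by linarith, h3⟩
      · exact ⟨by linarith, by linarith, h3⟩
  have hd : Disjoint ((fun z => transl (r / 2) • z) ⁻¹' box (r / 2))
      ((fun z => transl (-(r / 2)) • z) ⁻¹' box (r / 2)) := by
    rw [Set.disjoint_left]
    rintro z ⟨-, h1, -⟩ ⟨h2, -⟩
    rw [re_transl_smul] at h1 h2
    linarith
  rw [h, measure_union hd ((continuous_const_smul _).measurable (measurableSet_box _)),
    area_preimage_smul (modularCharacter_transl _) (measurableSet_box _),
    area_preimage_smul (modularCharacter_transl _) (measurableSet_box _), two_mul]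

theorem area_box_pow (n : ℕ) : area (box 1) = 2 ^ n * area (box ((2 : ℝ) ^ n)⁻¹) := by
  induction n with
  | zero => simp
  | succ n ih =>
    rw [ih, area_box_half (by positivity), pow_succ, mul_assoc]
    congr 4
    rw [pow_succ, mul_inv]; rfl

theorem area_box_one_lt_top : area (box 1) < ⊤ := by
  refine (measure_mono ?_).trans_lt (area_lt_top_of_isCompact (isCompact_closedBall I 8))
  rintro z ⟨h1, h2, h3, h4⟩
  rw [Metric.mem_closedBall]
  refine (dist_le_dist_coe_div_sqrt z I).trans ?_
  rw [I_im, mul_one]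
  have h5 : (1 / 2 : ℝ) ≤ √z.im := Real.le_sqrt_of_sq_le (by linarith)
  have h6 : dist (z : ℂ) (I : ℍ) ≤ 4 := by
    rw [Complex.dist_eq]
    refine (Complex.norm_le_abs_re_add_abs_im _).trans ?_
    simp only [Complex.sub_re, Complex.sub_im, coe_re, coe_im, I_re, I_im, sub_zero]
    have h7 : |z.im - 1| ≤ 1 := abs_le.mpr ⟨by linarith, by linarith⟩
    have h8 : |z.re| ≤ 1 := abs_le.mpr ⟨by linarith, by linarith⟩
    linarith
  rw [div_le_iff₀ (by linarith)]
  linarith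

/-- A strip that contains the fundamental domain of the modular group. -/
def siegel : Set ℍ := {z | -1 ≤ z.re ∧ z.re < 1 ∧ 1 / 2 ≤ z.im}

/-- Cut the strip at heights 2 ^ n / 2. Scaling the n-th piece down gives a box of width 2 · 2⁻ⁿ at
fixed height, so the areas form a geometric series. -/
theorem area_siegel_lt_top : area siegel < ⊤ := by
  have h1 : siegel ⊆ ⋃ n : ℕ, (fun z => (dil n)⁻¹ • z) ⁻¹' box ((2 : ℝ) ^ n)⁻¹ := by
    rintro z ⟨h1, h2, h3⟩
    obtain ⟨n, hn1, hn2⟩ := exists_nat_pow_near (show 1 ≤ 2 * z.im by linarith) one_lt_two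
    refine mem_iUnion.mpr ⟨n, ?_⟩
    have hre := re_dil_smul n ((dil n)⁻¹ • z)
    have him := im_dil_smul n ((dil n)⁻¹ • z)
    rw [smul_inv_smul] at hre him
    have hp : (0 : ℝ) < 2 ^ n := by positivity
    rw [hre] at h1 h2
    rw [him] at hn1 hn2
    rw [pow_succ] at hn2
    change -((2 : ℝ) ^ n)⁻¹ ≤ _ ∧ _ < ((2 : ℝ) ^ n)⁻¹ ∧ _ ∧ _
    refine ⟨?_, ?_, ?_, ?_⟩
    · refine le_of_mul_le_mul_left ?_ hp
      rw [mul_neg, mul_inv_cancel₀ hp.ne']; exact h1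
    · refine lt_of_mul_lt_mul_left ?_ hp.le
      rw [mul_inv_cancel₀ hp.ne']; exact h2
    · refine le_of_mul_le_mul_left ?_ hp
      linarith
    · refine lt_of_mul_lt_mul_left ?_ hp.le
      linarith
  have h2 : ∀ n : ℕ, area ((fun z => (dil n)⁻¹ • z) ⁻¹' box ((2 : ℝ) ^ n)⁻¹) =
      area (box 1) * (2⁻¹) ^ n := by
    intro n
    have hd : Measure.modularCharacter (dil n)⁻¹ = 1 := by
      have : Measure.modularCharacter (dil n) * Measure.modularCharacter (dil n)⁻¹ = 1 := by
        rw [← map_mul, mul_inv_cancel, map_one]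
      rwa [modularCharacter_dil, one_mul] at this
    rw [area_preimage_smul hd (measurableSet_box _), area_box_pow n, mul_right_comm,
      ← mul_pow, ENNReal.mul_inv_cancel (by norm_num) (by norm_num), one_pow, one_mul]
  refine (measure_mono h1).trans_lt ((measure_iUnion_le _).trans_lt ?_)
  simp_rw [h2]
  rw [ENNReal.tsum_mul_left, ENNReal.tsum_geometric]
  refine ENNReal.mul_lt_top area_box_one_lt_top ?_
  simp

theorem measurableSet_siegel : MeasurableSet siegel := by
  have hr : Measurable fun z : ℍ => z.re := UpperHalfPlane.continuous_re.measurable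
  have hi : Measurable fun z : ℍ => z.im := UpperHalfPlane.continuous_im.measurable
  exact (measurableSet_le measurable_const hr).inter <|
    (measurableSet_lt hr measurable_const).inter (measurableSet_le measurable_const hi)

theorem haarSL_siegel_lt_top : haarSL {g | g⁻¹ • I ∈ siegel} < ⊤ := by
  have := area_siegel_lt_top
  rwa [area, Measure.map_apply measurable_inv_smul_I measurableSet_siegel] at this

theorem exists_mul_incl_mem_siegel (h : SL(2, ℝ)) :
    ∃ γ : SL(2, ℤ), (h * incl γ)⁻¹ • I ∈ siegel := by
  obtain ⟨γ, hγ⟩ := ModularGroup.exists_smul_mem_fd (h⁻¹ • I)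
  refine ⟨γ⁻¹, ?_⟩
  rw [mul_inv_rev, map_inv, inv_inv, mul_smul, incl_smul]
  have h1 := ModularGroup.three_le_four_mul_im_sq_of_mem_fd hγ
  have h2 := abs_le.mp hγ.2
  refine ⟨by linarith [h2.1], by linarith [h2.2], ?_⟩
  by_contra hlt
  push Not at hlt
  nlinarith [(γ • h⁻¹ • I).im_pos]

theorem exists_nhds_incl_eq_one : ∃ W ∈ 𝓝 (1 : SL(2, ℝ)), ∀ γ, incl γ ∈ W → γ = 1 := by
  have he : IsClosedEmbedding (incl : SL(2, ℤ) → SL(2, ℝ)) :=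
    Topology.IsClosedEmbedding.specialLinearGroup_map (f := Int.castRingHom ℝ)
      Int.isClosedEmbedding_coe_real
  obtain ⟨W, hW, hWe⟩ := (he.isInducing.isOpen_iff).mp (isOpen_discrete {(1 : SL(2, ℤ))})
  refine ⟨W, hW.mem_nhds ?_, fun γ hγ => ?_⟩
  · have : (1 : SL(2, ℤ)) ∈ incl ⁻¹' W := by rw [hWe]; rfl
    simpa using this
  · have : γ ∈ incl ⁻¹' W := hγ
    rwa [hWe] at this

theorem exists_isOpen_inv_mul_mem {G : Type*} [Group G] [TopologicalSpace G] [IsTopologicalGroup G]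
    {W : Set G} (hW : W ∈ 𝓝 (1 : G)) :
    ∃ V, IsOpen V ∧ 1 ∈ V ∧ ∀ a ∈ V, ∀ b ∈ V, a⁻¹ * b ∈ W := by
  have hc : Continuous fun p : G × G => p.1⁻¹ * p.2 := by fun_prop
  have hW' : ∀ᶠ p in 𝓝 ((1 : G), (1 : G)), p.1⁻¹ * p.2 ∈ W :=
    hc.continuousAt.eventually_mem (by simpa using hW)
  rw [nhds_prod_eq, eventually_prod_iff] at hW'
  obtain ⟨p, hp, q, hq, h⟩ := hW'
  obtain ⟨V, hV, hVo, hV1⟩ := mem_nhds_iff.mp (hp.and hq)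
  exact ⟨V, hVo, hV1, fun a ha b hb => h (hV ha).1 (hV hb).2⟩

/-- An exact Borel fundamental domain for `SL(2, ℤ)` acting on `SL(2, ℝ)` from the right. -/
theorem exists_fundamental_set : ∃ F : Set SL(2, ℝ), MeasurableSet F ∧
    ∀ h, ∃! γ : SL(2, ℤ), h * incl γ ∈ F := by
  obtain ⟨W, hW, hWγ⟩ := exists_nhds_incl_eq_one
  obtain ⟨V, hVo, hV1, hVW⟩ := exists_isOpen_inv_mul_mem hW
  let g := TopologicalSpace.denseSeq SL(2, ℝ)
  let U : ℕ → Set SL(2, ℝ) := fun n => {h | (g n)⁻¹ * h ∈ V}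
  have hUo : ∀ n, IsOpen (U n) := fun n => hVo.preimage (by fun_prop)
  have hUcov : ∀ h, ∃ n, h ∈ U n := by
    intro h
    have ho : IsOpen {k : SL(2, ℝ) | k⁻¹ * h ∈ V} := hVo.preimage (by fun_prop)
    obtain ⟨_, hn, ⟨n, rfl⟩⟩ := (TopologicalSpace.denseRange_denseSeq SL(2, ℝ)).inter_open_nonempty _ ho
      ⟨h, by simpa using hV1⟩
    exact ⟨n, hn⟩
  have hUinj : ∀ n h γ γ', h * incl γ ∈ U n → h * incl γ' ∈ U n → γ = γ' := by
    intro n h γ γ' h1 h2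
    have h3 := hVW _ h1 _ h2
    have h4 : ((g n)⁻¹ * (h * incl γ))⁻¹ * ((g n)⁻¹ * (h * incl γ')) = incl (γ⁻¹ * γ') := by
      rw [map_mul, map_inv]; group
    rw [h4] at h3
    exact inv_mul_eq_one.mp (hWγ _ h3)
  let N : ℕ → Set SL(2, ℝ) := fun n => ⋃ γ : SL(2, ℤ), {h | h * incl γ ∈ U n}
  have hNo : ∀ n, IsOpen (N n) := fun n => isOpen_iUnion fun γ => (hUo n).preimage (by fun_prop)
  -- Each U n meets an orbit at most once, and N n is the union of the orbits meeting U n. An orbit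
  -- is represented only in the first U n that it meets.
  refine ⟨⋃ n, (U n \ ⋃ m ∈ Finset.range n, N m), ?_, fun h => ?_⟩
  · exact MeasurableSet.iUnion fun n => (hUo n).measurableSet.diff
      (Finset.measurableSet_biUnion _ fun m _ => (hNo m).measurableSet)
  · classical
    have hex : ∃ n, ∃ γ : SL(2, ℤ), h * incl γ ∈ U n := by
      obtain ⟨n, hn⟩ := hUcov h
      exact ⟨n, 1, by simpa using hn⟩
    obtain ⟨γ, hγ⟩ := Nat.find_spec hex
    refine ⟨γ, mem_iUnion.mpr ⟨Nat.find hex, hγ, ?_⟩, ?_⟩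
    · intro hmem
      obtain ⟨m, hm, hmem⟩ := mem_iUnion₂.mp hmem
      obtain ⟨δ, hδ⟩ := mem_iUnion.mp hmem
      refine Nat.find_min hex (Finset.mem_range.mp hm) ⟨γ * δ, ?_⟩
      rw [map_mul, ← mul_assoc]; exact hδ
    · intro δ hδ
      obtain ⟨n, hn, hn'⟩ := mem_iUnion.mp hδ
      have hle : Nat.find hex ≤ n := Nat.find_min' hex ⟨δ, hn⟩
      rcases hle.eq_or_lt with rfl | hlt
      · exact hUinj _ _ _ _ hn hγ
      · exfalso
        refine hn' (mem_iUnion₂.mpr ⟨Nat.find hex, Finset.mem_range.mpr hlt,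
          mem_iUnion.mpr ⟨δ⁻¹ * γ, ?_⟩⟩)
        change h * incl δ * incl (δ⁻¹ * γ) ∈ U (Nat.find hex)
        rw [mul_assoc, ← map_mul, mul_inv_cancel_left]
        exact hγ

/-! ### Unique ergodicity on pairs of dyadic integers. -/

instance : MeasurableSpace ℤ_[2] := borel ℤ_[2]

instance : BorelSpace ℤ_[2] := ⟨rfl⟩

/-- The Haar probability measure on the pairs of dyadic integers. -/
def haarPair : Measure IndexPair := Measure.addHaarMeasure ⊤

instance : Measure.IsAddHaarMeasure haarPair := by unfold haarPair; infer_instance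

instance : IsProbabilityMeasure haarPair := ⟨Measure.addHaarMeasure_self⟩

theorem eq_haarPair {μ : Measure IndexPair} [IsProbabilityMeasure μ]
    (h : ∀ t : IndexPair, μ.map (t + ·) = μ) : μ = haarPair := by
  have : μ.IsAddLeftInvariant := ⟨h⟩
  have : μ.IsAddHaarMeasure :=
    Measure.isAddHaarMeasure_of_isCompact_nonempty_interior μ univ isCompact_univ (by simp)
      (by simp) (by simp)
  exact Measure.isAddHaarMeasure_eq_of_isProbabilityMeasure _ _

/-- The image of Haar measure under an affine map with surjective linear part is again translation
invariant. -/
theorem map_haarPair {f : IndexPair → IndexPair} (hf : Continuous f) {L : IndexPair → IndexPair}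
    (hL : Function.Surjective L) (hfL : ∀ t x, f (t + x) = L t + f x) :
    haarPair.map f = haarPair := by
  have : IsProbabilityMeasure (haarPair.map f) :=
    Measure.isProbabilityMeasure_map hf.aemeasurable
  refine eq_haarPair fun s => ?_
  obtain ⟨t, rfl⟩ := hL s
  rw [Measure.map_map (by fun_prop) hf.measurable]
  have : (L t + ·) ∘ f = f ∘ (t + ·) := by
    funext x
    exact (hfL t x).symm
  rw [this, ← Measure.map_map hf.measurable (by fun_prop), map_add_left_eq_self]

theorem map_indexAction_haarPair (w : ℤ_[2]) (γ : SL(2, ℤ)) :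
    haarPair.map (indexAction w γ) = haarPair := by
  let H : Subgroup SL(2, ℤ) :=
    { carrier := {γ | haarPair.map (indexAction w γ) = haarPair}
      one_mem' := by
        change haarPair.map (indexAction w 1) = haarPair
        rw [map_one]
        exact Measure.map_id
      mul_mem' := by
        intro a b (ha : _ = _) (hb : _ = _)
        change haarPair.map (indexAction w (a * b)) = haarPair
        have : (indexAction w (a * b) : IndexPair → IndexPair) =
          indexAction w a ∘ indexAction w b := by rw [map_mul]; rfl
        rw [this, ← Measure.map_map (indexAction w a).continuous.measurable
          (indexAction w b).continuous.measurable, hb, ha]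
      inv_mem' := by
        intro a (ha : _ = _)
        change haarPair.map (indexAction w a⁻¹) = haarPair
        conv_lhs => rw [← ha]
        rw [Measure.map_map (indexAction w _).continuous.measurable
          (indexAction w a).continuous.measurable]
        have : (indexAction w a⁻¹ : IndexPair → IndexPair) ∘ indexAction w a = id := by
          change ⇑(indexAction w a⁻¹ * indexAction w a) = id
          rw [← map_mul, inv_mul_cancel, map_one]
          rfl
        rw [this, Measure.map_id] }
  refine mem_of_S_mem_of_rotInt_mem H ?_ ?_ γ
  · change haarPair.map (indexAction w _) = haarPair
    rw [indexAction_S]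
    refine map_haarPair flip.continuous (L := Prod.swap) Prod.swap_surjective fun t x => ?_
    ext <;> simp <;> ring
  · change haarPair.map (indexAction w _) = haarPair
    rw [indexAction_rotInt]
    refine map_haarPair (turn w).continuous (L := fun t => (- t.1 - t.2, t.1))
      (fun s => ⟨(s.2, -s.1 - s.2), Prod.ext (by ring) rfl⟩) fun t x => ?_
    ext <;> simp; ring

/-- The translations that leave a measure invariant form a closed set. -/
theorem isClosed_setOf_map_add_eq (μ : Measure IndexPair) [IsFiniteMeasure μ] :
    IsClosed {t : IndexPair | μ.map (t + ·) = μ} := by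
  -- Invariance is tested on bounded continuous functions, whose translated integrals depend
  -- continuously on t by dominated convergence.
  have h : {t : IndexPair | μ.map (t + ·) = μ} =
      ⋂ f : BoundedContinuousFunction IndexPair ℝ,
        {t | ∫ x, f (t + x) ∂μ = ∫ x, f x ∂μ} := by
    ext t
    simp only [mem_iInter, mem_ofPred_eq]
    have key (f : BoundedContinuousFunction IndexPair ℝ) :
        ∫ x, f x ∂(μ.map (t + ·)) = ∫ x, f (t + x) ∂μ :=
      integral_map (by fun_prop) f.continuous.aestronglyMeasurable
    refine ⟨fun ht f => ?_, fun ht => ?_⟩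
    · rw [← key, ht]
    · exact ext_of_forall_integral_eq_of_IsFiniteMeasure fun f => by rw [key, ht]
  rw [h]
  refine isClosed_iInter fun f => isClosed_eq ?_ continuous_const
  refine continuous_of_dominated (bound := fun _ => ‖f‖)
    (fun t => (f.continuous.comp (by fun_prop)).aestronglyMeasurable)
    (fun t => Eventually.of_forall fun x => f.norm_coe_le_norm _) (integrable_const _)
    (Eventually.of_forall fun x => f.continuous.comp (by fun_prop))

theorem isUnit_three : IsUnit (3 : ℤ_[2]) := by
  have h : IsUnit ((3 : ℕ) : ℤ_[2]) := by
    rw [PadicInt.isUnit_iff, PadicInt.norm_natCast_eq_one_iff]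
    decide
  exact_mod_cast h

/-- Unique ergodicity of the action of the modular group on the pairs of indices. -/
theorem eq_haarPair_of_indexAction {w : ℤ_[2]} {μ : Measure IndexPair} [IsProbabilityMeasure μ]
    (h : ∀ γ, μ.map (indexAction w γ) = μ) : μ = haarPair := by
  let H : AddSubgroup IndexPair :=
    { carrier := {t | μ.map (t + ·) = μ}
      zero_mem' := by
        change μ.map (0 + ·) = μ
        simp
      add_mem' := by
        intro a b (ha : _ = _) (hb : _ = _)
        change μ.map (a + b + ·) = μ
        have : (a + b + ·) = (a + ·) ∘ (b + ·) := by funext x; simp [add_assoc]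
        rw [this, ← Measure.map_map (by fun_prop) (by fun_prop), hb, ha]
      neg_mem' := by
        intro a (ha : _ = _)
        change μ.map (-a + ·) = μ
        conv_lhs => rw [← ha]
        rw [Measure.map_map (by fun_prop) (by fun_prop)]
        have : (-a + ·) ∘ (a + ·) = id := by funext x; simp
        rw [this, Measure.map_id] }
  have hH : IsClosed (H : Set IndexPair) := isClosed_setOf_map_add_eq μ
  -- T⁻¹ = S · `rotInt` acts with a sign change in the second coordinate; its square is a pure
  -- translation, in which w cancels.
  have h1 : ((2, -1) : IndexPair) ∈ H := by
    change μ.map ((2, -1) + ·) = μ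
    convert h (ModularGroup.S * rotInt * (ModularGroup.S * rotInt)) using 2
    simp only [map_mul, indexAction_S, indexAction_rotInt]
    funext x
    ext <;> simp <;> ring
  have h2 : ((-1, 2) : IndexPair) ∈ H := by
    change μ.map ((-1, 2) + ·) = μ
    convert h (rotInt * (ModularGroup.S * rotInt * (ModularGroup.S * rotInt)) * rotInt⁻¹) using 2
    simp only [map_mul, map_inv, indexAction_S, indexAction_rotInt]
    funext x
    ext <;> simp [Homeomorph.inv_apply] <;> ring
  -- A closed subgroup is a ℤ₂-submodule because ℤ is dense in ℤ₂.
  have mul_mem : ∀ t ∈ H, ∀ x : ℤ_[2], ((x * t.1, x * t.2) : IndexPair) ∈ H := by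
    intro t ht x
    have hc : IsClosed {x : ℤ_[2] | ((x * t.1, x * t.2) : IndexPair) ∈ H} :=
      hH.preimage (by fun_prop)
    refine hc.closure_subset_iff.mpr ?_ (PadicInt.denseRange_intCast x)
    rintro _ ⟨n, rfl⟩
    have hn : (((n : ℤ_[2]) * t.1, (n : ℤ_[2]) * t.2) : IndexPair) = n • t := by ext <;> simp
    change (((n : ℤ_[2]) * t.1, (n : ℤ_[2]) * t.2) : IndexPair) ∈ H
    rw [hn]
    exact H.zsmul_mem ht n
  refine eq_haarPair fun t => ?_
  -- Cramer's rule for the vectors (2, -1) and (-1, 2), of determinant 3.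
  obtain ⟨u, hu⟩ := isUnit_three.exists_right_inv
  have ht : t = (u * (2 * t.1 + t.2) * 2, u * (2 * t.1 + t.2) * (-1)) +
      (u * (t.1 + 2 * t.2) * (-1), u * (t.1 + 2 * t.2) * 2) := by
    refine Prod.ext ?_ ?_
    · simp only [Prod.fst_add]
      linear_combination (-t.1) * hu
    · simp only [Prod.snd_add]
      linear_combination (-t.2) * hu
  rw [ht]
  exact H.add_mem (mul_mem _ h1 _) (mul_mem _ h2 _)

/-! ### The invariant probability measure. -/

/-- A set that meets every orbit of a countable group at most once has, inside any invariant set,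
at most the measure of a set that meets every orbit. -/
theorem measure_inter_le_of_orbits {α Γ : Type*} [Group Γ] [Countable Γ] [MeasurableSpace α]
    {M : Measure α} {a : Γ → α → α} (ha : ∀ γ, MeasurePreserving (a γ) M M)
    (hinv : ∀ γ p, a γ (a γ⁻¹ p) = p) {D₁ D₂ E : Set α} (hD₁ : MeasurableSet D₁)
    (hD₂ : MeasurableSet D₂) (hE : MeasurableSet E)
    (h₁ : ∀ p γ γ', a γ p ∈ D₁ → a γ' p ∈ D₁ → γ = γ') (h₂ : ∀ p, ∃ γ, a γ p ∈ D₂)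
    (hEa : ∀ γ p, a γ p ∈ E ↔ p ∈ E) : M (D₁ ∩ E) ≤ M (D₂ ∩ E) := by
  calc M (D₁ ∩ E) ≤ M (⋃ γ, D₁ ∩ E ∩ a γ ⁻¹' D₂) := by
        refine measure_mono fun p hp => ?_
        obtain ⟨γ, hγ⟩ := h₂ p
        exact mem_iUnion.mpr ⟨γ, hp, hγ⟩
    _ ≤ ∑' γ, M (D₁ ∩ E ∩ a γ ⁻¹' D₂) := measure_iUnion_le _
    _ = ∑' γ, M (a γ⁻¹ ⁻¹' D₁ ∩ (D₂ ∩ E)) := by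
        congr 1
        funext γ
        rw [← (ha γ⁻¹).measure_preimage
          ((hD₁.inter hE).inter ((ha γ).measurable hD₂)).nullMeasurableSet]
        congr 1
        ext p
        simp only [mem_preimage, mem_inter_iff, hinv, hEa]
        tauto
    _ = M (⋃ γ, a γ⁻¹ ⁻¹' D₁ ∩ (D₂ ∩ E)) := by
        refine (measure_iUnion ?_ fun γ => ((ha γ⁻¹).measurable hD₁).inter (hD₂.inter hE)).symm
        intro γ γ' hne
        refine Set.disjoint_left.mpr fun p hp hp' => hne ?_
        exact inv_injective (h₁ p _ _ hp.1 hp'.1)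
    _ ≤ M (D₂ ∩ E) := measure_mono (iUnion_subset fun γ => inter_subset_right)

/-- The pairs `(A, x)` and `move w γ (A, x)` describe the same tiling. -/
def move (w : ℤ_[2]) (γ : SL(2, ℤ)) (p : SL(2, ℝ) × IndexPair) : SL(2, ℝ) × IndexPair :=
  (p.1 * incl γ⁻¹, indexAction w γ p.2)

theorem move_mul (w : ℤ_[2]) (γ δ : SL(2, ℤ)) (p : SL(2, ℝ) × IndexPair) :
    move w (γ * δ) p = move w γ (move w δ p) := by
  simp only [move, map_mul, mul_inv_rev, mul_assoc]
  rfl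

theorem move_one (w : ℤ_[2]) (p : SL(2, ℝ) × IndexPair) : move w 1 p = p := by
  simp only [move, map_one, inv_one, mul_one]
  rfl

theorem move_move_inv (w : ℤ_[2]) (γ : SL(2, ℤ)) (p : SL(2, ℝ) × IndexPair) :
    move w γ (move w γ⁻¹ p) = p := by
  rw [← move_mul, mul_inv_cancel, move_one]

theorem tilingAt_move (w : ℤ_[2]) (γ : SL(2, ℤ)) (p : SL(2, ℝ) × IndexPair) :
    tilingAt w (move w γ p) = tilingAt w p :=
  tilingAt_mul_incl w p.1 p.2 γ

theorem measurable_move (w : ℤ_[2]) (γ : SL(2, ℤ)) : Measurable (move w γ) := by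
  have h : Measurable fun h : SL(2, ℝ) => h * incl γ⁻¹ :=
    (continuous_mul_const (incl γ⁻¹)).measurable
  exact (h.comp measurable_fst).prodMk
    ((indexAction w γ).continuous.measurable.comp measurable_snd)

theorem measurePreserving_mul_incl (γ : SL(2, ℤ)) :
    MeasurePreserving (fun h : SL(2, ℝ) => h * incl γ) haarSL haarSL :=
  ⟨(continuous_mul_const (incl γ)).measurable, map_mul_right_haarSL (modularCharacter_incl γ)⟩

theorem measurePreserving_move (w : ℤ_[2]) (γ : SL(2, ℤ)) :
    MeasurePreserving (move w γ) (haarSL.prod haarPair) (haarSL.prod haarPair) :=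
  (measurePreserving_mul_incl γ⁻¹).prod
    ⟨(indexAction w γ).continuous.measurable, map_indexAction_haarPair w γ⟩

/-- A Borel set of representatives for `SL(2, ℝ)` modulo `SL(2, ℤ)`. -/
def fundamentalSet : Set SL(2, ℝ) := exists_fundamental_set.choose

theorem measurableSet_fundamentalSet : MeasurableSet fundamentalSet :=
  exists_fundamental_set.choose_spec.1

theorem existsUnique_mul_incl_mem (h : SL(2, ℝ)) : ∃! γ : SL(2, ℤ), h * incl γ ∈ fundamentalSet :=
  exists_fundamental_set.choose_spec.2 h

theorem existsUnique_mul_incl_inv_mem (h : SL(2, ℝ)) :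
    ∃! γ : SL(2, ℤ), h * incl γ⁻¹ ∈ fundamentalSet := by
  obtain ⟨γ, hγ, hu⟩ := existsUnique_mul_incl_mem h
  exact ⟨γ⁻¹, by simpa using hγ, fun δ hδ => by rw [← hu _ hδ, inv_inv]⟩

theorem haarSL_fundamentalSet_lt_top : haarSL fundamentalSet < ⊤ := by
  have hS : MeasurableSet {g : SL(2, ℝ) | g⁻¹ • I ∈ siegel} :=
    measurable_inv_smul_I measurableSet_siegel
  have := measure_inter_le_of_orbits (M := haarSL)
    (a := fun (γ : SL(2, ℤ)) h => h * incl γ⁻¹) (fun γ => measurePreserving_mul_incl _)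
    (fun γ p => by simp [mul_assoc]) (D₂ := {g : SL(2, ℝ) | g⁻¹ • I ∈ siegel})
    measurableSet_fundamentalSet hS MeasurableSet.univ
    (fun h γ γ' h1 h2 => (existsUnique_mul_incl_inv_mem h).unique h1 h2)
    (fun h => by
      obtain ⟨γ, hγ⟩ := exists_mul_incl_mem_siegel h
      exact ⟨γ⁻¹, by rwa [inv_inv]⟩) (fun _ _ => Iff.rfl)
  rw [inter_univ, inter_univ] at this
  exact this.trans_lt haarSL_siegel_lt_top

theorem haarSL_fundamentalSet_ne_zero : haarSL fundamentalSet ≠ 0 := by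
  intro h0
  have h : (⋃ γ : SL(2, ℤ), (fun h : SL(2, ℝ) => h * incl γ) ⁻¹' fundamentalSet) = univ :=
    eq_univ_of_forall fun h => mem_iUnion.mpr (existsUnique_mul_incl_mem h).exists
  have h1 : haarSL univ = 0 := by
    rw [← h]
    refine measure_iUnion_null fun γ => ?_
    rw [(measurePreserving_mul_incl γ).measure_preimage
      measurableSet_fundamentalSet.nullMeasurableSet, h0]
  exact NeZero.ne haarSL (Measure.measure_univ_eq_zero.mp h1)

/-- The invariant measure on the tilings with fixed sum. -/
def tilingMeasure (w : ℤ_[2]) : Measure Tiling :=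
  (haarSL fundamentalSet)⁻¹ •
    ((haarSL.prod haarPair).restrict (fundamentalSet ×ˢ univ)).map (tilingAt w)

theorem tilingMeasure_apply (w : ℤ_[2]) {A : Set Tiling} (hA : MeasurableSet A) :
    tilingMeasure w A = (haarSL fundamentalSet)⁻¹ *
      haarSL.prod haarPair (fundamentalSet ×ˢ univ ∩ tilingAt w ⁻¹' A) := by
  rw [tilingMeasure, Measure.smul_apply, smul_eq_mul,
    Measure.map_apply (continuous_tilingAt w).measurable hA,
    Measure.restrict_apply ((continuous_tilingAt w).measurable hA), inter_comm]

instance (w : ℤ_[2]) : IsProbabilityMeasure (tilingMeasure w) := by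
  constructor
  rw [tilingMeasure_apply w MeasurableSet.univ, preimage_univ, inter_univ, Measure.prod_prod,
    measure_univ, mul_one, ENNReal.inv_mul_cancel haarSL_fundamentalSet_ne_zero
      haarSL_fundamentalSet_lt_top.ne]

theorem tilingMeasure_compl_closure (w : ℤ_[2]) :
    tilingMeasure w (closure (range (tilingAt w)))ᶜ = 0 := by
  rw [tilingMeasure_apply w isClosed_closure.measurableSet.compl]
  have : tilingAt w ⁻¹' (closure (range (tilingAt w)))ᶜ = ∅ :=
    eq_empty_of_forall_notMem fun p hp => hp (subset_closure ⟨p, rfl⟩)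
  rw [this, inter_empty, measure_empty, mul_zero]

theorem measurePreserving_mul_left (B : SL(2, ℝ)) :
    MeasurePreserving (fun p : SL(2, ℝ) × IndexPair => (B * p.1, p.2))
      (haarSL.prod haarPair) (haarSL.prod haarPair) :=
  (MeasureTheory.measurePreserving_mul_left haarSL B).prod (MeasurePreserving.id haarPair)

/-- Left multiplication commutes with the action of SL(2,ℤ), so it carries one fundamental domain to
another, and two fundamental domains have equal measure inside any invariant set. -/
theorem measurePreserving_tilingMeasure (w : ℤ_[2]) (g : PSL2R) :
    MeasurePreserving (fun T : Tiling => g • T) (tilingMeasure w) (tilingMeasure w) := by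
  obtain ⟨B, rfl⟩ := toPSL_surjective g
  have hm : Measurable fun T : Tiling => toPSL B • T := (continuous_const_smul _).measurable
  refine ⟨hm, Measure.ext fun A hA => ?_⟩
  have hΨ := (continuous_tilingAt w).measurable
  rw [Measure.map_apply hm hA, tilingMeasure_apply w (hm hA), tilingMeasure_apply w hA]
  congr 1
  have hB := measurePreserving_mul_left B⁻¹
  have hF : MeasurableSet (fundamentalSet ×ˢ (univ : Set IndexPair)) :=
    measurableSet_fundamentalSet.prod MeasurableSet.univ
  rw [← hB.measure_preimage (hF.inter (hΨ (hm hA))).nullMeasurableSet]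
  have heq : (fun p : SL(2, ℝ) × IndexPair => (B⁻¹ * p.1, p.2)) ⁻¹'
      (fundamentalSet ×ˢ univ ∩ tilingAt w ⁻¹' ((fun T : Tiling => toPSL B • T) ⁻¹' A)) =
      (fun p : SL(2, ℝ) × IndexPair => (B⁻¹ * p.1, p.2)) ⁻¹' (fundamentalSet ×ˢ univ) ∩
        tilingAt w ⁻¹' A := by
    ext p
    simp only [mem_preimage, mem_inter_iff, toPSL_smul_tilingAt, mul_inv_cancel_left]
  rw [heq]
  have hu : ∀ p : SL(2, ℝ) × IndexPair, ∃! γ, move w γ p ∈ fundamentalSet ×ˢ (univ : Set IndexPair) := by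
    intro p
    simpa [move] using existsUnique_mul_incl_inv_mem p.1
  have hu' : ∀ p : SL(2, ℝ) × IndexPair, ∃! γ, move w γ p ∈
      (fun p : SL(2, ℝ) × IndexPair => (B⁻¹ * p.1, p.2)) ⁻¹'
        (fundamentalSet ×ˢ (univ : Set IndexPair)) := by
    intro p
    simpa [move, mul_assoc] using existsUnique_mul_incl_inv_mem (B⁻¹ * p.1)
  have hA' : ∀ γ p, move w γ p ∈ tilingAt w ⁻¹' A ↔ p ∈ tilingAt w ⁻¹' A := fun γ p => by
    rw [mem_preimage, mem_preimage, tilingAt_move]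
  apply le_antisymm
  · exact measure_inter_le_of_orbits (measurePreserving_move w) (move_move_inv w)
      (hB.measurable hF) hF (hΨ hA) (fun p _ _ h1 h2 => (hu' p).unique h1 h2)
      (fun p => (hu p).exists) hA'
  · exact measure_inter_le_of_orbits (measurePreserving_move w) (move_move_inv w)
      hF (hB.measurable hF) (hΨ hA) (fun p _ _ h1 h2 => (hu p).unique h1 h2)
      (fun p => (hu' p).exists) hA'

/-! ### Uniqueness by lifting invariant measures to the parameter space. -/

/-- A Borel section of the parametrization of the nondegenerate tilings. -/
theorem exists_measurable_section (w : ℤ_[2]) :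
    ∃ σ : Tiling → SL(2, ℝ) × IndexPair, Measurable σ ∧
      ∀ T ∈ range (tilingAt w), tilingAt w (σ T) = T := by
  have hF : MeasurableSet (fundamentalSet ×ˢ (univ : Set IndexPair)) :=
    measurableSet_fundamentalSet.prod MeasurableSet.univ
  have := hF.standardBorel
  let f : fundamentalSet ×ˢ (univ : Set IndexPair) → Tiling := fun p => tilingAt w p
  have hf : Measurable f := (continuous_tilingAt w).measurable.comp measurable_subtype_coe
  have hinj : Function.Injective f := by
    rintro ⟨⟨A, x⟩, hA, _⟩ ⟨⟨A', x'⟩, hA', _⟩ h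
    obtain ⟨γ, rfl, rfl⟩ := exists_of_tilingAt_eq h
    have hγ : γ = 1 := (existsUnique_mul_incl_inv_mem A).unique hA' (by simpa using hA)
    subst hγ
    exact Subtype.ext (move_one w (A, x)).symm
  -- By Lusin–Souslin, the injective Borel map from the fundamental domain is a measurable
  -- embedding, so its inverse extends measurably to all tilings.
  obtain ⟨σ, hσ, hσf⟩ := (hf.measurableEmbedding hinj).exists_measurable_extend
    (g := Subtype.val) measurable_subtype_coe fun _ => inferInstance
  refine ⟨σ, hσ, ?_⟩
  rintro _ ⟨p, rfl⟩
  obtain ⟨γ, hγ, -⟩ := existsUnique_mul_incl_inv_mem p.1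
  have h := congrFun hσf ⟨move w γ p, hγ, mem_univ _⟩
  have hf : f ⟨move w γ p, hγ, mem_univ _⟩ = tilingAt w p := tilingAt_move w γ p
  rw [Function.comp_apply, hf] at h
  rw [h]
  exact tilingAt_move w γ p

/-- The number of points of the orbit of `p` that lie in `E`. -/
def orbitCount (w : ℤ_[2]) (E : Set (SL(2, ℝ) × IndexPair)) (p : SL(2, ℝ) × IndexPair) : ℝ≥0∞ :=
  ∑' γ : SL(2, ℤ), E.indicator 1 (move w γ p)

theorem measurable_orbitCount (w : ℤ_[2]) {E : Set (SL(2, ℝ) × IndexPair)}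
    (hE : MeasurableSet E) : Measurable (orbitCount w E) :=
  Measurable.tsum fun γ => (measurable_one.indicator hE).comp (measurable_move w γ)

theorem orbitCount_move (w : ℤ_[2]) (E : Set (SL(2, ℝ) × IndexPair)) (γ : SL(2, ℤ))
    (p : SL(2, ℝ) × IndexPair) : orbitCount w E (move w γ p) = orbitCount w E p := by
  simp only [orbitCount, ← move_mul]
  exact (Equiv.mulRight γ).tsum_eq fun δ => E.indicator (1 : SL(2, ℝ) × IndexPair → ℝ≥0∞) (move w δ p)

theorem orbitCount_eq_of_tilingAt_eq {w : ℤ_[2]} (E : Set (SL(2, ℝ) × IndexPair))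
    {p q : SL(2, ℝ) × IndexPair} (h : tilingAt w p = tilingAt w q) :
    orbitCount w E p = orbitCount w E q := by
  obtain ⟨γ, h1, h2⟩ := exists_of_tilingAt_eq (A := p.1) (x := p.2) (A' := q.1) (x' := q.2) h
  have : q = move w γ p := Prod.ext h1 h2
  rw [this, orbitCount_move]

theorem orbitCount_preimage_move (w : ℤ_[2]) (E : Set (SL(2, ℝ) × IndexPair)) (γ : SL(2, ℤ))
    (p : SL(2, ℝ) × IndexPair) : orbitCount w (move w γ ⁻¹' E) p = orbitCount w E p := by
  have h (δ : SL(2, ℤ)) : (move w γ ⁻¹' E).indicator (1 : SL(2, ℝ) × IndexPair → ℝ≥0∞) (move w δ p) =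
      E.indicator 1 (move w (γ * δ) p) := by
    rw [move_mul]
    rfl
  simp only [orbitCount, h]
  exact (Equiv.mulLeft γ).tsum_eq fun δ => E.indicator (1 : SL(2, ℝ) × IndexPair → ℝ≥0∞) (move w δ p)

theorem orbitCount_preimage_mul_left (w : ℤ_[2]) (E : Set (SL(2, ℝ) × IndexPair)) (B : SL(2, ℝ))
    (p : SL(2, ℝ) × IndexPair) :
    orbitCount w ((fun p => (B * p.1, p.2)) ⁻¹' E) p = orbitCount w E (B * p.1, p.2) := by
  simp only [orbitCount, move, mul_assoc]
  rfl

theorem orbitCount_fundamentalSet_inter (w : ℤ_[2]) (A : Set Tiling) (p : SL(2, ℝ) × IndexPair) :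
    orbitCount w (fundamentalSet ×ˢ univ ∩ tilingAt w ⁻¹' A) p = A.indicator 1 (tilingAt w p) := by
  obtain ⟨γ, hγ, hu⟩ := existsUnique_mul_incl_inv_mem p.1
  rw [orbitCount, tsum_eq_single γ]
  · by_cases hA : tilingAt w p ∈ A
    · rw [indicator_of_mem hA, indicator_of_mem]
      · rfl
      · exact ⟨⟨hγ, mem_univ _⟩, by rwa [mem_preimage, tilingAt_move]⟩
    · rw [indicator_of_notMem hA, indicator_of_notMem]
      exact fun h => hA (by rw [← tilingAt_move w γ p]; exact h.2)
  · intro δ hδ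
    exact indicator_of_notMem (fun h => hδ (hu _ h.1.1)) _

/-- Two points of an orbit over K differ by a modular element in the compact set K⁻¹K, which leaves
finitely many possibilities. This makes the lifted measure finite over compact sets. -/
theorem orbitCount_le_of_isCompact (w : ℤ_[2]) {K : Set SL(2, ℝ)} (hK : IsCompact K) :
    ∃ c : ℝ≥0∞, c ≠ ⊤ ∧ ∀ p, orbitCount w (K ×ˢ univ) p ≤ c := by
  have hC : (incl ⁻¹' (K⁻¹ * K)).Finite := finite_incl_preimage (hK.inv.mul hK)
  refine ⟨(hC.toFinset.card : ℝ≥0∞), ENNReal.natCast_ne_top _, fun p => ?_⟩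
  by_cases h : ∃ γ, move w γ p ∈ K ×ˢ (univ : Set IndexPair)
  · obtain ⟨γ, hγ⟩ := h
    rw [← orbitCount_move w _ γ p]
    generalize move w γ p = q at hγ
    rw [orbitCount, ← (Equiv.inv SL(2, ℤ)).tsum_eq, tsum_eq_sum (s := hC.toFinset)]
    · have h1 (r : SL(2, ℝ) × IndexPair) :
          (K ×ˢ (univ : Set IndexPair)).indicator (1 : SL(2, ℝ) × IndexPair → ℝ≥0∞) r ≤ 1 :=
        indicator_le_self _ (1 : SL(2, ℝ) × IndexPair → ℝ≥0∞) r
      refine (Finset.sum_le_card_nsmul _ _ 1 fun δ _ => h1 _).trans ?_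
      simp
    · intro δ hδ
      refine indicator_of_notMem (fun h => hδ ?_) _
      rw [Set.Finite.mem_toFinset, mem_preimage]
      refine Set.mem_mul.mpr ⟨q.1⁻¹, Set.inv_mem_inv.mpr hγ.1, q.1 * incl δ, ?_, by simp⟩
      simpa [move] using h.1
  · push Not at h
    have : orbitCount w (K ×ˢ univ) p = 0 :=
      ENNReal.tsum_eq_zero.mpr fun γ => indicator_of_notMem (h γ) _
    rw [this]
    exact zero_le

section Lift

variable {w : ℤ_[2]} {σ : Tiling → SL(2, ℝ) × IndexPair} {μ : Measure Tiling}

/-- The lift of a measure on the nondegenerate tilings, given a section of the parametrization: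
it counts the parameters of a tiling in a given set, and averages over the tilings. -/
def liftMeasure (w : ℤ_[2]) (σ : Tiling → SL(2, ℝ) × IndexPair) (μ : Measure Tiling) :
    Measure (SL(2, ℝ) × IndexPair) :=
  Measure.sum fun γ : SL(2, ℤ) => μ.map (move w γ ∘ σ)

theorem liftMeasure_apply (hσ : Measurable σ) {E : Set (SL(2, ℝ) × IndexPair)}
    (hE : MeasurableSet E) : liftMeasure w σ μ E = ∫⁻ T, orbitCount w E (σ T) ∂μ := by
  have hm (γ : SL(2, ℤ)) : Measurable (move w γ ∘ σ) := (measurable_move w γ).comp hσ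
  rw [liftMeasure, Measure.sum_apply _ hE]
  simp only [orbitCount]
  have hi (γ : SL(2, ℤ)) : AEMeasurable
      (fun T => E.indicator (1 : SL(2, ℝ) × IndexPair → ℝ≥0∞) (move w γ (σ T))) μ :=
    ((measurable_one.indicator hE).comp (hm γ)).aemeasurable
  rw [lintegral_tsum hi]
  congr 1
  funext γ
  rw [Measure.map_apply (hm γ) hE, ← lintegral_indicator_one (hm γ hE)]
  rfl

theorem liftMeasure_preimage_move (hσ : Measurable σ) {E : Set (SL(2, ℝ) × IndexPair)}
    (hE : MeasurableSet E) (γ : SL(2, ℤ)) :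
    liftMeasure w σ μ (move w γ ⁻¹' E) = liftMeasure w σ μ E := by
  rw [liftMeasure_apply hσ hE, liftMeasure_apply hσ (measurable_move w γ hE)]
  simp only [orbitCount_preimage_move]

/-- The orbit count depends only on the tiling, not on the section, so the invariance of μ passes to
the lift. -/
theorem liftMeasure_preimage_mul_left (hσ : Measurable σ)
    (hσΨ : ∀ T ∈ range (tilingAt w), tilingAt w (σ T) = T) (hY : μ (range (tilingAt w))ᶜ = 0)
    (hμ : ∀ g : PSL2R, MeasurePreserving (fun T : Tiling => g • T) μ μ)
    {E : Set (SL(2, ℝ) × IndexPair)} (hE : MeasurableSet E) (B : SL(2, ℝ)) :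
    liftMeasure w σ μ ((fun p => (B * p.1, p.2)) ⁻¹' E) = liftMeasure w σ μ E := by
  rw [liftMeasure_apply hσ hE,
    liftMeasure_apply hσ ((measurePreserving_mul_left B).measurable hE)]
  refine Eq.trans ?_ ((hμ (toPSL B)).lintegral_comp ((measurable_orbitCount w hE).comp hσ))
  refine lintegral_congr_ae ?_
  filter_upwards [compl_mem_ae_iff.mpr hY] with T hT
  rw [compl_compl] at hT
  simp only [orbitCount_preimage_mul_left]
  apply orbitCount_eq_of_tilingAt_eq
  rw [hσΨ _ (smul_mem_range_iff.mpr hT), ← toPSL_smul_tilingAt, hσΨ _ hT]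

theorem liftMeasure_fundamentalSet_inter (hσ : Measurable σ)
    (hσΨ : ∀ T ∈ range (tilingAt w), tilingAt w (σ T) = T) (hY : μ (range (tilingAt w))ᶜ = 0)
    {A : Set Tiling} (hA : MeasurableSet A) :
    liftMeasure w σ μ (fundamentalSet ×ˢ univ ∩ tilingAt w ⁻¹' A) = μ A := by
  rw [liftMeasure_apply hσ ((measurableSet_fundamentalSet.prod MeasurableSet.univ).inter
    ((continuous_tilingAt w).measurable hA)), ← lintegral_indicator_one hA]
  refine lintegral_congr_ae ?_
  filter_upwards [compl_mem_ae_iff.mpr hY] with T hT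
  rw [compl_compl] at hT
  rw [orbitCount_fundamentalSet_inter, hσΨ _ hT]

theorem liftMeasure_prod_univ_lt_top (hσ : Measurable σ) [IsFiniteMeasure μ] {K : Set SL(2, ℝ)}
    (hK : IsCompact K) : liftMeasure w σ μ (K ×ˢ univ) < ⊤ := by
  obtain ⟨c, hc, hle⟩ := orbitCount_le_of_isCompact w hK
  rw [liftMeasure_apply hσ (hK.measurableSet.prod MeasurableSet.univ)]
  refine (lintegral_mono fun T => hle (σ T)).trans_lt ?_
  rw [lintegral_const]
  exact ENNReal.mul_lt_top hc.lt_top (measure_lt_top _ _)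

/-- For fixed A this is a left invariant measure in B, finite on compact sets, hence a multiple of
Haar measure. -/
theorem exists_liftMeasure_prod_eq (hσ : Measurable σ)
    (hσΨ : ∀ T ∈ range (tilingAt w), tilingAt w (σ T) = T) (hY : μ (range (tilingAt w))ᶜ = 0)
    (hμ : ∀ g : PSL2R, MeasurePreserving (fun T : Tiling => g • T) μ μ) [IsFiniteMeasure μ]
    {A : Set IndexPair} (hA : MeasurableSet A) :
    ∃ c : ℝ≥0∞, ∀ B, MeasurableSet B → liftMeasure w σ μ (B ×ˢ A) = c * haarSL B := by
  let m : Measure SL(2, ℝ) := ((liftMeasure w σ μ).restrict (univ ×ˢ A)).map Prod.fst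
  have hm : ∀ B, MeasurableSet B → m B = liftMeasure w σ μ (B ×ˢ A) := by
    intro B hB
    rw [Measure.map_apply measurable_fst hB, Measure.restrict_apply (measurable_fst hB)]
    congr 1
    ext p
    simp
  have h1 : m.IsMulLeftInvariant := by
    refine ⟨fun g => Measure.ext fun B hB => ?_⟩
    have hg : Measurable fun h : SL(2, ℝ) => g * h := measurable_const_mul g
    rw [Measure.map_apply hg hB, hm _ hB, hm _ (hg hB),
      ← liftMeasure_preimage_mul_left hσ hσΨ hY hμ (hB.prod hA) g]
    rfl
  have h2 : IsFiniteMeasureOnCompacts m := by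
    refine ⟨fun K hK => ?_⟩
    rw [hm K hK.measurableSet]
    exact (measure_mono (prod_mono_right (subset_univ A))).trans_lt
      (liftMeasure_prod_univ_lt_top hσ hK)
  refine ⟨Measure.haarScalarFactor m haarSL, fun B hB => ?_⟩
  rw [← hm B hB]
  conv_lhs => rw [Measure.isMulLeftInvariant_eq_smul m haarSL]
  rfl

/-- As a function of A this is a probability measure. Moving by γ shifts both factors, but the shift
of the fundamental domain does not matter because the first factor is a multiple of Haar measure,
which is right invariant under SL(2,ℤ). So the measure is invariant under `indexAction`, and unique
ergodicity on pairs applies. -/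
theorem liftMeasure_fundamentalSet_prod (hσ : Measurable σ)
    (hσΨ : ∀ T ∈ range (tilingAt w), tilingAt w (σ T) = T) (hY : μ (range (tilingAt w))ᶜ = 0)
    (hμ : ∀ g : PSL2R, MeasurePreserving (fun T : Tiling => g • T) μ μ) [IsProbabilityMeasure μ]
    {A : Set IndexPair} (hA : MeasurableSet A) :
    liftMeasure w σ μ (fundamentalSet ×ˢ A) = haarPair A := by
  let m : Measure IndexPair := ((liftMeasure w σ μ).restrict (fundamentalSet ×ˢ univ)).map Prod.snd
  have hm : ∀ A, MeasurableSet A → m A = liftMeasure w σ μ (fundamentalSet ×ˢ A) := by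
    intro A hA
    rw [Measure.map_apply measurable_snd hA, Measure.restrict_apply (measurable_snd hA)]
    congr 1
    ext p
    simp [and_comm]
  have h1 : IsProbabilityMeasure m := by
    constructor
    have := liftMeasure_fundamentalSet_inter hσ hσΨ hY MeasurableSet.univ
    rw [preimage_univ, inter_univ, measure_univ] at this
    rw [hm _ MeasurableSet.univ, this]
  rw [← hm A hA]
  congr 1
  refine eq_haarPair_of_indexAction (w := w) fun γ => Measure.ext fun A hA => ?_
  have hγ := (indexAction w γ).continuous.measurable
  rw [Measure.map_apply hγ hA, hm _ hA, hm _ (hγ hA)]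
  obtain ⟨c, hc⟩ := exists_liftMeasure_prod_eq hσ hσΨ hY hμ (hγ hA)
  have hF := (measurePreserving_mul_incl γ⁻¹).measurable measurableSet_fundamentalSet
  rw [← liftMeasure_preimage_move hσ (measurableSet_fundamentalSet.prod hA) γ]
  have : move w γ ⁻¹' (fundamentalSet ×ˢ A) =
    ((fun h => h * incl γ⁻¹) ⁻¹' fundamentalSet) ×ˢ (indexAction w γ ⁻¹' A) := rfl
  rw [this, hc _ hF, hc _ measurableSet_fundamentalSet,
    (measurePreserving_mul_incl γ⁻¹).measure_preimage
      measurableSet_fundamentalSet.nullMeasurableSet]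

theorem liftMeasure_eq (hσ : Measurable σ)
    (hσΨ : ∀ T ∈ range (tilingAt w), tilingAt w (σ T) = T) (hY : μ (range (tilingAt w))ᶜ = 0)
    (hμ : ∀ g : PSL2R, MeasurePreserving (fun T : Tiling => g • T) μ μ) [IsProbabilityMeasure μ] :
    liftMeasure w σ μ = (haarSL fundamentalSet)⁻¹ • haarSL.prod haarPair := by
  have h0 := haarSL_fundamentalSet_ne_zero
  have htop := haarSL_fundamentalSet_lt_top.ne
  have h : haarSL.prod haarPair = haarSL fundamentalSet • liftMeasure w σ μ := by
    refine Measure.prod_eq fun B A hB hA => ?_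
    obtain ⟨c, hc⟩ := exists_liftMeasure_prod_eq hσ hσΨ hY hμ hA
    rw [← liftMeasure_fundamentalSet_prod hσ hσΨ hY hμ hA, Measure.smul_apply, smul_eq_mul,
      hc _ hB, hc _ measurableSet_fundamentalSet]
    ring
  rw [h, smul_smul, ENNReal.inv_mul_cancel h0 htop, one_smul]

end Lift

theorem eq_tilingMeasure {w : ℤ_[2]} {μ : Measure Tiling} [IsProbabilityMeasure μ]
    (hc : μ (closure (range (tilingAt w)))ᶜ = 0)
    (hμ : ∀ g : PSL2R, MeasurePreserving (fun T : Tiling => g • T) μ μ) :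
    μ = tilingMeasure w := by
  have hY : μ (range (tilingAt w))ᶜ = 0 := by
    refine measure_mono_null (fun T hT => ?_)
      (measure_union_null hc (measure_closure_diff_range w μ hμ))
    by_cases h : T ∈ closure (range (tilingAt w))
    · exact Or.inr ⟨h, hT⟩
    · exact Or.inl h
  obtain ⟨σ, hσ, hσΨ⟩ := exists_measurable_section w
  refine Measure.ext fun A hA => ?_
  rw [← liftMeasure_fundamentalSet_inter hσ hσΨ hY hA, liftMeasure_eq hσ hσΨ hY hμ,
    tilingMeasure_apply w hA, Measure.smul_apply, smul_eq_mul]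

end ModifiedBinary

end

theorem theorem4 (w : ℤ_[2]) :
    ModifiedBinary.UniquelyErgodicOn ModifiedBinary.PSL2R (ModifiedBinary.tilingSpace w) := by
  have h : ModifiedBinary.tilingSpace w = closure (Set.range (ModifiedBinary.tilingAt w)) := by
    rw [ModifiedBinary.tilingSpace, ModifiedBinary.fixedSum_eq_range]
  rw [ModifiedBinary.UniquelyErgodicOn, h]
  refine ⟨ModifiedBinary.tilingMeasure w, ⟨inferInstance,
    ModifiedBinary.tilingMeasure_compl_closure w,
    ModifiedBinary.measurePreserving_tilingMeasure w⟩, ?_⟩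
  rintro μ ⟨_, hc, hμ⟩
  exact ModifiedBinary.eq_tilingMeasure hc hμ
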